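/- Let $m\ge 1$. Let $\mathcal{C}l_m$ be the real Clifford algebra with generators $e_1,\dots,e_m$ and relations $e_ie_j+e_je_i=-2\delta_{ij}$, and let $\mathcal{S}(\mathbb{R}^m)\otimes \mathcal{C}l_m$ be the complex vector space of Schwartz functions with values in the complexified Clifford algebra, with its usual topology. On it consider $\underline{x}=\sum_j e_jx_j$, $\partial_{\underline{x}}=\sum_j e_j\partial_{x_j}$ (the $e_j$ act by left multiplication), $b^{\pm}=\pm\frac{\sqrt2}{2}(\underline{x}\mp\partial_{\underline{x}})$, $h=\frac12\{b^-,b^+\}$ (which equals $\frac12(|x|^2-\Delta)$), $e=\frac14\{b^+,b^+\}$, $f=-\frac14\{b^-,b^-\}$ and the Casimir element $C=\frac14+\frac12 b^-b^+-\frac12 b^+b^-+h^2+2ef+2fe$. For each $k\ge 0$ let $\{M_k^{(\ell)}\}_\ell$ be a complex basis of the space $\mathcal{M}_k$ of spherical monogenics of degree $k$ (homogeneous polynomials of degree $k$ with values in the complexified Clifford algebra that are annihilated by $\partial_{\underline{x}}$), and put, with $L_p^\alpha$ the generalized Laguerre polynomials and $p,k\ge0$, $$\psi_{2p,k,\ell}=2^pp!\,L_p^{\frac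 m2+k-1}(|x|^2)\,M_k^{(\ell)}e^{-|x|^2/2},\qquad \psi_{2p+1,k,\ell}=2^pp!\sqrt2\,L_p^{\frac m2+k}(|x|^2)\,\underline{x}\,M_k^{(\ell)}e^{-|x|^2/2}.$$ Let $E_n(x)=\prod_{l=0}^{n-1}\frac{x^2-l^2}{n^2-l^2}$ and $D_n(x)=\prod_{l=0}^{n-1}\frac{x^2-(l+\frac12)^2}{(n+\frac12)^2-(l+\frac12)^2}$. For a sequence $a=(a_n)_{n\ge0}$ with $a_n\in\{0,1,2,3\}$ let $F(\sqrt C)$ be the series $\sum_n a_nE_n(x)$ if $m$ is odd, and $\sum_n a_nD_n(x)$ if $m$ is even, with $C$ substituted for $x^2$; on each vector of the linear span $V$ of all $\psi_{j,k,\ell}$ only finitely many terms of this series are nonzero. For a linear operator $T$ on $\mathcal{S}(\mathbb{R}^m)\otimes \mathcal{C}l_m$ consider the properties: (I) $T\circ\partial_{\underline{x}}=-i\,\underline{x}\circ T$ and $T\circ\underline{x}=-i\,\partial_{\underline{x}}\circ T$ (the Clifford-Helmholtz relations); (II) $T\psi_{j,k,\ell}=\mu_{j,k}\psi_{j,k,\ell}$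 for all $j,k,\ell$, with some $\mu_{j,k}\in\mathbb{C}$ independent of $\ell$; (III) $T^4=\mathrm{id}$. **Theorem 3.4.** (a) For every such sequence $a$ there is exactly one continuous linear operator $T_a$ on $\mathcal{S}(\mathbb{R}^m)\otimes \mathcal{C}l_m$ that is given on $V$ by $$T_a=e^{i\frac{\pi}{2}F(\sqrt C)}\,e^{i\frac{\pi}{2}(h-\frac m2)},$$ where both exponentials are the convergent exponential series, and $T_a$ satisfies (I), (II) and (III). (b) Every linear operator $T$ on $\mathcal{S}(\mathbb{R}^m)\otimes \mathcal{C}l_m$ that satisfies (I), (II) and (III) is equivalent to such an operator: there is a sequence $a$ with $T\psi_{j,k,\ell}=T_a\psi_{j,k,\ell}$ for all $j,k,\ell$. If moreover $T$ is continuous, then $T=T_a$. -/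

import Mathlib

open scoped TensorProduct SchwartzMap Nat

noncomputable section

namespace CliffordFT

/-! ### The Clifford algebra and the space of Clifford-valued Schwartz functions -/

/-- Euclidean space of dimension `m`. -/
abbrev E (m : ℕ) : Type := EuclideanSpace ℝ (Fin m)

/-- The real Clifford algebra with generators `e_1, …, e_m` and `e_i e_j + e_j e_i = -2 δ_ij`. -/
abbrev Cl (m : ℕ) : Type :=
  CliffordAlgebra (QuadraticMap.weightedSumSquares ℝ (fun _ : Fin m => (-1 : ℝ)))

/-- The generator `e_j`. -/
def gen {m : ℕ} (j : Fin m) : Cl m :=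
  CliffordAlgebra.ι (QuadraticMap.weightedSumSquares ℝ (fun _ : Fin m => (-1 : ℝ)))
    (Pi.single j 1)

/-- The space `𝓢(ℝ^m) ⊗ Cl_m`, with complex-valued Schwartz functions; it is a complex vector
space through the first factor. -/
abbrev CliffordSchwartz (m : ℕ) : Type := 𝓢(E m, ℂ) ⊗[ℝ] Cl m

/-- The component of a Clifford-valued Schwartz function along a linear functional `L` of the
Clifford algebra: `f ⊗ c ↦ L(c) f`. -/
def component {m : ℕ} (L : Module.Dual ℝ (Cl m)) : CliffordSchwartz m →ₗ[ℝ] 𝓢(E m, ℂ) :=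
  (TensorProduct.rid ℝ 𝓢(E m, ℂ)).toLinearMap ∘ₗ
    TensorProduct.map (LinearMap.id : 𝓢(E m, ℂ) →ₗ[ℝ] 𝓢(E m, ℂ)) L

/-- The usual topology on `𝓢(ℝ^m) ⊗ Cl_m` (the Clifford algebra is finite dimensional): convergence
means convergence of all components in the Schwartz space. -/
instance (m : ℕ) : TopologicalSpace (CliffordSchwartz m) :=
  ⨅ L : Module.Dual ℝ (Cl m), TopologicalSpace.induced (component L) inferInstance

/-! ### The vector variable, the Dirac operator and the realization of `osp(1|2)` -/

/-- The partial derivative `∂_{x_j}` on Schwartz functions. -/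
def partialD {m : ℕ} (j : Fin m) : 𝓢(E m, ℂ) →ₗ[ℂ] 𝓢(E m, ℂ) :=
  (LineDeriv.lineDerivOpCLM ℂ 𝓢(E m, ℂ) (EuclideanSpace.single j (1 : ℝ))).toLinearMap

/-- Multiplication by the coordinate `x_j` on Schwartz functions. -/
def coordMul {m : ℕ} (j : Fin m) : 𝓢(E m, ℂ) →ₗ[ℂ] 𝓢(E m, ℂ) :=
  (SchwartzMap.smulLeftCLM ℂ (fun x : E m => ((x j : ℝ) : ℂ))).toLinearMap

theorem hasTemperateGrowth_coord {m : ℕ} (j : Fin m) :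
    Function.HasTemperateGrowth (fun x : E m => ((x j : ℝ) : ℂ)) := by
  have h : (fun x : E m => ((x j : ℝ) : ℂ)) =
      (Complex.ofRealCLM.comp (EuclideanSpace.proj (𝕜 := ℝ) j : E m →L[ℝ] ℝ)) := by
    ext x; simp
  rw [h]
  exact ContinuousLinearMap.hasTemperateGrowth _

theorem coordMul_apply {m : ℕ} (j : Fin m) (f : 𝓢(E m, ℂ)) (x : E m) :
    coordMul j f x = ((x j : ℝ) : ℂ) * f x :=
  SchwartzMap.smulLeftCLM_apply_apply (hasTemperateGrowth_coord j) f x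

/-- The Dirac operator `∂ = ∑_j e_j ∂_{x_j}`, with `e_j` acting by left multiplication. -/
def dirac (m : ℕ) : Module.End ℂ (CliffordSchwartz m) :=
  ∑ j : Fin m, TensorProduct.AlgebraTensorModule.map (partialD j) (LinearMap.mulLeft ℝ (gen j))

/-- Multiplication by the vector variable `x = ∑_j e_j x_j` from the left. -/
def vecVar (m : ℕ) : Module.End ℂ (CliffordSchwartz m) :=
  ∑ j : Fin m, TensorProduct.AlgebraTensorModule.map (coordMul j) (LinearMap.mulLeft ℝ (gen j))

/-- `b⁺ = (√2/2) (x - ∂)`. -/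
def bPlus (m : ℕ) : Module.End ℂ (CliffordSchwartz m) :=
  (((Real.sqrt 2 / 2 : ℝ)) : ℂ) • (vecVar m - dirac m)

/-- `b⁻ = -(√2/2) (x + ∂)`. -/
def bMinus (m : ℕ) : Module.End ℂ (CliffordSchwartz m) :=
  (-((Real.sqrt 2 / 2 : ℝ)) : ℂ) • (vecVar m + dirac m)

/-- `h = ½ {b⁻, b⁺}`. -/
def hOp (m : ℕ) : Module.End ℂ (CliffordSchwartz m) :=
  (1 / 2 : ℂ) • (bMinus m * bPlus m + bPlus m * bMinus m)

/-- `e = ¼ {b⁺, b⁺}`. -/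
def eOp (m : ℕ) : Module.End ℂ (CliffordSchwartz m) :=
  (1 / 4 : ℂ) • (bPlus m * bPlus m + bPlus m * bPlus m)

/-- `f = -¼ {b⁻, b⁻}`. -/
def fOp (m : ℕ) : Module.End ℂ (CliffordSchwartz m) :=
  (-(1 / 4) : ℂ) • (bMinus m * bMinus m + bMinus m * bMinus m)

/-- The Casimir element `C = ¼ + ½ b⁻b⁺ - ½ b⁺b⁻ + h² + 2ef + 2fe` of `osp(1|2)`. -/
def casimir (m : ℕ) : Module.End ℂ (CliffordSchwartz m) :=
  (1 / 4 : ℂ) • 1 + (1 / 2 : ℂ) • (bMinus m * bPlus m) - (1 / 2 : ℂ) • (bPlus m * bMinus m)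
    + hOp m ^ 2 + (2 : ℂ) • (eOp m * fOp m) + (2 : ℂ) • (fOp m * eOp m)

/-! ### Spherical monogenics and the functions `ψ_{j,k,ℓ}` -/

/-- Clifford-valued polynomials on `ℝ^m` (with complex coefficients). -/
abbrev CliffordPoly (m : ℕ) : Type := MvPolynomial (Fin m) ℂ ⊗[ℝ] Cl m

/-- The Dirac operator on Clifford-valued polynomials. -/
def polyDirac (m : ℕ) : Module.End ℂ (CliffordPoly m) :=
  ∑ j : Fin m, TensorProduct.AlgebraTensorModule.map
    (MvPolynomial.pderiv (R := ℂ) j).toLinearMap (LinearMap.mulLeft ℝ (gen j))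

/-- Left multiplication by the vector variable on Clifford-valued polynomials. -/
def polyVecVar (m : ℕ) : Module.End ℂ (CliffordPoly m) :=
  ∑ j : Fin m, TensorProduct.AlgebraTensorModule.map
    (LinearMap.mulLeft ℂ (MvPolynomial.X j : MvPolynomial (Fin m) ℂ))
    (LinearMap.mulLeft ℝ (gen j))

/-- Multiplication of a Clifford-valued polynomial by a scalar polynomial. -/
def polyMul {m : ℕ} (q : MvPolynomial (Fin m) ℂ) : Module.End ℂ (CliffordPoly m) :=
  TensorProduct.AlgebraTensorModule.map (LinearMap.mulLeft ℂ q)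
    (LinearMap.id : Cl m →ₗ[ℝ] Cl m)

/-- The space `𝓜_k` of spherical monogenics of degree `k`: homogeneous Clifford-valued polynomials
of degree `k` in the kernel of the Dirac operator. -/
def monogenics (m k : ℕ) : Submodule ℂ (CliffordPoly m) :=
  LinearMap.range (TensorProduct.AlgebraTensorModule.map
      (MvPolynomial.homogeneousSubmodule (Fin m) ℂ k).subtype
      (LinearMap.id : Cl m →ₗ[ℝ] Cl m)) ⊓ LinearMap.ker (polyDirac m)

/-- The generalized Laguerre polynomial `L_p^α`. -/
def laguerre (p : ℕ) (α : ℝ) : Polynomial ℝ :=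
  ∑ n ∈ Finset.range (p + 1),
    Polynomial.C (Real.Gamma (p + α + 1) / ((n ! : ℝ) * ((p - n)! : ℝ) * Real.Gamma (n + α + 1)))
      * (-Polynomial.X) ^ n

/-- The polynomial `|x|² = ∑_j x_j²`. -/
def normSqPoly (m : ℕ) : MvPolynomial (Fin m) ℂ := ∑ j : Fin m, MvPolynomial.X j ^ 2

theorem gaussian_decay (m : ℕ) (k n : ℕ) : ∃ K : ℝ, ∀ x : E m,
    ‖x‖ ^ k * ‖iteratedFDeriv ℝ n (fun x : E m => Real.exp (-(‖x‖ ^ 2 / 2))) x‖ ≤ K := by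
  have hf : Function.HasTemperateGrowth (fun x : E m => -(‖x‖ ^ 2 / 2)) := by
    have h := (Function.HasTemperateGrowth.const (-(1 / 2) : ℝ)).mul
      (Function.hasTemperateGrowth_norm_sq (H := E m))
    convert! h using 1
    ext x
    simp only [Pi.mul_apply]
    ring
  obtain ⟨l, C, hC, hb⟩ := hf.norm_iteratedFDeriv_le_uniform n
  refine ⟨n ! * (1 + C) ^ n * ((k + l * n)! * Real.exp (3 / 2)), fun x => ?_⟩
  have hx := norm_nonneg x
  have key := norm_iteratedFDeriv_comp_le (𝕜 := ℝ) (n := n) (N := (n : ℕ∞)) (g := Real.exp)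
    (f := fun x : E m => -(‖x‖ ^ 2 / 2)) Real.contDiff_exp (hf.1.of_le (by exact_mod_cast le_top))
    (by exact_mod_cast le_rfl) x (C := Real.exp (-(‖x‖ ^ 2 / 2))) (D := (1 + C) * (1 + ‖x‖) ^ l)
    (fun i _ => by
      rw [norm_iteratedFDeriv_eq_norm_iteratedDeriv, iteratedDeriv_eq_iterate,
        Real.iter_deriv_exp, Real.norm_eq_abs, abs_of_pos (Real.exp_pos _)])
    (fun i hi hin => by
      refine (hb i hin x).trans ?_
      have h1 : (1 : ℝ) ≤ (1 + C) * (1 + ‖x‖) ^ l :=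
        one_le_mul_of_one_le_of_one_le (by linarith) (one_le_pow₀ (by linarith))
      have h2 : C * (1 + ‖x‖) ^ l ≤ (1 + C) * (1 + ‖x‖) ^ l := by
        gcongr
        linarith
      exact h2.trans (le_self_pow₀ h1 (by omega)))
  have key' : ‖iteratedFDeriv ℝ n (fun x : E m => Real.exp (-(‖x‖ ^ 2 / 2))) x‖ ≤
      n ! * Real.exp (-(‖x‖ ^ 2 / 2)) * ((1 + C) * (1 + ‖x‖) ^ l) ^ n := key
  have hexp : (1 + ‖x‖) ^ (k + l * n) ≤ (k + l * n)! * Real.exp (1 + ‖x‖) := by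
    have h := Real.pow_div_factorial_le_exp (1 + ‖x‖) (by linarith) (k + l * n)
    rw [div_le_iff₀ (by positivity)] at h
    linarith
  calc ‖x‖ ^ k * ‖iteratedFDeriv ℝ n (fun x : E m => Real.exp (-(‖x‖ ^ 2 / 2))) x‖
      ≤ (1 + ‖x‖) ^ k *
          (n ! * Real.exp (-(‖x‖ ^ 2 / 2)) * ((1 + C) * (1 + ‖x‖) ^ l) ^ n) := by
        gcongr
        linarith
    _ = n ! * (1 + C) ^ n * ((1 + ‖x‖) ^ (k + l * n) * Real.exp (-(‖x‖ ^ 2 / 2))) := by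
        rw [mul_pow, ← pow_mul, pow_add]
        ring
    _ ≤ n ! * (1 + C) ^ n *
          (((k + l * n)! * Real.exp (1 + ‖x‖)) * Real.exp (-(‖x‖ ^ 2 / 2))) := by
        gcongr
    _ = n ! * (1 + C) ^ n *
          ((k + l * n)! * Real.exp (1 + ‖x‖ + -(‖x‖ ^ 2 / 2))) := by
        rw [Real.exp_add (1 + ‖x‖)]
        ring
    _ ≤ n ! * (1 + C) ^ n * ((k + l * n)! * Real.exp (3 / 2)) := by
        gcongr
        nlinarith [sq_nonneg (‖x‖ - 1)]

/-- The Gaussian `e^{-|x|²/2}` as a Schwartz function. -/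
def gaussian (m : ℕ) : 𝓢(E m, ℂ) :=
  SchwartzMap.postcompCLM (𝕜 := ℝ) Complex.ofRealCLM
    { toFun := fun x => Real.exp (-(‖x‖ ^ 2 / 2))
      smooth' := by
        have h : ContDiff ℝ (⊤ : ℕ∞) (fun x : E m => ‖x‖ ^ 2) := contDiff_norm_sq ℝ
        exact Real.contDiff_exp.comp (h.div_const 2).neg
      decay' := gaussian_decay m }

theorem gaussian_apply {m : ℕ} (x : E m) :
    gaussian m x = ((Real.exp (-(‖x‖ ^ 2 / 2)) : ℝ) : ℂ) := rfl

theorem hasTemperateGrowth_poly {m : ℕ} (p : MvPolynomial (Fin m) ℂ) :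
    Function.HasTemperateGrowth
      (fun x : E m => MvPolynomial.eval (fun i => ((x i : ℝ) : ℂ)) p) := by
  induction p using MvPolynomial.induction_on with
  | C a => simp [Function.HasTemperateGrowth.const a]
  | add p q hp hq => simp only [map_add]; exact hp.add hq
  | mul_X p i hp => simp only [map_mul, MvPolynomial.eval_X]; exact hp.mul (hasTemperateGrowth_coord i)

/-- `p ↦ p(x) e^{-|x|²/2}` for scalar polynomials `p`. -/
def polyGauss (m : ℕ) : MvPolynomial (Fin m) ℂ →ₗ[ℂ] 𝓢(E m, ℂ) where
  toFun p := SchwartzMap.smulLeftCLM ℂ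
    (fun x : E m => MvPolynomial.eval (fun i => ((x i : ℝ) : ℂ)) p) (gaussian m)
  map_add' p q := by
    ext x
    rw [add_apply, SchwartzMap.smulLeftCLM_apply_apply (hasTemperateGrowth_poly _),
      SchwartzMap.smulLeftCLM_apply_apply (hasTemperateGrowth_poly _),
      SchwartzMap.smulLeftCLM_apply_apply (hasTemperateGrowth_poly _), map_add, add_smul]
  map_smul' c p := by
    ext x
    rw [RingHom.id_apply, smul_apply,
      SchwartzMap.smulLeftCLM_apply_apply (hasTemperateGrowth_poly _),
      SchwartzMap.smulLeftCLM_apply_apply (hasTemperateGrowth_poly _),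
      MvPolynomial.smul_eval, smul_eq_mul, smul_eq_mul, smul_eq_mul, mul_assoc]

theorem polyGauss_apply {m : ℕ} (p : MvPolynomial (Fin m) ℂ) (x : E m) :
    polyGauss m p x = MvPolynomial.eval (fun i => ((x i : ℝ) : ℂ)) p *
      ((Real.exp (-(‖x‖ ^ 2 / 2)) : ℝ) : ℂ) :=
  SchwartzMap.smulLeftCLM_apply_apply (hasTemperateGrowth_poly p) (gaussian m) x

/-- `P ↦ P(x) e^{-|x|²/2}` for Clifford-valued polynomials `P`. -/
def cliffordGauss (m : ℕ) : CliffordPoly m →ₗ[ℂ] CliffordSchwartz m :=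
  TensorProduct.AlgebraTensorModule.map (polyGauss m) (LinearMap.id : Cl m →ₗ[ℝ] Cl m)

/-- The function `ψ_{j,k}` built from a spherical monogenic `M` of degree `k`:
`ψ_{2p,k} = 2^p p! L_p^{m/2+k-1}(|x|²) M e^{-|x|²/2}` and
`ψ_{2p+1,k} = 2^p p! √2 L_p^{m/2+k}(|x|²) x M e^{-|x|²/2}`. -/
def psi (m j k : ℕ) (M : CliffordPoly m) : CliffordSchwartz m :=
  if Even j then
    ((2 ^ (j / 2) * (j / 2)! : ℕ) : ℂ) • cliffordGauss m
      (polyMul (Polynomial.aeval (normSqPoly m) (laguerre (j / 2) ((m : ℝ) / 2 + k - 1))) M)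
  else
    (((2 ^ (j / 2) * (j / 2)! : ℕ) : ℂ) * ((Real.sqrt 2 : ℝ) : ℂ)) • cliffordGauss m
      (polyMul (Polynomial.aeval (normSqPoly m) (laguerre (j / 2) ((m : ℝ) / 2 + k)))
        (polyVecVar m M))

/-- The linear span of all `ψ_{j,k,ℓ}`, where `M_k^{(ℓ)} = B k ℓ`. -/
def psiSpan {m : ℕ} {ι : ℕ → Type*} (B : ∀ k, Module.Basis (ι k) ℂ (monogenics m k)) :
    Submodule ℂ (CliffordSchwartz m) :=
  Submodule.span ℂ {v | ∃ (j k : ℕ) (l : ι k), v = psi m j k (B k l : CliffordPoly m)}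

/-! ### Integer-valued polynomials in the Casimir element -/

/-- The polynomial `E_n(x) = ∏_{l<n} (x² - l²)/(n² - l²)`, written as a polynomial in `t = x²`. -/
def evenPoly (n : ℕ) : Polynomial ℂ :=
  ∏ l ∈ Finset.range n,
    Polynomial.C (((n : ℂ) ^ 2 - (l : ℂ) ^ 2)⁻¹) *
      (Polynomial.X - Polynomial.C ((l : ℂ) ^ 2))

/-- The polynomial `D_n(x) = ∏_{l<n} (x² - (l+½)²)/((n+½)² - (l+½)²)`, written as a polynomial in
`t = x²`. -/
def halfPoly (n : ℕ) : Polynomial ℂ :=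
  ∏ l ∈ Finset.range n,
    Polynomial.C ((((n : ℂ) + 1 / 2) ^ 2 - ((l : ℂ) + 1 / 2) ^ 2)⁻¹) *
      (Polynomial.X - Polynomial.C (((l : ℂ) + 1 / 2) ^ 2))

/-- The operator `E_n(√C)` (for `m` odd) or `D_n(√C)` (for `m` even): the Casimir element `C` is
substituted for `x²`. -/
def casimirPoly (m n : ℕ) : Module.End ℂ (CliffordSchwartz m) :=
  Polynomial.aeval (casimir m) (if Odd m then evenPoly n else halfPoly n)

/-- The Clifford-valued Schwartz functions that are annihilated by all but finitely many of the
operators `E_n(√C)` (`m` odd), `D_n(√C)` (`m` even): the common domain of the series below. -/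
def seriesDomain (m : ℕ) : Submodule ℂ (CliffordSchwartz m) where
  carrier := {v | ∃ N, ∀ n, N ≤ n → casimirPoly m n v = 0}
  zero_mem' := ⟨0, fun n _ => map_zero _⟩
  add_mem' := by
    rintro u v ⟨N, hN⟩ ⟨N', hN'⟩
    refine ⟨max N N', fun n hn => ?_⟩
    rw [map_add, hN n (le_trans (le_max_left _ _) hn), hN' n (le_trans (le_max_right _ _) hn),
      add_zero]
  smul_mem' := by
    rintro c v ⟨N, hN⟩
    exact ⟨N, fun n hn => by rw [map_smul, hN n hn, smul_zero]⟩

theorem casimirPoly_mem {m : ℕ} (n : ℕ) {v : CliffordSchwartz m} (hv : v ∈ seriesDomain m) :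
    casimirPoly m n v ∈ seriesDomain m := by
  obtain ⟨N, hN⟩ := hv
  refine ⟨N, fun k hk => ?_⟩
  have h : casimirPoly m k * casimirPoly m n = casimirPoly m n * casimirPoly m k := by
    simp only [casimirPoly, ← map_mul, mul_comm]
  have h' := congrArg (fun A : Module.End ℂ (CliffordSchwartz m) => A v) h
  simp only [Module.End.mul_apply] at h'
  rw [h', hN k hk, map_zero]

theorem finite_support_series {m : ℕ} (a : ℕ → Fin 4) (v : seriesDomain m) :
    (Function.support fun n => ((a n : ℕ) : ℂ) • casimirPoly m n (v : CliffordSchwartz m)).Finite :=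
    by
  obtain ⟨N, hN⟩ := v.2
  refine (Set.finite_lt_nat N).subset fun n hn => ?_
  by_contra h
  exact hn (by simp only [hN n (not_lt.mp h), smul_zero])

/-- The operator `F(√C) = ∑_n a_n E_n(√C)` (`m` odd) or `∑_n a_n D_n(√C)` (`m` even), with
`a_n ∈ {0,1,2,3}`; on each vector of its domain only finitely many terms are nonzero. -/
def seriesOp (m : ℕ) (a : ℕ → Fin 4) : Module.End ℂ (seriesDomain m) where
  toFun v := ⟨∑ᶠ n, ((a n : ℕ) : ℂ) • casimirPoly m n (v : CliffordSchwartz m),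
    by
      rw [finsum_eq_sum _ (finite_support_series a v)]
      exact Submodule.sum_mem _ fun n _ =>
        Submodule.smul_mem _ _ (casimirPoly_mem n v.2)⟩
  map_add' u v := by
    ext
    simp only [Submodule.coe_add, map_add, smul_add]
    exact finsum_add_distrib (finite_support_series a u) (finite_support_series a v)
  map_smul' c v := by
    ext
    simp only [Submodule.coe_smul, map_smul, RingHom.id_apply]
    rw [smul_finsum' c (finite_support_series a v)]
    exact finsum_congr fun n => smul_comm _ _ _

/-- `w = e^A v`: the exponential series `∑_n A^n v / n!` converges to `w`. -/
def IsExp {V : Type*} [AddCommGroup V] [Module ℂ V] [TopologicalSpace V]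
    (A : Module.End ℂ V) (v w : V) : Prop :=
  HasSum (fun n : ℕ => ((n ! : ℂ)⁻¹) • (A ^ n) v) w

/-- `T` is the operator `e^{iπ/2 F(√C)} e^{iπ/2 (h - m/2)}` on `𝓢(ℝ^m) ⊗ Cl_m`: it is continuous,
and on the span of the `ψ_{j,k,ℓ}` it is given by the two exponential series. -/
structure IsExpOperator {m : ℕ} {ι : ℕ → Type*}
    (B : ∀ k, Module.Basis (ι k) ℂ (monogenics m k)) (a : ℕ → Fin 4)
    (T : Module.End ℂ (CliffordSchwartz m)) : Prop where
  continuous : Continuous T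
  exp_apply : ∀ v ∈ psiSpan B, ∃ u w : seriesDomain m,
    IsExp (((Real.pi : ℂ) / 2 * Complex.I) • (hOp m - ((m : ℂ) / 2) • 1)) v u ∧
    IsExp (((Real.pi : ℂ) / 2 * Complex.I) • seriesOp m a) u w ∧
    T v = w

/-! ### The three properties -/

/-- The Clifford-Helmholtz relations `T ∘ ∂ = -i x ∘ T` and `T ∘ x = -i ∂ ∘ T`. -/
def CliffordHelmholtz {m : ℕ} (T : Module.End ℂ (CliffordSchwartz m)) : Prop :=
  T * dirac m = (-Complex.I) • (vecVar m * T) ∧ T * vecVar m = (-Complex.I) • (dirac m * T)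

/-- `T ψ_{j,k,ℓ} = μ_{j,k} ψ_{j,k,ℓ}` with complex numbers `μ_{j,k}` that do not depend on `ℓ`. -/
def DiagonalOnPsi {m : ℕ} {ι : ℕ → Type*}
    (B : ∀ k, Module.Basis (ι k) ℂ (monogenics m k))
    (T : Module.End ℂ (CliffordSchwartz m)) : Prop :=
  ∃ μ : ℕ → ℕ → ℂ, ∀ (j k : ℕ) (l : ι k),
    T (psi m j k (B k l : CliffordPoly m)) = μ j k • psi m j k (B k l : CliffordPoly m)

/-- Two operators are equivalent if they coincide on all `ψ_{j,k,ℓ}`. -/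
def EquivalentOnPsi {m : ℕ} {ι : ℕ → Type*}
    (B : ∀ k, Module.Basis (ι k) ℂ (monogenics m k))
    (T T' : Module.End ℂ (CliffordSchwartz m)) : Prop :=
  ∀ (j k : ℕ) (l : ι k),
    T (psi m j k (B k l : CliffordPoly m)) = T' (psi m j k (B k l : CliffordPoly m))

end CliffordFT

end

open CliffordFT

open scoped TensorProduct SchwartzMap Nat

noncomputable section

namespace CliffordFT

open Filter Topology

/-! ### Completeness of the Schwartz space -/

section Complete

variable {D F : Type*} [NormedAddCommGroup D] [NormedSpace ℝ D] [NormedAddCommGroup F]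
  [NormedSpace ℝ F]

/-! The system ψ diagonalizes everything in sight. The Laguerre recurrences say exactly that
ψ_{j+1,k} = b⁺ψ_{j,k} (`psi_succ`), and from {b⁻,b⁺} = 2h one gets that h acts on ψ_{j,k,ℓ} by k +
m/2 + j and C by (k + m/2 - 1/2)² (`hOp_psi`, `casimir_psi`). So √C takes the values N (m odd) or N
+ 1/2 (m even) with N = k + ⌊(m-1)/2⌋. At such points E_n and D_n are integers, given by binomial
coefficients, and the matrix of their values is unitriangular. Hence F(√C) is an integer on each ψ,
T_a is multiplication by a power of i, and any prescribed residues modulo 4 of F at the points N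
come from exactly such digits a_n (`exists_seriesSum_eq`).

The relations (I) amount to T b⁺ = i b⁺ T and T b⁻ = -i b⁻ T. They hold for T_a because j enters its
eigenvalue as i^j. Conversely they force the eigenvalue of T on ψ_{j,k,ℓ} to be i^j μ_{0,k}, and T⁴
= 1 makes μ_{0,k} a power of i; choosing a to match its exponent modulo 4 for every k gives (b).

The analytic point is that T_a extends continuously to the whole Schwartz space, and uniquely. For
an inner product built from L² and a form on the Clifford algebra invariant under the generators, h
and C are symmetric, so ψ's with different (j,k) are orthogonal (`cliffInner_psi_eq_zero`). A
unimodular multiplier depending only on (j,k) therefore preserves every norm ‖h^n v‖. These norms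
control all Schwartz seminorms, by a Sobolev argument (`seminorm_le_hermiteNorm`), and the ψ's span
a dense subspace, because the Fischer decomposition produces all polynomials times the Gaussian and
those are dense (`dense_psiSpan`). With completeness of the Schwartz space this gives
`exists_continuous_diagonal`; density also reduces each identity between continuous operators to the
ψ's. -/

theorem summable_of_le_half_pow {c : ℕ → ℝ} (hc : ∀ i, 0 ≤ c i) {n : ℕ}
    (h : ∀ i, n ≤ i → c i ≤ (1 / 2 : ℝ) ^ i) : Summable c := by
  refine Summable.of_norm_bounded_eventually_nat summable_geometric_two ?_
  filter_upwards [eventually_ge_atTop n] with i hi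
  rw [Real.norm_eq_abs, abs_of_nonneg (hc i)]
  exact h i hi

theorem mul_norm_tsum_le {W : Type*} [NormedAddCommGroup W] {v : ℕ → W} {s : ℕ → ℝ} {t : ℝ}
    (ht : 0 ≤ t) (hv : Summable fun i => ‖v i‖) (hs : Summable s) (h : ∀ i, t * ‖v i‖ ≤ s i) :
    t * ‖∑' i, v i‖ ≤ ∑' i, s i := by
  refine (mul_le_mul_of_nonneg_left (norm_tsum_le_tsum_norm hv) ht).trans ?_
  rw [← tsum_mul_left]
  exact Summable.tsum_le_tsum h (hv.mul_left t) hs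

theorem norm_tsum_iteratedFDeriv_le (g : ℕ → 𝓢(D, F))
    (hg : ∀ k n, Summable fun i => SchwartzMap.seminorm ℝ k n (g i)) (k n : ℕ) (x : D) :
    ‖x‖ ^ k * ‖∑' i, iteratedFDeriv ℝ n (g i) x‖ ≤ ∑' i, SchwartzMap.seminorm ℝ k n (g i) := by
  refine mul_norm_tsum_le (pow_nonneg (norm_nonneg x) k) ?_ (hg k n)
    (fun i => SchwartzMap.le_seminorm ℝ k n (g i) x)
  refine Summable.of_nonneg_of_le (fun i => norm_nonneg (iteratedFDeriv ℝ n (g i) x))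
    (fun i => ?_) (hg 0 n)
  exact SchwartzMap.norm_iteratedFDeriv_le_seminorm ℝ (g i) n x

/-- A series of Schwartz functions all of whose seminorms are summable converges. -/
theorem exists_tendsto_sum_schwartz [CompleteSpace F] (g : ℕ → 𝓢(D, F))
    (hg : ∀ k n, Summable fun i => SchwartzMap.seminorm ℝ k n (g i)) :
    ∃ G : 𝓢(D, F), Tendsto (fun N => ∑ i ∈ Finset.range N, g i) atTop (𝓝 G) := by
  have hb : ∀ (n i : ℕ) (x : D), ((n : ℕ∞) ≤ (⊤ : ℕ∞)) →
      ‖iteratedFDeriv ℝ n (g i) x‖ ≤ SchwartzMap.seminorm ℝ 0 n (g i) := fun n i x _ => by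
    simpa using SchwartzMap.norm_iteratedFDeriv_le_seminorm ℝ (g i) n x
  have hsm : ∀ i, ContDiff ℝ ((⊤ : ℕ∞) : WithTop ℕ∞) (g i) := fun i => (g i).smooth ⊤
  have hder : ∀ n x, iteratedFDeriv ℝ n (fun y => ∑' i, g i y) x =
      ∑' i, iteratedFDeriv ℝ n (g i) x := fun n x =>
    iteratedFDeriv_tsum_apply hsm (fun k _ => hg 0 k) hb le_top x
  have hsum : ∀ n x, Summable fun i => iteratedFDeriv ℝ n (g i) x := fun n x =>
    Summable.of_norm_bounded (hg 0 n) fun i => hb n i x le_top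
  have htail : ∀ k n N x, ‖x‖ ^ k * ‖∑' i, iteratedFDeriv ℝ n (g (i + N)) x‖ ≤
      ∑' i, SchwartzMap.seminorm ℝ k n (g (i + N)) := fun k n N x =>
    norm_tsum_iteratedFDeriv_le (fun i => g (i + N))
      (fun k n => (summable_nat_add_iff (f := fun i => SchwartzMap.seminorm ℝ k n (g i)) N).mpr
        (hg k n)) k n x
  obtain ⟨G, hGc⟩ : ∃ G : 𝓢(D, F), (G : D → F) = fun y => ∑' i, g i y :=
    ⟨{ toFun := fun y => ∑' i, g i y
       smooth' := contDiff_tsum hsm (fun k _ => hg 0 k) hb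
       decay' := fun k n => ⟨∑' i, SchwartzMap.seminorm ℝ k n (g i), fun x => by
         rw [hder]
         exact norm_tsum_iteratedFDeriv_le g hg k n x⟩ }, rfl⟩
  apply Exists.intro G
  rw [(schwartz_withSeminorms ℝ D F).tendsto_nhds]
  rintro ⟨k, n⟩ ε hε
  have hlim := tendsto_sum_nat_add (fun i => SchwartzMap.seminorm ℝ k n (g i))
  filter_upwards [hlim.eventually (gt_mem_nhds hε)] with N hN
  change SchwartzMap.seminorm ℝ k n (∑ i ∈ Finset.range N, g i - G) < ε
  have hnn : 0 ≤ ∑' i, SchwartzMap.seminorm ℝ k n (g (i + N)) :=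
    tsum_nonneg fun i => apply_nonneg (SchwartzMap.seminorm ℝ k n) (g (i + N))
  suffices h : ∀ x : D, ‖x‖ ^ k * ‖iteratedFDeriv ℝ n (⇑(∑ i ∈ Finset.range N, g i - G)) x‖ ≤
      ∑' i, SchwartzMap.seminorm ℝ k n (g (i + N)) from
    lt_of_le_of_lt (SchwartzMap.seminorm_le_bound ℝ k n _ hnn h) hN
  intro x
  have hfun : iteratedFDeriv ℝ n (⇑(∑ i ∈ Finset.range N, g i - G)) x =
      ∑ i ∈ Finset.range N, iteratedFDeriv ℝ n (g i) x - iteratedFDeriv ℝ n G x := by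
    have h1 : (⇑(∑ i ∈ Finset.range N, g i - G) : D → F) =
        (fun y => ∑ i ∈ Finset.range N, g i y) - ⇑G := by
      ext y
      simp [sub_apply, sum_apply]
    rw [h1, iteratedFDeriv_sub_apply ((ContDiff.sum fun i _ => (g i).smooth n).contDiffAt)
      ((G.smooth n).contDiffAt)]
    congr 1
    exact iteratedFDeriv_fun_sum_apply fun i _ => ((g i).smooth n).contDiffAt
  have hG : iteratedFDeriv ℝ n G x = ∑' i, iteratedFDeriv ℝ n (g i) x := by
    rw [hGc, hder]
  -- The partial sum minus the limit is minus the tail, whose seminorms are bounded by tails of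
  -- convergent series.
  rw [hfun, hG, ← (hsum n x).sum_add_tsum_nat_add N, sub_add_cancel_left, norm_neg]
  exact htail k n N x

/-- Countably many seminorms define the uniformity, so it suffices to treat sequences whose
successive differences are below 2^{-N} in all seminorms with indices at most N; they telescope to
series with summable seminorms. -/
instance [CompleteSpace F] : CompleteSpace 𝓢(D, F) := by
  have : (uniformity 𝓢(D, F)).IsCountablyGenerated :=
    IsUniformAddGroup.uniformity_countably_generated
  have hcont : ∀ k n, Continuous (SchwartzMap.seminorm ℝ (E := D) (F := F) k n) := fun k n =>
    (schwartz_withSeminorms ℝ D F).continuous_seminorm (k, n)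
  refine UniformSpace.complete_of_convergent_controlled_sequences
    (fun N => {q : 𝓢(D, F) × 𝓢(D, F) | ∀ k ≤ N, ∀ n ≤ N,
      SchwartzMap.seminorm ℝ k n (q.2 - q.1) < (1 / 2 : ℝ) ^ N}) (fun N => ?_) fun u hu => ?_
  · rw [uniformity_eq_comap_nhds_zero]
    refine ⟨{f | ∀ k ≤ N, ∀ n ≤ N, SchwartzMap.seminorm ℝ k n f < (1 / 2 : ℝ) ^ N}, ?_,
      fun q hq => hq⟩
    have : {f : 𝓢(D, F) | ∀ k ≤ N, ∀ n ≤ N, SchwartzMap.seminorm ℝ k n f < (1 / 2 : ℝ) ^ N} =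
        ⋂ k ∈ Set.Iic N, ⋂ n ∈ Set.Iic N,
          {f | SchwartzMap.seminorm ℝ k n f < (1 / 2 : ℝ) ^ N} := by
      ext f; simp
    rw [this]
    refine (biInter_mem (Set.finite_Iic N)).mpr fun k _ =>
      (biInter_mem (Set.finite_Iic N)).mpr fun n _ => ?_
    refine (isOpen_lt (hcont k n) continuous_const).mem_nhds ?_
    simp
  · have hsum : ∀ k n, Summable fun i => SchwartzMap.seminorm ℝ k n (u (i + 1) - u i) :=
      fun k n => summable_of_le_half_pow (fun i => apply_nonneg _ _) (n := max k n) fun i hi =>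
        (hu i i (i + 1) le_rfl (by omega) k (le_trans (le_max_left _ _) hi) n
          (le_trans (le_max_right _ _) hi)).le
    obtain ⟨G, hG⟩ := exists_tendsto_sum_schwartz _ hsum
    refine ⟨G + u 0, ?_⟩
    have h2 := hG.add_const (u 0)
    refine h2.congr fun N => ?_
    rw [Finset.sum_range_sub, sub_add_cancel]

end Complete

end CliffordFT

namespace CliffordFT

open Filter Topology MeasureTheory LineDeriv

/-! ### The harmonic oscillator and the Hermite-Sobolev norms -/

section ScalarOperators

variable {m : ℕ}

theorem partialD_apply (j : Fin m) (f : 𝓢(E m, ℂ)) (x : E m) :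
    partialD j f x = fderiv ℝ f x (EuclideanSpace.single j 1) :=
  SchwartzMap.lineDerivOp_apply_eq_fderiv _ f x

theorem commute_coordMul (i j : Fin m) : Commute (coordMul (m := m) i) (coordMul j) := by
  ext f x
  simp only [Module.End.mul_apply, coordMul_apply]
  ring

theorem commute_partialD (i j : Fin m) : Commute (partialD (m := m) i) (partialD j) := by
  ext f x
  have h (u v : E m) : ∂_{u} (∂_{v} f) x = iteratedFDeriv ℝ 2 f x ![u, v] := by
    rw [← SchwartzMap.iteratedLineDerivOp_eq_iteratedFDeriv, iteratedLineDerivOp_succ_left,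
      iteratedLineDerivOp_one]
    rfl
  have hs : IsSymmSndFDerivAt ℝ f x :=
    (f.smooth 2).contDiffAt.isSymmSndFDerivAt (by simp)
  exact (h _ _).trans (hs.iteratedFDeriv_cons.trans (h _ _).symm)

theorem partialD_coordMul (i j : Fin m) (f : 𝓢(E m, ℂ)) :
    partialD i (coordMul j f) = coordMul j (partialD i f) + if i = j then f else 0 := by
  ext x
  have h1 : (coordMul j f : E m → ℂ) = fun y => ((y j : ℝ) : ℂ) * f y := by
    ext y; exact coordMul_apply j f y
  have h2 : HasFDerivAt (fun y : E m => ((y j : ℝ) : ℂ))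
      (Complex.ofRealCLM.comp (EuclideanSpace.proj (𝕜 := ℝ) j : E m →L[ℝ] ℝ)) x :=
    (Complex.ofRealCLM.comp (EuclideanSpace.proj (𝕜 := ℝ) j : E m →L[ℝ] ℝ)).hasFDerivAt
  rw [partialD_apply, h1, (h2.fun_mul (f.hasFDerivAt x)).fderiv]
  have h3 : (coordMul j (partialD i f) + if i = j then f else 0) x =
      coordMul j (partialD i f) x + if i = j then f x else 0 := by
    split_ifs <;> simp
  rw [h3, coordMul_apply, partialD_apply]
  by_cases hij : i = j
  · subst hij; simp
  · simp [hij]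

theorem partialD_coordMul_self (j : Fin m) (f : 𝓢(E m, ℂ)) :
    partialD j (coordMul j f) = coordMul j (partialD j f) + f := by
  simp [partialD_coordMul]

/-- The embedding of the Schwartz space into `L²`. -/
def toL2 (m : ℕ) : 𝓢(E m, ℂ) →L[ℂ] Lp ℂ 2 (volume : Measure (E m)) :=
  SchwartzMap.toLpCLM ℂ ℂ 2 volume

theorem toL2_injective : Function.Injective (toL2 m) := SchwartzMap.injective_toLp 2 volume

theorem inner_toL2 (f g : 𝓢(E m, ℂ)) :
    inner ℂ (toL2 m f) (toL2 m g) = ∫ x, inner ℂ (f x) (g x) :=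
  SchwartzMap.inner_toL2_toL2_eq f g volume

theorem inner_coordMul (j : Fin m) (f g : 𝓢(E m, ℂ)) :
    inner ℂ (toL2 m (coordMul j f)) (toL2 m g) = inner ℂ (toL2 m f) (toL2 m (coordMul j g)) := by
  rw [inner_toL2, inner_toL2]
  congr 1
  ext x
  simp only [coordMul_apply, RCLike.inner_apply, map_mul, Complex.conj_ofReal]
  ring

theorem inner_partialD (j : Fin m) (f g : 𝓢(E m, ℂ)) :
    inner ℂ (toL2 m (partialD j f)) (toL2 m g) =
      -inner ℂ (toL2 m f) (toL2 m (partialD j g)) := by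
  rw [inner_toL2, inner_toL2]
  have h := SchwartzMap.integral_bilinear_lineDerivOp_right_eq_neg_left (μ := volume) f g
    ((ContinuousLinearMap.mul ℝ ℂ) ∘L (Complex.conjCLE : ℂ →L[ℝ] ℂ))
    (EuclideanSpace.single j (1 : ℝ))
  have h' : ∫ x, (starRingEnd ℂ) (f x) * (partialD j g) x =
      -∫ x, (starRingEnd ℂ) ((partialD j f) x) * g x := h
  simp only [RCLike.inner_apply']
  rw [h', neg_neg]

/-- The operator `∑_j (x_j² - ∂_j²) = |x|² - Δ` on Schwartz functions. -/
def harmonic (m : ℕ) : Module.End ℂ 𝓢(E m, ℂ) :=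
  ∑ j : Fin m, (coordMul j * coordMul j - partialD j * partialD j)

theorem harmonic_apply (u : 𝓢(E m, ℂ)) :
    harmonic m u = ∑ j : Fin m, (coordMul j (coordMul j u) - partialD j (partialD j u)) := by
  simp [harmonic, LinearMap.sum_apply]

theorem inner_harmonic (u v : 𝓢(E m, ℂ)) :
    inner ℂ (toL2 m (harmonic m u)) (toL2 m v) =
      ∑ j : Fin m, (inner ℂ (toL2 m (coordMul j u)) (toL2 m (coordMul j v)) +
        inner ℂ (toL2 m (partialD j u)) (toL2 m (partialD j v))) := by
  rw [harmonic_apply, map_sum, sum_inner]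
  refine Finset.sum_congr rfl fun j _ => ?_
  rw [map_sub, inner_sub_left, inner_coordMul, inner_partialD, sub_neg_eq_add]

theorem re_inner_harmonic_self (u : 𝓢(E m, ℂ)) :
    (inner ℂ (toL2 m (harmonic m u)) (toL2 m u)).re =
      ∑ j : Fin m, (‖toL2 m (coordMul j u)‖ ^ 2 + ‖toL2 m (partialD j u)‖ ^ 2) := by
  rw [inner_harmonic, Complex.re_sum]
  refine Finset.sum_congr rfl fun j _ => ?_
  rw [Complex.add_re, inner_self_eq_norm_sq_to_K, inner_self_eq_norm_sq_to_K]
  norm_cast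

/-- The uncertainty principle: [∂_j, x_j] = 1 gives 2 Re⟨x_j u, ∂_j u⟩ = -‖u‖², and ‖x_j u + ∂_j u‖²
≥ 0. -/
theorem norm_sq_le_coordMul_add_partialD (j : Fin m) (u : 𝓢(E m, ℂ)) :
    ‖toL2 m u‖ ^ 2 ≤ ‖toL2 m (coordMul j u)‖ ^ 2 + ‖toL2 m (partialD j u)‖ ^ 2 := by
  have h1 := norm_add_sq (𝕜 := ℂ) (toL2 m (coordMul j u)) (toL2 m (partialD j u))
  have h2 : inner ℂ (toL2 m (partialD j u)) (toL2 m (coordMul j u)) =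
      -inner ℂ (toL2 m (coordMul j u)) (toL2 m (partialD j u)) - inner ℂ (toL2 m u) (toL2 m u) := by
    rw [inner_partialD, partialD_coordMul_self, map_add, inner_add_right, inner_coordMul]
    ring
  have h3 : (inner ℂ (toL2 m u) (toL2 m u)).re = ‖toL2 m u‖ ^ 2 := by
    rw [inner_self_eq_norm_sq_to_K]; norm_cast
  have h4 := congrArg Complex.re h2
  have h5 : (inner ℂ (toL2 m (partialD j u)) (toL2 m (coordMul j u))).re =
      (inner ℂ (toL2 m (coordMul j u)) (toL2 m (partialD j u))).re := by
    rw [← inner_conj_symm, Complex.conj_re]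
  rw [Complex.sub_re, Complex.neg_re, h5, h3] at h4
  change _ = _ + 2 * (inner ℂ (toL2 m (coordMul j u)) (toL2 m (partialD j u))).re + _ at h1
  nlinarith [sq_nonneg ‖toL2 m (coordMul j u) + toL2 m (partialD j u)‖]

/-- The quadratic form of |x|² - Δ is at least ‖u‖² by the uncertainty principle in one coordinate,
which must exist; Cauchy-Schwarz then compares the norms. This makes the Hermite-Sobolev norms
increasing in their order. -/
theorem norm_le_norm_harmonic (hm : 1 ≤ m) (u : 𝓢(E m, ℂ)) :
    ‖toL2 m u‖ ≤ ‖toL2 m (harmonic m u)‖ := by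
  have h1 := re_inner_harmonic_self u
  have h2 : ‖toL2 m u‖ ^ 2 ≤ (inner ℂ (toL2 m (harmonic m u)) (toL2 m u)).re := by
    rw [h1]
    refine (norm_sq_le_coordMul_add_partialD ⟨0, hm⟩ u).trans ?_
    exact Finset.single_le_sum (f := fun j : Fin m =>
      ‖toL2 m (coordMul j u)‖ ^ 2 + ‖toL2 m (partialD j u)‖ ^ 2)
      (fun j _ => by positivity) (Finset.mem_univ _)
  have h3 := (Complex.re_le_norm _).trans
    (norm_inner_le_norm (𝕜 := ℂ) (toL2 m (harmonic m u)) (toL2 m u))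
  by_contra! h
  nlinarith [norm_nonneg (toL2 m u), norm_nonneg (toL2 m (harmonic m u))]

theorem norm_coordMul_partialD_le (hm : 1 ≤ m) (j : Fin m) (u : 𝓢(E m, ℂ)) :
    ‖toL2 m (coordMul j u)‖ ^ 2 + ‖toL2 m (partialD j u)‖ ^ 2 ≤ ‖toL2 m (harmonic m u)‖ ^ 2 := by
  have h1 := re_inner_harmonic_self u
  have h2 := Finset.single_le_sum (f := fun j : Fin m =>
      ‖toL2 m (coordMul j u)‖ ^ 2 + ‖toL2 m (partialD j u)‖ ^ 2)
      (fun j _ => by positivity) (Finset.mem_univ j)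
  rw [← h1] at h2
  have h3 := (Complex.re_le_norm _).trans
    (norm_inner_le_norm (𝕜 := ℂ) (toL2 m (harmonic m u)) (toL2 m u))
  have h4 := norm_le_norm_harmonic hm u
  nlinarith [norm_nonneg (toL2 m u), norm_nonneg (toL2 m (harmonic m u))]

theorem norm_coordMul_le (hm : 1 ≤ m) (j : Fin m) (u : 𝓢(E m, ℂ)) :
    ‖toL2 m (coordMul j u)‖ ≤ ‖toL2 m (harmonic m u)‖ := by
  have h := norm_coordMul_partialD_le hm j u
  exact le_of_sq_le_sq (by nlinarith [sq_nonneg ‖toL2 m (partialD j u)‖]) (norm_nonneg _)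

theorem norm_partialD_le (hm : 1 ≤ m) (j : Fin m) (u : 𝓢(E m, ℂ)) :
    ‖toL2 m (partialD j u)‖ ≤ ‖toL2 m (harmonic m u)‖ := by
  have h := norm_coordMul_partialD_le hm j u
  exact le_of_sq_le_sq (by nlinarith [sq_nonneg ‖toL2 m (coordMul j u)‖]) (norm_nonneg _)

theorem harmonic_coordMul (j : Fin m) (u : 𝓢(E m, ℂ)) :
    harmonic m (coordMul j u) = coordMul j (harmonic m u) - (2 : ℂ) • partialD j u := by
  have hx (i : Fin m) (f : 𝓢(E m, ℂ)) : coordMul i (coordMul j f) = coordMul j (coordMul i f) :=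
    LinearMap.congr_fun (commute_coordMul i j).eq f
  have h (i : Fin m) : coordMul i (coordMul i (coordMul j u)) -
      partialD i (partialD i (coordMul j u)) =
      coordMul j (coordMul i (coordMul i u) - partialD i (partialD i u)) -
        if i = j then (2 : ℂ) • partialD j u else 0 := by
    rw [partialD_coordMul, map_add, partialD_coordMul, hx, hx, map_sub]
    by_cases hij : i = j
    · subst hij
      simp only [if_true, two_smul]
      abel
    · simp [hij]
  rw [harmonic_apply, harmonic_apply, map_sum, Finset.sum_congr rfl fun i _ => h i,
    Finset.sum_sub_distrib]
  simp

theorem harmonic_partialD (j : Fin m) (u : 𝓢(E m, ℂ)) :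
    harmonic m (partialD j u) = partialD j (harmonic m u) - (2 : ℂ) • coordMul j u := by
  have hd (i : Fin m) (f : 𝓢(E m, ℂ)) : partialD i (partialD j f) = partialD j (partialD i f) :=
    LinearMap.congr_fun (commute_partialD i j).eq f
  have h (i : Fin m) : coordMul i (coordMul i (partialD j u)) -
      partialD i (partialD i (partialD j u)) =
      partialD j (coordMul i (coordMul i u) - partialD i (partialD i u)) -
        if j = i then (2 : ℂ) • coordMul j u else 0 := by
    rw [map_sub, partialD_coordMul, partialD_coordMul, map_add, hd, hd]
    by_cases hij : j = i
    · subst hij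
      simp only [if_true, two_smul]
      abel
    · simp [hij]
  rw [harmonic_apply, harmonic_apply, map_sum, Finset.sum_congr rfl fun i _ => h i,
    Finset.sum_sub_distrib]
  simp

/-- The Hermite-Sobolev norm `‖(|x|² - Δ)^n u‖_{L²}`. -/
def hermiteNorm (m n : ℕ) (u : 𝓢(E m, ℂ)) : ℝ := ‖toL2 m ((harmonic m ^ n) u)‖

theorem hermiteNorm_nonneg (n : ℕ) (u : 𝓢(E m, ℂ)) : 0 ≤ hermiteNorm m n u := norm_nonneg _

theorem hermiteNorm_add_le (n : ℕ) (u v : 𝓢(E m, ℂ)) :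
    hermiteNorm m n (u + v) ≤ hermiteNorm m n u + hermiteNorm m n v := by
  simp only [hermiteNorm, map_add]
  exact norm_add_le _ _

theorem hermiteNorm_sub_le (n : ℕ) (u v : 𝓢(E m, ℂ)) :
    hermiteNorm m n (u - v) ≤ hermiteNorm m n u + hermiteNorm m n v := by
  simp only [hermiteNorm, map_sub]
  exact norm_sub_le _ _

theorem hermiteNorm_smul (n : ℕ) (c : ℂ) (u : 𝓢(E m, ℂ)) :
    hermiteNorm m n (c • u) = ‖c‖ * hermiteNorm m n u := by
  simp only [hermiteNorm, map_smul, norm_smul]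

theorem hermiteNorm_harmonic (n : ℕ) (u : 𝓢(E m, ℂ)) :
    hermiteNorm m n (harmonic m u) = hermiteNorm m (n + 1) u := by
  simp only [hermiteNorm, pow_succ, Module.End.mul_apply]

theorem hermiteNorm_mono (hm : 1 ≤ m) {n n' : ℕ} (h : n ≤ n') (u : 𝓢(E m, ℂ)) :
    hermiteNorm m n u ≤ hermiteNorm m n' u := by
  refine monotone_nat_of_le_succ (f := fun n => hermiteNorm m n u) (fun n => ?_) h
  simp only [hermiteNorm, pow_succ', Module.End.mul_apply]
  exact norm_le_norm_harmonic hm _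

/-- Commuting |x|² - Δ past x_j produces -2∂_j and vice versa, so both estimates must be proved in
one induction; each step costs the factor 1 + 2 = 3. -/
theorem hermiteNorm_coordMul_partialD_le (hm : 1 ≤ m) (n : ℕ) (j : Fin m) (u : 𝓢(E m, ℂ)) :
    hermiteNorm m n (coordMul j u) ≤ 3 ^ n * hermiteNorm m (n + 1) u ∧
      hermiteNorm m n (partialD j u) ≤ 3 ^ n * hermiteNorm m (n + 1) u := by
  induction n generalizing u with
  | zero =>
    simpa [hermiteNorm] using And.intro (norm_coordMul_le hm j u) (norm_partialD_le hm j u)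
  | succ n ih =>
    have hmono := hermiteNorm_mono hm (Nat.le_succ (n + 1)) u
    have h1 := ih (harmonic m u)
    have h2 := ih u
    rw [hermiteNorm_harmonic] at h1
    have hp : (0 : ℝ) < 3 ^ n := by positivity
    have h3 := mul_le_mul_of_nonneg_left hmono hp.le
    constructor
    · rw [← hermiteNorm_harmonic, harmonic_coordMul]
      refine (hermiteNorm_sub_le _ _ _).trans ?_
      rw [hermiteNorm_smul, pow_succ, Complex.norm_ofNat]
      linarith [h1.1, h2.2]
    · rw [← hermiteNorm_harmonic, harmonic_partialD]
      refine (hermiteNorm_sub_le _ _ _).trans ?_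
      rw [hermiteNorm_smul, pow_succ, Complex.norm_ofNat]
      linarith [h1.2, h2.1]

/-- Operators of finite order with respect to the Hermite-Sobolev norms. -/
def FiniteOrder (A : Module.End ℂ 𝓢(E m, ℂ)) : Prop :=
  ∃ r : ℕ, ∀ n : ℕ, ∃ C : ℝ, 0 ≤ C ∧ ∀ u, hermiteNorm m n (A u) ≤ C * hermiteNorm m (n + r) u

theorem finiteOrder_one : FiniteOrder (1 : Module.End ℂ 𝓢(E m, ℂ)) :=
  ⟨0, fun n => ⟨1, zero_le_one, fun u => by simp⟩⟩

theorem finiteOrder_partialD (hm : 1 ≤ m) (j : Fin m) : FiniteOrder (partialD (m := m) j) :=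
  ⟨1, fun n => ⟨3 ^ n, by positivity, fun u => (hermiteNorm_coordMul_partialD_le hm n j u).2⟩⟩

theorem FiniteOrder.mul {A A' : Module.End ℂ 𝓢(E m, ℂ)} (hA : FiniteOrder A)
    (hA' : FiniteOrder A') : FiniteOrder (A * A') := by
  obtain ⟨r, h⟩ := hA
  obtain ⟨r', h'⟩ := hA'
  refine ⟨r + r', fun n => ?_⟩
  obtain ⟨C, hC, hb⟩ := h n
  obtain ⟨C', hC', hb'⟩ := h' (n + r)
  refine ⟨C * C', mul_nonneg hC hC', fun u => (hb _).trans ?_⟩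
  rw [mul_assoc, ← add_assoc]
  exact mul_le_mul_of_nonneg_left (hb' u) hC

theorem FiniteOrder.add (hm : 1 ≤ m) {A A' : Module.End ℂ 𝓢(E m, ℂ)} (hA : FiniteOrder A)
    (hA' : FiniteOrder A') : FiniteOrder (A + A') := by
  obtain ⟨r, h⟩ := hA
  obtain ⟨r', h'⟩ := hA'
  refine ⟨max r r', fun n => ?_⟩
  obtain ⟨C, hC, hb⟩ := h n
  obtain ⟨C', hC', hb'⟩ := h' n
  refine ⟨C + C', add_nonneg hC hC', fun u => (hermiteNorm_add_le _ _ _).trans ?_⟩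
  rw [add_mul]
  refine add_le_add ((hb u).trans ?_) ((hb' u).trans ?_)
  · exact mul_le_mul_of_nonneg_left (hermiteNorm_mono hm (by omega) u) hC
  · exact mul_le_mul_of_nonneg_left (hermiteNorm_mono hm (by omega) u) hC'

theorem FiniteOrder.smul {A : Module.End ℂ 𝓢(E m, ℂ)} (hA : FiniteOrder A) (c : ℂ) :
    FiniteOrder (c • A) := by
  obtain ⟨r, h⟩ := hA
  refine ⟨r, fun n => ?_⟩
  obtain ⟨C, hC, hb⟩ := h n
  refine ⟨‖c‖ * C, by positivity, fun u => ?_⟩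
  rw [LinearMap.smul_apply, hermiteNorm_smul, mul_assoc]
  exact mul_le_mul_of_nonneg_left (hb u) (norm_nonneg c)

theorem FiniteOrder.sum (hm : 1 ≤ m) {ι : Type*} (s : Finset ι)
    {A : ι → Module.End ℂ 𝓢(E m, ℂ)} (hA : ∀ i ∈ s, FiniteOrder (A i)) :
    FiniteOrder (∑ i ∈ s, A i) := by
  classical
  induction s using Finset.induction_on with
  | empty => exact ⟨0, fun n => ⟨0, le_rfl, fun u => by simp [hermiteNorm]⟩⟩
  | insert i s hi ih =>
    rw [Finset.sum_insert hi]
    exact (hA i (Finset.mem_insert_self i s)).add hm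
      (ih fun j hj => hA j (Finset.mem_insert_of_mem hj))

theorem FiniteOrder.pow {A : Module.End ℂ 𝓢(E m, ℂ)} (hA : FiniteOrder A) (n : ℕ) :
    FiniteOrder (A ^ n) := by
  induction n with
  | zero => exact finiteOrder_one
  | succ n ih => rw [pow_succ]; exact ih.mul hA

end ScalarOperators
end CliffordFT

namespace CliffordFT

open Filter Topology MeasureTheory LineDeriv FourierTransform

/-! ### Schwartz seminorms are bounded by Hermite-Sobolev norms -/

section Sobolev

variable {m : ℕ}

theorem fourierInv_partialD (j : Fin m) (f : 𝓢(E m, ℂ)) :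
    𝓕⁻ (partialD j f) = (-(2 * Real.pi * Complex.I) : ℂ) • coordMul j (𝓕⁻ f) := by
  have h := SchwartzMap.fourierInv_lineDerivOp_eq f (EuclideanSpace.single j (1 : ℝ))
  refine Eq.trans h ?_
  congr 1
  ext x
  have hg : Function.HasTemperateGrowth
      fun x : E m => inner ℝ x (EuclideanSpace.single j (1 : ℝ)) := by
    fun_prop
  rw [SchwartzMap.smulLeftCLM_apply_apply hg, coordMul_apply]
  simp [EuclideanSpace.inner_single_right]

theorem coordMul_fourierInv (j : Fin m) (f : 𝓢(E m, ℂ)) :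
    coordMul j (𝓕⁻ f) = 𝓕⁻ (((-(2 * Real.pi * Complex.I) : ℂ)⁻¹ • partialD j) f) := by
  have h0 : (-(2 * Real.pi * Complex.I) : ℂ) ≠ 0 :=
    neg_ne_zero.mpr Complex.two_pi_I_ne_zero
  rw [LinearMap.smul_apply, fourierInv_smul, fourierInv_partialD, smul_smul, inv_mul_cancel₀ h0,
    one_smul]

/-- Multiplication by `1 + |x|²`. -/
def japaneseSq (m : ℕ) : Module.End ℂ 𝓢(E m, ℂ) := 1 + ∑ j : Fin m, coordMul j * coordMul j

/-- The operator conjugate to `1 + |x|²` under the Fourier transform. -/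
def besselSq (m : ℕ) : Module.End ℂ 𝓢(E m, ℂ) :=
  1 + ∑ j : Fin m, ((-(2 * Real.pi * Complex.I) : ℂ)⁻¹ • partialD j) *
    ((-(2 * Real.pi * Complex.I) : ℂ)⁻¹ • partialD j)

theorem japaneseSq_apply (f : 𝓢(E m, ℂ)) (x : E m) :
    japaneseSq m f x = ((1 + ‖x‖ ^ 2 : ℝ) : ℂ) * f x := by
  rw [EuclideanSpace.norm_sq_eq]
  simp only [japaneseSq, LinearMap.add_apply, Module.End.one_apply, LinearMap.sum_apply,
    Module.End.mul_apply, add_apply, sum_apply, coordMul_apply]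
  push_cast
  rw [add_mul, one_mul, Finset.sum_mul]
  congr 1
  refine Finset.sum_congr rfl fun j _ => ?_
  rw [Real.norm_eq_abs, ← Complex.ofReal_pow, sq_abs]
  push_cast
  ring

theorem japaneseSq_pow_apply (k : ℕ) (f : 𝓢(E m, ℂ)) (x : E m) :
    (japaneseSq m ^ k) f x = (((1 + ‖x‖ ^ 2) ^ k : ℝ) : ℂ) * f x := by
  induction k with
  | zero => simp
  | succ k ih =>
    rw [pow_succ', Module.End.mul_apply, japaneseSq_apply, ih, pow_succ']
    push_cast
    ring

theorem japaneseSq_fourierInv (f : 𝓢(E m, ℂ)) : japaneseSq m (𝓕⁻ f) = 𝓕⁻ (besselSq m f) := by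
  simp only [japaneseSq, besselSq, LinearMap.add_apply, Module.End.one_apply, LinearMap.sum_apply,
    Module.End.mul_apply, coordMul_fourierInv, fourierInv_add, fourierInv_sum]

theorem japaneseSq_pow_fourierInv (k : ℕ) (f : 𝓢(E m, ℂ)) :
    (japaneseSq m ^ k) (𝓕⁻ f) = 𝓕⁻ ((besselSq m ^ k) f) := by
  induction k with
  | zero => simp
  | succ k ih =>
    rw [pow_succ', Module.End.mul_apply, ih, japaneseSq_fourierInv, pow_succ', Module.End.mul_apply]

theorem finiteOrder_besselSq (hm : 1 ≤ m) : FiniteOrder (besselSq m) :=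
  finiteOrder_one.add hm (FiniteOrder.sum hm _ fun j _ =>
    ((finiteOrder_partialD hm j).smul _).mul ((finiteOrder_partialD hm j).smul _))

theorem norm_toL2_fourierInv (f : 𝓢(E m, ℂ)) : ‖toL2 m (𝓕⁻ f)‖ = ‖toL2 m f‖ := by
  have h := SchwartzMap.norm_fourier_toL2_eq (𝓕⁻ f)
  rw [FourierTransform.fourier_fourierInv_eq] at h
  exact h.symm

/-- Cauchy-Schwarz for g = (1+|x|)^{-k} · (1+|x|)^k g, where k is so large that the first factor is
in L², together with 1 + |x| ≤ 2(1 + |x|²). -/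
theorem norm_toLp_one_le (m : ℕ) : ∃ (k : ℕ) (C : ℝ), 0 ≤ C ∧ ∀ g : 𝓢(E m, ℂ),
    ‖g.toLp 1‖ ≤ C * ‖toL2 m ((japaneseSq m ^ k) g)‖ := by
  obtain ⟨k, hk⟩ := (inferInstance :
    (volume : Measure (E m)).HasTemperateGrowth).exists_eLpNorm_lt_top 2
  refine ⟨k, (eLpNorm (fun x : E m ↦ (1 + ‖x‖) ^ (-k : ℝ)) 2 volume).toReal * 2 ^ k,
    by positivity, fun g => ?_⟩
  have hpos (x : E m) : 0 < 1 + ‖x‖ := lt_add_of_pos_of_le zero_lt_one (norm_nonneg x)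
  have h1 : eLpNorm g 1 volume ≤ eLpNorm (fun x : E m ↦ (1 + ‖x‖) ^ (-k : ℝ)) 2 volume *
      eLpNorm ((2 ^ k : ℝ) • ⇑((japaneseSq m ^ k) g)) 2 volume := by
    have he : (g : E m → ℂ) =
        (fun x : E m ↦ (1 + ‖x‖) ^ (-k : ℝ)) • fun x => ((1 + ‖x‖) ^ k : ℝ) • g x := by
      ext x
      simp only [Pi.smul_apply', smul_smul]
      rw [Real.rpow_neg (hpos x).le, Real.rpow_natCast,
        inv_mul_cancel₀ (pow_ne_zero _ (hpos x).ne'), one_smul]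
    have hc1 : Continuous fun x : E m ↦ (1 + ‖x‖) ^ (-k : ℝ) :=
      .rpow_const (by fun_prop) fun x ↦ .inl (hpos x).ne'
    have hc2 : Continuous fun x : E m => ((1 + ‖x‖) ^ k : ℝ) • g x := by fun_prop
    calc eLpNorm g 1 volume = eLpNorm ((fun x : E m ↦ (1 + ‖x‖) ^ (-k : ℝ)) •
          fun x => ((1 + ‖x‖) ^ k : ℝ) • g x) 1 volume := congrArg (eLpNorm · 1 volume) he
      _ ≤ _ := eLpNorm_smul_le_mul_eLpNorm (p := 2) (q := 2) (r := 1)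
          hc2.aestronglyMeasurable hc1.aestronglyMeasurable
      _ ≤ _ := by
        gcongr
        refine eLpNorm_mono fun x => ?_
        rw [Pi.smul_apply, japaneseSq_pow_apply, norm_smul, norm_smul, norm_mul, ← mul_assoc,
          Complex.norm_real]
        gcongr
        rw [← norm_mul, ← mul_pow, norm_pow, norm_pow]
        gcongr
        rw [Real.norm_of_nonneg (hpos x).le, Real.norm_of_nonneg (by positivity)]
        nlinarith [sq_nonneg (‖x‖ - 1), norm_nonneg x]
  have h2 : (eLpNorm ((2 ^ k : ℝ) • ⇑((japaneseSq m ^ k) g)) 2 volume).toReal =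
      2 ^ k * ‖toL2 m ((japaneseSq m ^ k) g)‖ := by
    rw [eLpNorm_const_smul, ENNReal.toReal_mul]
    congr 1
    · simp
    · exact (SchwartzMap.norm_toLp).symm
  have h3 : eLpNorm ((2 ^ k : ℝ) • ⇑((japaneseSq m ^ k) g)) 2 volume ≠ ⊤ :=
    ((((japaneseSq m ^ k) g).memLp 2 volume).const_smul (2 ^ k : ℝ)).eLpNorm_ne_top
  rw [SchwartzMap.norm_toLp, mul_assoc, ← h2, ← ENNReal.toReal_mul]
  exact ENNReal.toReal_mono (ENNReal.mul_ne_top hk.ne h3) h1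

/-- Sobolev embedding: |f| is at most the L¹ norm of its inverse Fourier transform, hence at most a
weighted L² norm of that; by Plancherel the latter is the L² norm of a power of `besselSq` applied
to f. -/
theorem norm_apply_le_hermiteNorm (hm : 1 ≤ m) : ∃ (N : ℕ) (C : ℝ), 0 ≤ C ∧
    ∀ (f : 𝓢(E m, ℂ)) (x : E m), ‖f x‖ ≤ C * hermiteNorm m N f := by
  obtain ⟨k, C, hC, h⟩ := norm_toLp_one_le m
  obtain ⟨r, hr⟩ := (finiteOrder_besselSq hm).pow k
  obtain ⟨C', hC', hb⟩ := hr 0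
  refine ⟨0 + r, C * C', mul_nonneg hC hC', fun f x => ?_⟩
  have h1 := SchwartzMap.norm_fourier_apply_le_toLp_one (𝓕⁻ f) x
  rw [FourierTransform.fourier_fourierInv_eq] at h1
  refine h1.trans ((h _).trans ?_)
  rw [japaneseSq_pow_fourierInv, norm_toL2_fourierInv, mul_assoc]
  exact mul_le_mul_of_nonneg_left (hb f) hC

theorem norm_le_sum_coord (x : E m) : ‖x‖ ≤ ∑ j : Fin m, ‖x j‖ := by
  have h : x = ∑ j, x j • EuclideanSpace.single j (1 : ℝ) := by
    ext i
    simp [Finset.sum_apply, Pi.single_apply]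
  calc ‖x‖ = ‖∑ j, x j • EuclideanSpace.single j (1 : ℝ)‖ := by rw [← h]
    _ ≤ ∑ j, ‖x j • EuclideanSpace.single j (1 : ℝ)‖ := norm_sum_le _ _
    _ = _ := by simp [norm_smul]

/-- Since |x| ≤ ∑|x_j|, one more power of |x| on f is absorbed by passing to the functions x_j f,
which costs one Hermite order. -/
theorem seminorm_zero_le_hermiteNorm (hm : 1 ≤ m) (k : ℕ) : ∃ (N : ℕ) (C : ℝ), 0 ≤ C ∧
    ∀ f : 𝓢(E m, ℂ), SchwartzMap.seminorm ℝ k 0 f ≤ C * hermiteNorm m N f := by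
  induction k with
  | zero =>
    obtain ⟨N, C, hC, h⟩ := norm_apply_le_hermiteNorm hm
    refine ⟨N, C, hC, fun f => SchwartzMap.seminorm_le_bound ℝ _ _ f
      (mul_nonneg hC (hermiteNorm_nonneg _ _)) fun x => ?_⟩
    simpa using h f x
  | succ k ih =>
    obtain ⟨N, C, hC, h⟩ := ih
    refine ⟨N + 1, m * (C * 3 ^ N), by positivity, fun f => SchwartzMap.seminorm_le_bound ℝ _ _ f
      (by have := hermiteNorm_nonneg (N + 1) f; positivity) fun x => ?_⟩
    have h1 (j : Fin m) : ‖x‖ ^ k * (‖x j‖ * ‖f x‖) ≤ C * 3 ^ N * hermiteNorm m (N + 1) f := by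
      have h2 := SchwartzMap.le_seminorm ℝ k 0 (coordMul j f) x
      rw [norm_iteratedFDeriv_zero, coordMul_apply, norm_mul, Complex.norm_real] at h2
      refine h2.trans ((h _).trans ?_)
      rw [mul_assoc]
      exact mul_le_mul_of_nonneg_left (hermiteNorm_coordMul_partialD_le hm N j f).1 hC
    rw [norm_iteratedFDeriv_zero, pow_succ]
    calc ‖x‖ ^ k * ‖x‖ * ‖f x‖ ≤ ‖x‖ ^ k * (∑ j : Fin m, ‖x j‖) * ‖f x‖ := by
          gcongr
          exact norm_le_sum_coord x
      _ = ∑ j : Fin m, ‖x‖ ^ k * (‖x j‖ * ‖f x‖) := by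
          rw [Finset.mul_sum, Finset.sum_mul]
          exact Finset.sum_congr rfl fun j _ => by ring
      _ ≤ ∑ j : Fin m, C * 3 ^ N * hermiteNorm m (N + 1) f := Finset.sum_le_sum fun j _ => h1 j
      _ = _ := by
          rw [Finset.sum_const, Finset.card_univ, Fintype.card_fin, nsmul_eq_mul]
          ring

/-- The derivative is ∑_j dx_j ⊗ ∂_j f, and tensoring with dx_j is a linear map of norm at most 1.
-/
theorem norm_iteratedFDeriv_succ_le (n : ℕ) (f : 𝓢(E m, ℂ)) (x : E m) :
    ‖iteratedFDeriv ℝ (n + 1) f x‖ ≤ ∑ j : Fin m, ‖iteratedFDeriv ℝ n (partialD j f) x‖ := by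
  let S (j : Fin m) : ℂ →L[ℝ] (E m →L[ℝ] ℂ) :=
    ContinuousLinearMap.smulRightL ℝ (E m) ℂ (EuclideanSpace.proj (𝕜 := ℝ) j : E m →L[ℝ] ℝ)
  have hS (j : Fin m) : ‖S j‖ ≤ 1 := by
    refine ContinuousLinearMap.opNorm_le_bound _ zero_le_one fun z => ?_
    refine ContinuousLinearMap.opNorm_le_bound _ (by positivity) fun y => ?_
    simp only [S, ContinuousLinearMap.smulRightL_apply_apply,
      ContinuousLinearMap.smulRight_apply, norm_smul, one_mul]
    rw [mul_comm]
    gcongr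
    exact PiLp.norm_apply_le y j
  have hf : fderiv ℝ f = fun y => ∑ j : Fin m, S j (partialD j f y) := by
    ext1 y
    ext1 z
    have hz : z = ∑ j, z j • EuclideanSpace.single j (1 : ℝ) := by
      ext i
      simp [Finset.sum_apply, Pi.single_apply]
    simp only [sum_apply, S, partialD_apply,
      ContinuousLinearMap.smulRightL_apply_apply, ContinuousLinearMap.smulRight_apply]
    conv_lhs => rw [hz]
    rw [map_sum]
    exact Finset.sum_congr rfl fun j _ => by rw [map_smul]; rfl
  rw [← norm_iteratedFDeriv_fderiv, hf, iteratedFDeriv_fun_sum_apply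
    (f := fun j y => S j (partialD j f y)) fun j _ =>
    ((S j).contDiff.comp ((partialD j f).smooth n)).contDiffAt]
  refine (norm_sum_le _ _).trans (Finset.sum_le_sum fun j _ => ?_)
  have h := (S j).norm_iteratedFDeriv_comp_left (f := partialD j f) (x := x) (N := n)
    (n := n) ((partialD j f).smooth n).contDiffAt le_rfl
  exact h.trans (mul_le_of_le_one_left (norm_nonneg _) (hS j))

/-- The Hermite-Sobolev norms generate the topology of the Schwartz space. -/
theorem seminorm_le_hermiteNorm (hm : 1 ≤ m) (k n : ℕ) : ∃ (N : ℕ) (C : ℝ), 0 ≤ C ∧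
    ∀ f : 𝓢(E m, ℂ), SchwartzMap.seminorm ℝ k n f ≤ C * hermiteNorm m N f := by
  induction n with
  | zero => exact seminorm_zero_le_hermiteNorm hm k
  | succ n ih =>
    obtain ⟨N, C, hC, h⟩ := ih
    refine ⟨N + 1, m * (C * 3 ^ N), by positivity, fun f => SchwartzMap.seminorm_le_bound ℝ _ _ f
      (by have := hermiteNorm_nonneg (N + 1) f; positivity) fun x => ?_⟩
    have h1 (j : Fin m) : ‖x‖ ^ k * ‖iteratedFDeriv ℝ n (partialD j f) x‖ ≤
        C * 3 ^ N * hermiteNorm m (N + 1) f := by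
      refine (SchwartzMap.le_seminorm ℝ k n (partialD j f) x).trans ((h _).trans ?_)
      rw [mul_assoc]
      exact mul_le_mul_of_nonneg_left (hermiteNorm_coordMul_partialD_le hm N j f).2 hC
    calc ‖x‖ ^ k * ‖iteratedFDeriv ℝ (n + 1) f x‖
        ≤ ‖x‖ ^ k * ∑ j : Fin m, ‖iteratedFDeriv ℝ n (partialD j f) x‖ := by
          gcongr
          exact norm_iteratedFDeriv_succ_le n f x
      _ ≤ ∑ j : Fin m, C * 3 ^ N * hermiteNorm m (N + 1) f := by
          rw [Finset.mul_sum]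
          exact Finset.sum_le_sum fun j _ => h1 j
      _ = _ := by
          rw [Finset.sum_const, Finset.card_univ, Fintype.card_fin, nsmul_eq_mul]
          ring

end Sobolev
end CliffordFT

namespace CliffordFT

open Filter Topology MeasureTheory LineDeriv FourierTransform

/-! ### Polynomials times the Gaussian -/

section PolyGauss

variable {m : ℕ}

theorem coordMul_polyGauss (j : Fin m) (p : MvPolynomial (Fin m) ℂ) :
    coordMul j (polyGauss m p) = polyGauss m (MvPolynomial.X j * p) := by
  ext x
  rw [coordMul_apply, polyGauss_apply, polyGauss_apply, map_mul, MvPolynomial.eval_X, mul_assoc]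

theorem polyGauss_one : polyGauss m 1 = gaussian m := by
  ext x
  rw [polyGauss_apply, map_one, one_mul, gaussian_apply]

theorem partialD_gaussian (j : Fin m) : partialD j (gaussian m) = -coordMul j (gaussian m) := by
  ext x
  have h1 : HasFDerivAt (fun x : E m => Real.exp (-(‖x‖ ^ 2 / 2)))
      (Real.exp (-(‖x‖ ^ 2 / 2)) • -((1 / 2 : ℝ) • ((2 : ℝ) • innerSL ℝ x))) x := by
    have h2 := ((hasStrictFDerivAt_norm_sq x).hasFDerivAt.const_smul (1 / 2 : ℝ)).fun_neg.exp
    have h3 : (fun y : E m => Real.exp (-(((1 / 2 : ℝ) • fun z : E m => ‖z‖ ^ 2) y))) =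
        fun y => Real.exp (-(‖y‖ ^ 2 / 2)) := by
      ext y
      rw [Pi.smul_apply, smul_eq_mul]
      ring_nf
    rw [h3, congrFun h3 x] at h2
    simpa [two_smul] using h2
  have h3 : HasFDerivAt (gaussian m) _ x := Complex.ofRealCLM.hasFDerivAt.comp x h1
  rw [partialD_apply, h3.fderiv, neg_apply, coordMul_apply, gaussian_apply]
  simp [EuclideanSpace.inner_single_right]
  ring

theorem partialD_polyGauss (j : Fin m) (p : MvPolynomial (Fin m) ℂ) :
    partialD j (polyGauss m p) =
      polyGauss m (MvPolynomial.pderiv j p - MvPolynomial.X j * p) := by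
  induction p using MvPolynomial.induction_on with
  | C a =>
    have h : (MvPolynomial.C a : MvPolynomial (Fin m) ℂ) = a • 1 := by
      rw [MvPolynomial.smul_eq_C_mul, mul_one]
    rw [MvPolynomial.pderiv_C, zero_sub, map_neg, ← coordMul_polyGauss, h, map_smul, map_smul,
      map_smul, polyGauss_one, partialD_gaussian, smul_neg]
  | add p q hp hq =>
    rw [map_add, map_add, hp, hq, ← map_add]
    congr 1
    rw [map_add]
    ring
  | mul_X p i hp =>
    rw [mul_comm p, ← coordMul_polyGauss, partialD_coordMul, hp, coordMul_polyGauss]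
    have h : (if j = i then polyGauss m p else 0) = polyGauss m (if j = i then p else 0) := by
      split_ifs <;> simp
    rw [h, ← map_add]
    congr 1
    rw [Derivation.leibniz, MvPolynomial.pderiv_X, smul_eq_mul, smul_eq_mul]
    by_cases hij : j = i
    · subst hij
      simp
      ring
    · simp [hij, Ne.symm hij]
      ring

/-- The polynomial operator conjugate to `|x|² - Δ` under multiplication by the Gaussian. -/
def polyHarmonic (m : ℕ) : Module.End ℂ (MvPolynomial (Fin m) ℂ) :=
  ∑ j : Fin m, (1 + (2 : ℂ) • (LinearMap.mulLeft ℂ (MvPolynomial.X j) *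
    (MvPolynomial.pderiv (R := ℂ) j).toLinearMap) -
    (MvPolynomial.pderiv (R := ℂ) j).toLinearMap * (MvPolynomial.pderiv (R := ℂ) j).toLinearMap)

theorem harmonic_polyGauss (p : MvPolynomial (Fin m) ℂ) :
    harmonic m (polyGauss m p) = polyGauss m (polyHarmonic m p) := by
  rw [harmonic_apply, polyHarmonic, LinearMap.sum_apply, map_sum]
  refine Finset.sum_congr rfl fun j _ => ?_
  rw [coordMul_polyGauss, coordMul_polyGauss, partialD_polyGauss, partialD_polyGauss, ← map_sub]
  congr 1
  simp only [map_sub, Derivation.leibniz, MvPolynomial.pderiv_X_self, smul_eq_mul,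
    LinearMap.sub_apply, LinearMap.add_apply, Module.End.mul_apply,
    Module.End.one_apply, LinearMap.mulLeft_apply, Derivation.coeFn_coe, two_smul]
  ring

theorem polyHarmonic_monomial (s : Fin m →₀ ℕ) :
    polyHarmonic m (MvPolynomial.monomial s 1) =
      ((m : ℂ) + 2 * (s.degree : ℂ)) • MvPolynomial.monomial s 1 -
      ∑ j : Fin m, MvPolynomial.pderiv j (MvPolynomial.pderiv j (MvPolynomial.monomial s 1)) := by
  simp only [polyHarmonic, LinearMap.sum_apply, LinearMap.sub_apply, LinearMap.add_apply,
    LinearMap.smul_apply, Module.End.mul_apply, Module.End.one_apply, LinearMap.mulLeft_apply,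
    Derivation.coeFn_coe, MvPolynomial.X_mul_pderiv_monomial]
  rw [Finset.sum_sub_distrib, Finset.sum_add_distrib]
  congr 1
  rw [add_smul, Finset.sum_const, Finset.card_univ, Fintype.card_fin, ← Nat.cast_smul_eq_nsmul ℂ,
    mul_smul, ← Finset.smul_sum, ← Finset.sum_smul]
  congr 2
  rw [← Nat.cast_smul_eq_nsmul ℂ, Finsupp.degree_eq_sum]

/-- The operator is triangular for the degree: it multiplies a monomial of degree d by m + 2d ≠ 0
and adds terms of lower degree, which strong induction handles. -/
theorem polyHarmonic_surjective (hm : 1 ≤ m) : Function.Surjective (polyHarmonic m) := by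
  rw [← LinearMap.range_eq_top]
  have key : ∀ (d : ℕ) (s : Fin m →₀ ℕ), s.degree = d →
      MvPolynomial.monomial s (1 : ℂ) ∈ LinearMap.range (polyHarmonic m) := by
    intro d
    induction d using Nat.strong_induction_on with
    | _ d ih =>
      intro s hs
      have h1 := polyHarmonic_monomial s
      have hne : ((m : ℂ) + 2 * (s.degree : ℂ)) ≠ 0 := by
        norm_cast
        omega
      have h2 : ∑ j : Fin m, MvPolynomial.pderiv j (MvPolynomial.pderiv j
          (MvPolynomial.monomial s (1 : ℂ))) ∈ LinearMap.range (polyHarmonic m) := by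
        refine Submodule.sum_mem _ fun j _ => ?_
        rw [MvPolynomial.pderiv_monomial, MvPolynomial.pderiv_monomial]
        by_cases hsj : s j = 0
        · simp [hsj]
        rw [← mul_one (_ * _ : ℂ), ← smul_eq_mul, ← MvPolynomial.smul_monomial]
        refine Submodule.smul_mem _ _ (ih _ ?_ _ rfl)
        have h3 : (s - Finsupp.single j 1 - Finsupp.single j 1).degree ≤
            (s - Finsupp.single j 1).degree := Finsupp.degree_mono tsub_le_self
        have h4 : (s - Finsupp.single j 1) + Finsupp.single j 1 = s := by
          refine tsub_add_cancel_of_le ?_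
          rw [Finsupp.single_le_iff]
          omega
        have h5 := congrArg Finsupp.degree h4
        rw [map_add, Finsupp.degree_single] at h5
        omega
      have h6 : ((m : ℂ) + 2 * (s.degree : ℂ)) • MvPolynomial.monomial s (1 : ℂ) ∈
          LinearMap.range (polyHarmonic m) := by
        rw [sub_eq_iff_eq_add.mp h1.symm]
        exact Submodule.add_mem _ ⟨_, rfl⟩ h2
      exact (Submodule.smul_mem_iff _ hne).mp h6
  rw [eq_top_iff]
  rintro p -
  rw [p.as_sum]
  refine Submodule.sum_mem _ fun s _ => ?_
  rw [← mul_one (MvPolynomial.coeff s p), ← smul_eq_mul, ← MvPolynomial.smul_monomial]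
  exact Submodule.smul_mem _ _ (key _ s rfl)

/-- This upgrades L² approximation to approximation in the n-th Hermite-Sobolev norm: an approximant
of (|x|² - Δ)^n f can be pulled back to one of f. -/
theorem exists_harmonic_pow_polyGauss (hm : 1 ≤ m) (n : ℕ) (p : MvPolynomial (Fin m) ℂ) :
    ∃ q, (harmonic m ^ n) (polyGauss m q) = polyGauss m p := by
  induction n generalizing p with
  | zero => exact ⟨p, by simp⟩
  | succ n ih =>
    obtain ⟨q, hq⟩ := ih p
    obtain ⟨q', hq'⟩ := polyHarmonic_surjective hm q
    exact ⟨q', by rw [pow_succ, Module.End.mul_apply, harmonic_polyGauss, hq', hq]⟩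

end PolyGauss

/-! ### Injectivity of the Fourier transform on integrable functions -/

section Completeness

variable {V : Type*} [NormedAddCommGroup V] [InnerProductSpace ℝ V] [FiniteDimensional ℝ V]
  [MeasurableSpace V] [BorelSpace V]

/-- An integrable function with vanishing Fourier transform vanishes almost everywhere. -/
theorem ae_eq_zero_of_fourier_eq_zero {g : V → ℂ} (hg : Integrable g) (h : ∀ w, 𝓕 g w = 0) :
    ∀ᵐ x, g x = 0 := by
  refine ae_eq_zero_of_integral_contDiff_smul_eq_zero hg.locallyIntegrable fun η hη hc => ?_
  have hcη : HasCompactSupport fun x => (η x : ℂ) := hc.comp_left (g := Complex.ofReal) rfl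
  let Φ : 𝓢(V, ℂ) := hcη.toSchwartzMap (Complex.ofRealCLM.contDiff.comp hη)
  have hΦ (x : V) : Φ x = η x := rfl
  -- Writing the test function as a Fourier transform moves the transform onto g, where it vanishes.
  have h1 : ∫ x, 𝓕 (𝓕⁻ Φ : 𝓢(V, ℂ)) x • g x = ∫ x, (𝓕⁻ Φ : 𝓢(V, ℂ)) x • 𝓕 g x := by
    rw [SchwartzMap.fourier_coe]
    simpa using! (VectorFourier.integral_fourierIntegral_smul_eq_flip (L := innerₗ V)
      Real.continuous_fourierChar continuous_inner (𝓕⁻ Φ : 𝓢(V, ℂ)).integrable hg)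
  rw [FourierTransform.fourier_fourierInv_eq] at h1
  simpa [h, hΦ] using h1

end Completeness

/-! ### Density of the Hermite functions -/

section Density

variable {m : ℕ}

theorem memLp_exp_neg_normSq : MemLp (fun x : E m => Real.exp (-(‖x‖ ^ 2 / 4))) 2 volume := by
  have hc : Continuous fun x : E m => Real.exp (-(‖x‖ ^ 2 / 4)) := by fun_prop
  rw [memLp_two_iff_integrable_sq_norm hc.aestronglyMeasurable]
  refine (gaussian m).integrable.norm.congr (Eventually.of_forall fun x => ?_)
  simp only [gaussian_apply, Complex.norm_real, Real.norm_eq_abs, Real.abs_exp]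
  rw [← Real.exp_nat_mul]
  congr 1
  push_cast
  ring

/-- As c|x| ≤ c² + |x|²/4, half of the Gaussian exponent absorbs the exponential and the remaining
e^{-|x|²/4} is in L², so it pairs with u. -/
theorem integrable_exp_mul_of_memLp {u : E m → ℂ} (hu : MemLp u 2 volume) (c : ℝ) :
    Integrable fun x : E m => Real.exp (c * ‖x‖) * ‖u x * (Real.exp (-(‖x‖ ^ 2 / 2)) : ℝ)‖ := by
  have h1 : Integrable fun x : E m => Real.exp (c ^ 2) * (Real.exp (-(‖x‖ ^ 2 / 4)) * ‖u x‖) :=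
    (memLp_exp_neg_normSq.integrable_mul hu.norm).const_mul _
  refine h1.mono' ?_ (Eventually.of_forall fun x => ?_)
  · have hc : Continuous fun x : E m => Real.exp (c * ‖x‖) := by fun_prop
    have hc' : Continuous fun x : E m => ((Real.exp (-(‖x‖ ^ 2 / 2)) : ℝ) : ℂ) := by fun_prop
    exact hc.aestronglyMeasurable.mul (hu.1.mul hc'.aestronglyMeasurable).norm
  · rw [norm_mul, norm_norm, norm_mul, Complex.norm_real, Real.norm_eq_abs, Real.norm_eq_abs,
      Real.abs_exp, Real.abs_exp, ← mul_assoc (Real.exp (c ^ 2)), ← Real.exp_add,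
      mul_comm ‖u x‖, ← mul_assoc, ← Real.exp_add]
    refine mul_le_mul_of_nonneg_right (Real.exp_le_exp.mpr ?_) (norm_nonneg _)
    nlinarith [sq_nonneg (c - ‖x‖ / 2)]

/-- Expand the Fourier kernel in its exponential series: each term pairs u with a polynomial times
the Gaussian. Summation and integration may be exchanged because e^{2π|w||x|} |u| e^{-|x|²/2} is
integrable. -/
theorem fourier_mul_gaussian_eq_zero {u : E m → ℂ} (hu : MemLp u 2 volume)
    (h : ∀ p, ∫ x, (starRingEnd ℂ) (polyGauss m p x) * u x = 0) (w : E m) :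
    𝓕 (fun x : E m => u x * ((Real.exp (-(‖x‖ ^ 2 / 2)) : ℝ) : ℂ)) w = 0 := by
  have hmeas : AEStronglyMeasurable
      (fun x : E m => u x * ((Real.exp (-(‖x‖ ^ 2 / 2)) : ℝ) : ℂ)) volume := by
    have hc' : Continuous fun x : E m => ((Real.exp (-(‖x‖ ^ 2 / 2)) : ℝ) : ℂ) := by fun_prop
    exact hu.1.mul hc'.aestronglyMeasurable
  have hexp : ∀ z : ℂ, HasSum (fun n : ℕ => (n ! : ℂ)⁻¹ * z ^ n) (Complex.exp z) := fun z => by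
    have := NormedSpace.expSeries_div_hasSum_exp (𝔸 := ℂ) z
    rw [← Complex.exp_eq_exp_ℂ] at this
    simpa only [div_eq_inv_mul] using this
  have hexpR : ∀ z : ℝ, HasSum (fun n : ℕ => (n ! : ℝ)⁻¹ * z ^ n) (Real.exp z) := fun z => by
    have := NormedSpace.expSeries_div_hasSum_exp (𝔸 := ℝ) z
    rw [← Real.exp_eq_exp_ℝ] at this
    simpa only [div_eq_inv_mul] using this
  let c (x : E m) : ℂ := ((-2 * Real.pi * inner ℝ x w : ℝ) : ℂ) * Complex.I
  have hcc : Continuous c := by fun_prop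
  have hcn (x : E m) : ‖c x‖ ≤ (2 * Real.pi * ‖w‖) * ‖x‖ := by
    rw [norm_mul, Complex.norm_I, mul_one, Complex.norm_real, norm_mul, norm_mul, norm_neg,
      Real.norm_of_nonneg Real.pi_pos.le, Real.norm_ofNat]
    have := norm_inner_le_norm (𝕜 := ℝ) x w
    calc _ ≤ 2 * Real.pi * (‖x‖ * ‖w‖) := by gcongr
      _ = _ := by ring
  have hsum := hasSum_integral_of_dominated_convergence (μ := (volume : Measure (E m)))
    (F := fun (n : ℕ) x => ((n ! : ℂ)⁻¹ * c x ^ n) *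
      (u x * ((Real.exp (-(‖x‖ ^ 2 / 2)) : ℝ) : ℂ)))
    (f := fun x => Complex.exp (c x) * (u x * ((Real.exp (-(‖x‖ ^ 2 / 2)) : ℝ) : ℂ)))
    (fun n x => ((n ! : ℝ)⁻¹ * ((2 * Real.pi * ‖w‖) * ‖x‖) ^ n) *
      ‖u x * ((Real.exp (-(‖x‖ ^ 2 / 2)) : ℝ) : ℂ)‖)
    (fun n => (by fun_prop : Continuous fun x => (n ! : ℂ)⁻¹ * c x ^ n).aestronglyMeasurable.mul
      hmeas)
    (fun n => Eventually.of_forall fun x => by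
      rw [norm_mul, norm_mul, norm_inv, Complex.norm_natCast, norm_pow]
      gcongr
      exact hcn x)
    (Eventually.of_forall fun x => (hexpR _).summable.mul_right _)
    ((integrable_exp_mul_of_memLp hu (2 * Real.pi * ‖w‖)).congr
      (Eventually.of_forall fun x => ((hexpR _).mul_right _).tsum_eq.symm))
    (Eventually.of_forall fun x => (hexp _).mul_right _)
  have hzero (n : ℕ) : ∫ x, ((n ! : ℂ)⁻¹ * c x ^ n) *
      (u x * ((Real.exp (-(‖x‖ ^ 2 / 2)) : ℝ) : ℂ)) = 0 := by
    -- The pairing conjugates the polynomial, so its linear form carries +2πi instead of the -2πi of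
    -- the kernel.
    rw [← h (MvPolynomial.C (n ! : ℂ)⁻¹ *
      (∑ j, MvPolynomial.C (2 * Real.pi * Complex.I * (w j : ℝ)) * MvPolynomial.X j) ^ n)]
    congr 1
    ext x
    have h1 : c x = (starRingEnd ℂ)
        (∑ j, (2 * Real.pi * Complex.I * (w j : ℝ)) * ((x j : ℝ) : ℂ)) := by
      simp only [c, PiLp.inner_apply, map_sum, map_mul, Complex.conj_ofReal, Complex.conj_I,
        RCLike.inner_apply, conj_trivial, map_ofNat]
      push_cast
      rw [Finset.mul_sum, Finset.sum_mul]
      exact Finset.sum_congr rfl fun j _ => by ring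
    rw [polyGauss_apply]
    simp only [map_mul, map_pow, map_sum, MvPolynomial.eval_C, MvPolynomial.eval_X,
      Complex.conj_ofReal, map_inv₀, map_natCast, h1]
    ring
  simp only [hzero] at hsum
  rw [Real.fourier_eq']
  have h2 := hsum.unique hasSum_zero
  simpa only [smul_eq_mul, c] using h2

theorem eq_zero_of_inner_polyGauss (u : Lp ℂ 2 (volume : Measure (E m)))
    (h : ∀ p, inner ℂ (toL2 m (polyGauss m p)) u = 0) : u = 0 := by
  have hint : ∀ p, ∫ x, (starRingEnd ℂ) (polyGauss m p x) * u x = 0 := fun p => by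
    rw [← h p, L2.inner_def]
    refine integral_congr_ae ?_
    filter_upwards [(polyGauss m p).coeFn_toLp 2 volume] with x hx
    change _ = inner ℂ ((polyGauss m p).toLp 2 volume x) (u x)
    rw [hx, RCLike.inner_apply']
  have hu := Lp.memLp u
  have hg : Integrable fun x : E m => u x * ((Real.exp (-(‖x‖ ^ 2 / 2)) : ℝ) : ℂ) := by
    have hc' : Continuous fun x : E m => ((Real.exp (-(‖x‖ ^ 2 / 2)) : ℝ) : ℂ) := by fun_prop
    refine (integrable_norm_iff (hu.1.mul hc'.aestronglyMeasurable)).mp ?_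
    simpa using! integrable_exp_mul_of_memLp hu 0
  have h0 := ae_eq_zero_of_fourier_eq_zero hg (fourier_mul_gaussian_eq_zero hu hint)
  rw [Lp.eq_zero_iff_ae_eq_zero]
  filter_upwards [h0] with x hx
  exact (mul_eq_zero.mp hx).resolve_right (by simp)

theorem exists_norm_sub_polyGauss_lt (u : Lp ℂ 2 (volume : Measure (E m))) {ε : ℝ} (hε : 0 < ε) :
    ∃ p, ‖u - toL2 m (polyGauss m p)‖ < ε := by
  have h : (LinearMap.range ((toL2 m).toLinearMap ∘ₗ polyGauss m)).topologicalClosure = ⊤ := by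
    rw [Submodule.topologicalClosure_eq_top_iff, eq_bot_iff]
    intro v hv
    rw [Submodule.mem_orthogonal] at hv
    exact eq_zero_of_inner_polyGauss v fun p => hv _ ⟨p, rfl⟩
  have hu : u ∈ (LinearMap.range ((toL2 m).toLinearMap ∘ₗ polyGauss m)).topologicalClosure := by
    rw [h]; trivial
  obtain ⟨_, ⟨p, rfl⟩, hp⟩ := Metric.mem_closure_iff.mp hu ε hε
  exact ⟨p, by rw [dist_eq_norm] at hp; exact hp⟩

/-- Hermite functions span a dense subspace of the Schwartz space. -/
theorem denseRange_polyGauss (hm : 1 ≤ m) : DenseRange (polyGauss m) := by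
  intro f
  have h1 (n : ℕ) : ∃ p, hermiteNorm m n (polyGauss m p - f) < 1 / ((n : ℝ) + 1) := by
    obtain ⟨p, hp⟩ := exists_norm_sub_polyGauss_lt (toL2 m ((harmonic m ^ n) f))
      (ε := 1 / ((n : ℝ) + 1)) (by positivity)
    obtain ⟨q, hq⟩ := exists_harmonic_pow_polyGauss hm n p
    refine ⟨q, ?_⟩
    rw [hermiteNorm, map_sub, hq, map_sub, norm_sub_rev]
    exact hp
  -- The n-th approximant is close in the n-th norm only, but the norms increase with n, so the
  -- sequence converges in all of them.
  choose q hq using h1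
  refine mem_closure_of_tendsto (f := fun n => polyGauss m (q n)) (b := atTop) ?_
    (Eventually.of_forall fun n => ⟨_, rfl⟩)
  rw [(schwartz_withSeminorms ℝ (E m) ℂ).tendsto_nhds]
  rintro ⟨k, l⟩ ε hε
  obtain ⟨N, C, hC, hb⟩ := seminorm_le_hermiteNorm hm k l
  have h2 : Tendsto (fun n : ℕ => C * (1 / ((n : ℝ) + 1))) atTop (𝓝 0) := by
    simpa using tendsto_one_div_add_atTop_nhds_zero_nat.const_mul C
  filter_upwards [h2.eventually (gt_mem_nhds hε), eventually_ge_atTop N] with n hn hNn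
  refine lt_of_le_of_lt ((hb _).trans ?_) hn
  exact mul_le_mul_of_nonneg_left ((hermiteNorm_mono hm hNn _).trans (hq n).le) hC

end Density
end CliffordFT

namespace CliffordFT

open Filter Topology MeasureTheory

/-! ### Finite dimension of the Clifford algebra and an invariant form on it -/

section CliffordAlgebra

variable {m : ℕ}

theorem gen_mul_gen_add_swap (i j : Fin m) :
    gen i * gen j + gen j * gen i = if i = j then (-2 : Cl m) else 0 := by
  rw [gen, gen, CliffordAlgebra.ι_mul_ι_add_swap, QuadraticMap.polar]
  simp only [QuadraticMap.weightedSumSquares_apply, Pi.add_apply, smul_eq_mul]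
  rw [← Finset.sum_sub_distrib, ← Finset.sum_sub_distrib]
  have h (k : Fin m) : -1 * (((Pi.single i 1 : Fin m → ℝ) k + (Pi.single j 1 : Fin m → ℝ) k) *
      ((Pi.single i 1 : Fin m → ℝ) k + (Pi.single j 1 : Fin m → ℝ) k)) -
      -1 * ((Pi.single i 1 : Fin m → ℝ) k * (Pi.single i 1 : Fin m → ℝ) k) -
      -1 * ((Pi.single j 1 : Fin m → ℝ) k * (Pi.single j 1 : Fin m → ℝ) k) =
      if k = i then (if i = j then (-2 : ℝ) else 0) else 0 := by
    simp only [Pi.single_apply]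
    by_cases h1 : k = i
    · subst h1
      by_cases h2 : k = j <;> simp [h2]
      norm_num
    · simp [h1]
  simp only [h, Finset.sum_ite_eq', Finset.mem_univ, if_true]
  split_ifs
  · rw [map_neg, map_ofNat]
  · rw [map_zero]

theorem gen_mul_self (j : Fin m) : gen j * gen j = (-1 : Cl m) := by
  have h := gen_mul_gen_add_swap j j
  rw [if_pos rfl, ← two_smul ℝ] at h
  have h2 : (2 : ℝ) • (gen j * gen j) = (2 : ℝ) • (-1 : Cl m) := by
    rw [h, two_smul]
    norm_num
  exact smul_right_injective _ (two_ne_zero' ℝ) h2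

theorem gen_mul_gen_mul_self (j : Fin m) (c : Cl m) : gen j * (gen j * c) = -c := by
  rw [← mul_assoc, gen_mul_self, neg_one_mul]

theorem gen_mul_gen_mul {i j : Fin m} (h : i ≠ j) (c : Cl m) :
    gen i * (gen j * c) = -(gen j * (gen i * c)) := by
  rw [← mul_assoc, ← mul_assoc, ← neg_mul]
  congr 1
  exact eq_neg_of_add_eq_zero_left (by rw [gen_mul_gen_add_swap, if_neg h])

/-- To add a generator e_i, replace W by W + e_i W: it is stable under e_i because e_i² = -1, and
still stable under the earlier e_j because they anticommute with e_i. -/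
theorem exists_fg_mul_gen_mem (s : Finset (Fin m)) : ∃ W : Submodule ℝ (Cl m),
    W.FG ∧ 1 ∈ W ∧ ∀ i ∈ s, ∀ w ∈ W, gen i * w ∈ W := by
  induction s using Finset.induction_on with
  | empty => exact ⟨Submodule.span ℝ {1}, Submodule.fg_span_singleton _,
      Submodule.mem_span_singleton_self _, by simp⟩
  | insert i s hi ih =>
    obtain ⟨W, hfg, h1, hW⟩ := ih
    refine ⟨W ⊔ W.map (LinearMap.mulLeft ℝ (gen i)), hfg.sup (hfg.map _),
      Submodule.mem_sup_left h1, fun j hj w hw => ?_⟩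
    obtain ⟨a, ha, _, ⟨b, hb, rfl⟩, rfl⟩ := Submodule.mem_sup.mp hw
    rw [LinearMap.mulLeft_apply, mul_add]
    rcases Finset.mem_insert.mp hj with rfl | hj
    · rw [gen_mul_gen_mul_self, add_comm]
      exact Submodule.add_mem_sup (Submodule.neg_mem _ hb) ⟨a, ha, rfl⟩
    · have hij : j ≠ i := fun h => hi (h ▸ hj)
      rw [gen_mul_gen_mul hij, ← mul_neg]
      exact Submodule.add_mem_sup (hW j hj a ha)
        ⟨_, Submodule.neg_mem _ (hW j hj b hb), rfl⟩

theorem ι_eq_sum_gen (v : Fin m → ℝ) :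
    CliffordAlgebra.ι (QuadraticMap.weightedSumSquares ℝ (fun _ : Fin m => (-1 : ℝ))) v =
      ∑ j, v j • gen j := by
  simp only [gen, ← map_smul, ← map_sum]
  congr 1
  ext i
  simp [Finset.sum_apply, Pi.single_apply]

instance : Module.Finite ℝ (Cl m) := by
  obtain ⟨W, hfg, h1, hW⟩ := exists_fg_mul_gen_mem (Finset.univ : Finset (Fin m))
  have htop : W = ⊤ := by
    rw [eq_top_iff]
    rintro c -
    induction c using CliffordAlgebra.left_induction with
    | algebraMap r =>
      rw [Algebra.algebraMap_eq_smul_one]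
      exact W.smul_mem r h1
    | add x y hx hy => exact W.add_mem hx hy
    | ι_mul x v hx =>
      rw [ι_eq_sum_gen, Finset.sum_mul]
      refine W.sum_mem fun j _ => ?_
      rw [smul_mul_assoc]
      exact W.smul_mem _ (hW j (Finset.mem_univ j) x hx)
  exact ⟨htop ▸ hfg⟩

/-- A finite family of functionals on the Clifford algebra that separates points and whose sum of
squares is a quadratic form invariant under left multiplication by the generators. -/
structure InvariantFamily (m : ℕ) {κ : Type*} [Fintype κ] (L : κ → Module.Dual ℝ (Cl m)) : Prop where
  separates : ∀ c, (∀ k, L k c = 0) → c = 0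
  invariant : ∀ j c d, ∑ k, L k (gen j * c) * L k (gen j * d) = ∑ k, L k c * L k d

/-- Averaging one generator at a time: q(c) + q(e_i c) is invariant under e_i since e_i² = -1, and
keeps its invariance under e_j since the sign in e_i e_j = -e_j e_i disappears in a quadratic form.
-/
theorem exists_family_invariant_on (s : Finset (Fin m)) : ∃ (κ : Type) (_ : Fintype κ)
    (L : κ → Module.Dual ℝ (Cl m)), (∀ c, (∀ k, L k c = 0) → c = 0) ∧
      ∀ j ∈ s, ∀ c d, ∑ k, L k (gen j * c) * L k (gen j * d) = ∑ k, L k c * L k d := by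
  induction s using Finset.induction_on with
  | empty =>
    let b := Module.finBasis ℝ (Cl m)
    exact ⟨Fin (Module.finrank ℝ (Cl m)), inferInstance, fun k => b.coord k,
      fun c hc => b.ext_elem fun k => by simpa using hc k, by simp⟩
  | insert i s hi ih =>
    obtain ⟨κ, _, L, hsep, hinv⟩ := ih
    refine ⟨κ ⊕ κ, inferInstance, Sum.elim L fun k => L k ∘ₗ LinearMap.mulLeft ℝ (gen i),
      fun c hc => hsep c fun k => hc (Sum.inl k), fun j hj c d => ?_⟩
    simp only [Fintype.sum_sum_type, Sum.elim_inl, Sum.elim_inr, LinearMap.comp_apply,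
      LinearMap.mulLeft_apply]
    rcases Finset.mem_insert.mp hj with rfl | hj
    · rw [add_comm]
      congr 1
      exact Finset.sum_congr rfl fun k _ => by
        rw [gen_mul_gen_mul_self, gen_mul_gen_mul_self, map_neg, map_neg, neg_mul_neg]
    · have hij : i ≠ j := fun h => hi (h ▸ hj)
      rw [hinv j hj, ← hinv j hj (gen i * c)]
      congr 1
      exact Finset.sum_congr rfl fun k _ => by
        rw [gen_mul_gen_mul hij, gen_mul_gen_mul hij, map_neg, map_neg, neg_mul_neg]

theorem exists_invariantFamily (m : ℕ) : ∃ (κ : Type) (_ : Fintype κ)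
    (L : κ → Module.Dual ℝ (Cl m)), InvariantFamily m L := by
  obtain ⟨κ, hκ, L, h1, h2⟩ := exists_family_invariant_on (Finset.univ : Finset (Fin m))
  exact ⟨κ, hκ, L, h1, fun j => h2 j (Finset.mem_univ j)⟩

/-- An isometry with square -1 is skew. -/
theorem InvariantFamily.skew {κ : Type*} [Fintype κ] {L : κ → Module.Dual ℝ (Cl m)}
    (hL : InvariantFamily m L) (j : Fin m) (c d : Cl m) :
    ∑ k, L k (gen j * c) * L k d = -∑ k, L k c * L k (gen j * d) := by
  rw [← hL.invariant j (gen j * c) d, ← Finset.sum_neg_distrib]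
  exact Finset.sum_congr rfl fun k _ => by rw [gen_mul_gen_mul_self, map_neg, neg_mul]

theorem InvariantFamily.exists_eq_sum {κ : Type*} [Fintype κ] {L : κ → Module.Dual ℝ (Cl m)}
    (hL : InvariantFamily m L) (K : Module.Dual ℝ (Cl m)) :
    ∃ a : κ → ℝ, K = ∑ k, a k • L k := by
  have h : K ∈ Submodule.span ℝ (Set.range L) := by
    refine mem_span_of_iInf_ker_le_ker fun c hc => ?_
    rw [Submodule.mem_iInf] at hc
    rw [hL.separates c hc]
    exact Submodule.zero_mem _
  obtain ⟨a, ha⟩ := (Submodule.mem_span_range_iff_exists_fun ℝ).mp h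
  exact ⟨a, ha.symm⟩

end CliffordAlgebra

/-! ### Operators with Clifford coefficients -/

section CliffordOperators

variable {m : ℕ} {W : Type*} [AddCommGroup W] [Module ℂ W] [Module ℝ W] [IsScalarTower ℝ ℂ W]

/-- The operator `∑_j A_j ⊗ e_j`, with `e_j` acting by left multiplication. -/
def cliffOp (A : Fin m → Module.End ℂ W) : Module.End ℂ (W ⊗[ℝ] Cl m) :=
  ∑ j : Fin m, TensorProduct.AlgebraTensorModule.map (A j) (LinearMap.mulLeft ℝ (gen j))

/-- The operator `A ⊗ 1`. -/
def scalarOp (m : ℕ) (A : Module.End ℂ W) : Module.End ℂ (W ⊗[ℝ] Cl m) :=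
  TensorProduct.AlgebraTensorModule.map A (LinearMap.id : Cl m →ₗ[ℝ] Cl m)

theorem cliffOp_tmul (A : Fin m → Module.End ℂ W) (w : W) (c : Cl m) :
    cliffOp A (w ⊗ₜ[ℝ] c) = ∑ j, A j w ⊗ₜ[ℝ] (gen j * c) := by
  simp [cliffOp, LinearMap.sum_apply]

theorem scalarOp_tmul (A : Module.End ℂ W) (w : W) (c : Cl m) :
    scalarOp m A (w ⊗ₜ[ℝ] c) = A w ⊗ₜ[ℝ] c := by
  simp [scalarOp]

theorem tensor_end_ext {T T' : Module.End ℂ (W ⊗[ℝ] Cl m)}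
    (h : ∀ w c, T (w ⊗ₜ[ℝ] c) = T' (w ⊗ₜ[ℝ] c)) : T = T' :=
  TensorProduct.AlgebraTensorModule.ext h

/-- For i ≠ j the operators A_i, B_j commute while e_i, e_j anticommute, so these terms cancel; the
diagonal ones give -(A_iB_i + B_iA_i) = c - 2A_iB_i. One computation thus serves x² and ∂² on
Schwartz functions and {x, ∂} on polynomials. -/
theorem cliffOp_mul_add_mul (A B : Fin m → Module.End ℂ W) (c : ℂ)
    (h : ∀ i j, A i * B j - B j * A i = if i = j then c • 1 else 0) :
    cliffOp A * cliffOp B + cliffOp B * cliffOp A =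
      scalarOp m (((m : ℂ) * c) • 1 - (2 : ℂ) • ∑ i, A i * B i) := by
  refine tensor_end_ext fun w d => ?_
  have h1 (i j : Fin m) : A i (B j w) ⊗ₜ[ℝ] (gen i * (gen j * d)) +
      B j (A i w) ⊗ₜ[ℝ] (gen j * (gen i * d)) =
      if i = j then (c • w - (2 : ℂ) • A i (B i w)) ⊗ₜ[ℝ] d else 0 := by
    have h2 := LinearMap.congr_fun (h i j) w
    by_cases hij : i = j
    · subst hij
      simp only [LinearMap.sub_apply, Module.End.mul_apply, if_true, LinearMap.smul_apply,
        Module.End.one_apply] at h2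
      rw [if_pos rfl, gen_mul_gen_mul_self, ← TensorProduct.add_tmul, TensorProduct.tmul_neg,
        ← TensorProduct.neg_tmul, ← h2, two_smul]
      congr 1
      abel
    · rw [if_neg hij, LinearMap.zero_apply, LinearMap.sub_apply, Module.End.mul_apply,
        Module.End.mul_apply, sub_eq_zero] at h2
      rw [if_neg hij, h2, ← TensorProduct.tmul_add, gen_mul_gen_mul hij, neg_add_cancel,
        TensorProduct.tmul_zero]
  rw [LinearMap.add_apply, Module.End.mul_apply, Module.End.mul_apply, cliffOp_tmul, cliffOp_tmul,
    map_sum, map_sum]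
  simp only [cliffOp_tmul]
  rw [Finset.sum_comm, ← Finset.sum_add_distrib]
  simp only [← Finset.sum_add_distrib, h1]
  rw [scalarOp_tmul]
  simp only [Finset.sum_ite_eq, Finset.mem_univ, if_true]
  rw [← TensorProduct.sum_tmul, Finset.sum_sub_distrib, LinearMap.sub_apply, LinearMap.smul_apply,
    LinearMap.smul_apply, LinearMap.sum_apply, Finset.sum_const,
    Finset.card_univ, Fintype.card_fin, Module.End.one_apply, mul_smul, Nat.cast_smul_eq_nsmul,
    Finset.smul_sum]
  rfl

theorem cliffOp_mul_self (A : Fin m → Module.End ℂ W) (h : ∀ i j, Commute (A i) (A j)) :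
    cliffOp A * cliffOp A = -scalarOp m (∑ i, A i * A i) := by
  have h1 := cliffOp_mul_add_mul A A 0 fun i j => by simp [(h i j).eq]
  rw [← two_smul ℂ, mul_zero, zero_smul, zero_sub] at h1
  have h2 : scalarOp m (-((2 : ℂ) • ∑ i, A i * A i)) = (2 : ℂ) • -scalarOp m (∑ i, A i * A i) := by
    refine tensor_end_ext fun w d => ?_
    rw [LinearMap.smul_apply, LinearMap.neg_apply, scalarOp_tmul, scalarOp_tmul,
      LinearMap.neg_apply, LinearMap.smul_apply, TensorProduct.neg_tmul, smul_neg,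
      TensorProduct.smul_tmul']
  rw [h2] at h1
  exact smul_right_injective _ (two_ne_zero' ℂ) h1

end CliffordOperators

/-! ### The topology of Clifford-valued Schwartz functions -/

section Topology

variable {m : ℕ}

theorem component_tmul (L : Module.Dual ℝ (Cl m)) (f : 𝓢(E m, ℂ)) (c : Cl m) :
    component L (f ⊗ₜ[ℝ] c) = L c • f := by
  simp [component]

theorem component_smul (L : Module.Dual ℝ (Cl m)) (z : ℂ) (F : CliffordSchwartz m) :
    component L (z • F) = z • component L F := by
  induction F using TensorProduct.induction_on with
  | zero => simp
  | tmul f c => rw [TensorProduct.smul_tmul', component_tmul, component_tmul, smul_comm]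
  | add F G hF hG => rw [smul_add, map_add, map_add, hF, hG, smul_add]

/-- The complex linear version of `component`. -/
def componentC (L : Module.Dual ℝ (Cl m)) : CliffordSchwartz m →ₗ[ℂ] 𝓢(E m, ℂ) :=
  { component L with map_smul' := component_smul L }

theorem component_sum_smul {κ : Type*} [Fintype κ] (L : κ → Module.Dual ℝ (Cl m)) (a : κ → ℝ)
    (F : CliffordSchwartz m) :
    component (∑ k, a k • L k) F = ∑ k, a k • component (L k) F := by
  induction F using TensorProduct.induction_on with
  | zero => simp
  | tmul f c =>
    simp only [component_tmul, LinearMap.sum_apply, LinearMap.smul_apply, Finset.sum_smul,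
      smul_assoc]
  | add F G hF hG => simp only [map_add, hF, hG, smul_add, Finset.sum_add_distrib]

theorem eq_sum_component_tmul {κ : Type*} [Fintype κ] (b : Module.Basis κ ℝ (Cl m))
    (F : CliffordSchwartz m) : F = ∑ k, component (b.coord k) F ⊗ₜ[ℝ] b k := by
  induction F using TensorProduct.induction_on with
  | zero => simp
  | tmul f c =>
    simp only [component_tmul, TensorProduct.smul_tmul]
    rw [← TensorProduct.tmul_sum]
    simp only [Module.Basis.coord_apply, b.sum_repr]
  | add F G hF hG =>
    simp only [map_add, TensorProduct.add_tmul, Finset.sum_add_distrib, ← hF, ← hG]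

theorem continuous_component (L : Module.Dual ℝ (Cl m)) : Continuous (component (m := m) L) :=
  continuous_iInf_dom continuous_induced_dom

theorem continuous_cliffordSchwartz_iff {X : Type*} [TopologicalSpace X]
    {f : X → CliffordSchwartz m} : Continuous f ↔ ∀ L, Continuous fun x => component L (f x) := by
  rw [continuous_iInf_rng]
  exact forall_congr' fun L => continuous_induced_rng

instance : IsTopologicalAddGroup (CliffordSchwartz m) :=
  topologicalAddGroup_iInf fun L => topologicalAddGroup_induced (component L)

instance : ContinuousSMul ℂ (CliffordSchwartz m) :=
  continuousSMul_iInf fun L => continuousSMul_induced (componentC L)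

instance : T2Space (CliffordSchwartz m) := by
  refine T2Space.of_injective_continuous
    (f := fun (F : CliffordSchwartz m) (L : Module.Dual ℝ (Cl m)) => component L F)
    (fun F G h => ?_) (continuous_pi continuous_component)
  have h' (L : Module.Dual ℝ (Cl m)) : component L F = component L G := congrFun h L
  rw [eq_sum_component_tmul (Module.finBasis ℝ (Cl m)) F,
    eq_sum_component_tmul (Module.finBasis ℝ (Cl m)) G]
  simp only [h']

theorem continuous_tmul_right (c : Cl m) :
    Continuous fun f : 𝓢(E m, ℂ) => (f ⊗ₜ[ℝ] c : CliffordSchwartz m) := by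
  rw [continuous_cliffordSchwartz_iff]
  intro L
  simp only [component_tmul]
  exact continuous_const_smul _

theorem component_cliffOp (A : Fin m → Module.End ℂ 𝓢(E m, ℂ)) (L : Module.Dual ℝ (Cl m))
    (F : CliffordSchwartz m) : component L (cliffOp A F) =
      ∑ j, A j (component (L ∘ₗ LinearMap.mulLeft ℝ (gen j)) F) := by
  induction F using TensorProduct.induction_on with
  | zero => simp
  | tmul f c =>
    simp only [cliffOp_tmul, map_sum, component_tmul, LinearMap.comp_apply,
      LinearMap.mulLeft_apply, LinearMap.map_smul_of_tower]
  | add F G hF hG => simp only [map_add, hF, hG, Finset.sum_add_distrib]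

theorem component_scalarOp (A : Module.End ℂ 𝓢(E m, ℂ)) (L : Module.Dual ℝ (Cl m))
    (F : CliffordSchwartz m) : component L (scalarOp m A F) = A (component L F) := by
  induction F using TensorProduct.induction_on with
  | zero => simp
  | tmul f c => simp only [scalarOp_tmul, component_tmul, LinearMap.map_smul_of_tower]
  | add F G hF hG => simp only [map_add, hF, hG]

theorem continuous_cliffOp {A : Fin m → Module.End ℂ 𝓢(E m, ℂ)} (hA : ∀ j, Continuous (A j)) :
    Continuous (cliffOp A) := by
  rw [continuous_cliffordSchwartz_iff]
  intro L
  simp only [component_cliffOp]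
  exact continuous_finsetSum _ fun j _ => (hA j).comp (continuous_component _)

theorem continuous_dirac : Continuous (dirac m) :=
  continuous_cliffOp fun j => (LineDeriv.lineDerivOpCLM ℂ 𝓢(E m, ℂ)
    (EuclideanSpace.single j (1 : ℝ))).continuous

theorem continuous_vecVar : Continuous (vecVar m) :=
  continuous_cliffOp fun j => (SchwartzMap.smulLeftCLM ℂ
    (fun x : E m => ((x j : ℝ) : ℂ))).continuous

end Topology

/-! ### The invariant inner product -/

section InnerProduct

variable {m : ℕ} {κ : Type*} [Fintype κ] (L : κ → Module.Dual ℝ (Cl m))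

/-- The `L²` inner product of Clifford-valued Schwartz functions defined by a finite family of
functionals on the Clifford algebra. -/
def cliffInner (F G : CliffordSchwartz m) : ℂ :=
  ∑ k, inner ℂ (toL2 m (component (L k) F)) (toL2 m (component (L k) G))

theorem cliffInner_add_left (F F' G : CliffordSchwartz m) :
    cliffInner L (F + F') G = cliffInner L F G + cliffInner L F' G := by
  simp only [cliffInner, map_add, inner_add_left, Finset.sum_add_distrib]

theorem cliffInner_add_right (F G G' : CliffordSchwartz m) :
    cliffInner L F (G + G') = cliffInner L F G + cliffInner L F G' := by
  simp only [cliffInner, map_add, inner_add_right, Finset.sum_add_distrib]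

theorem cliffInner_zero_left (G : CliffordSchwartz m) : cliffInner L 0 G = 0 := by
  simp [cliffInner]

theorem cliffInner_zero_right (F : CliffordSchwartz m) : cliffInner L F 0 = 0 := by
  simp [cliffInner]

theorem cliffInner_smul_left (z : ℂ) (F G : CliffordSchwartz m) :
    cliffInner L (z • F) G = (starRingEnd ℂ) z * cliffInner L F G := by
  simp only [cliffInner, component_smul, map_smul, inner_smul_left, Finset.mul_sum]

theorem cliffInner_smul_right (z : ℂ) (F G : CliffordSchwartz m) :
    cliffInner L F (z • G) = z * cliffInner L F G := by
  simp only [cliffInner, component_smul, map_smul, inner_smul_right, Finset.mul_sum]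

theorem cliffInner_tmul (f g : 𝓢(E m, ℂ)) (c d : Cl m) :
    cliffInner L (f ⊗ₜ[ℝ] c) (g ⊗ₜ[ℝ] d) =
      ((∑ k, L k c * L k d : ℝ) : ℂ) * inner ℂ (toL2 m f) (toL2 m g) := by
  simp only [cliffInner, component_tmul]
  push_cast
  rw [Finset.sum_mul]
  refine Finset.sum_congr rfl fun k _ => ?_
  have h (r : ℝ) (u : 𝓢(E m, ℂ)) : toL2 m (r • u) = (r : ℂ) • toL2 m u := by
    rw [← map_smul]
    congr 1
  rw [h, h, inner_smul_left, inner_smul_right, Complex.conj_ofReal, mul_assoc]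

-- Left multiplication by e_j is skew, which reverses the sign of the adjoint of A_j: the vector
-- variable becomes skew and the Dirac operator symmetric.
variable {L} in
theorem cliffInner_cliffOp (hL : InvariantFamily m L) {A : Fin m → Module.End ℂ 𝓢(E m, ℂ)} {ε : ℂ}
    (hA : ∀ j u v, inner ℂ (toL2 m (A j u)) (toL2 m v) = ε * inner ℂ (toL2 m u) (toL2 m (A j v)))
    (F G : CliffordSchwartz m) :
    cliffInner L (cliffOp A F) G = -ε * cliffInner L F (cliffOp A G) := by
  have hsum_left (s : Fin m → CliffordSchwartz m) (G) :
      cliffInner L (∑ j, s j) G = ∑ j, cliffInner L (s j) G :=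
    map_sum (AddMonoidHom.mk' (fun F => cliffInner L F G)
      fun F F' => cliffInner_add_left L F F' G) s _
  have hsum_right (s : Fin m → CliffordSchwartz m) (F) :
      cliffInner L F (∑ j, s j) = ∑ j, cliffInner L F (s j) :=
    map_sum (AddMonoidHom.mk' (fun G => cliffInner L F G)
      fun G G' => cliffInner_add_right L F G G') s _
  induction F using TensorProduct.induction_on with
  | zero => simp [cliffInner_zero_left]
  | add F F' hF hF' => rw [map_add, cliffInner_add_left, cliffInner_add_left, hF, hF', mul_add]
  | tmul f c =>
    induction G using TensorProduct.induction_on with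
    | zero => simp [cliffInner_zero_right]
    | add G G' hG hG' => rw [map_add, cliffInner_add_right, cliffInner_add_right, hG, hG', mul_add]
    | tmul g d =>
      rw [cliffOp_tmul, cliffOp_tmul, hsum_left, hsum_right, Finset.mul_sum]
      refine Finset.sum_congr rfl fun j _ => ?_
      rw [cliffInner_tmul, cliffInner_tmul, hL.skew, hA]
      push_cast
      ring

variable {L} in
theorem cliffInner_vecVar (hL : InvariantFamily m L) (F G : CliffordSchwartz m) :
    cliffInner L (vecVar m F) G = -cliffInner L F (vecVar m G) := by
  have h := cliffInner_cliffOp hL (A := coordMul) (ε := 1)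
    (fun j u v => by rw [one_mul, inner_coordMul]) F G
  rw [neg_one_mul] at h
  exact h

variable {L} in
theorem cliffInner_dirac (hL : InvariantFamily m L) (F G : CliffordSchwartz m) :
    cliffInner L (dirac m F) G = cliffInner L F (dirac m G) := by
  have h := cliffInner_cliffOp hL (A := partialD) (ε := -1)
    (fun j u v => by rw [neg_one_mul, inner_partialD]) F G
  rw [neg_neg, one_mul] at h
  exact h

theorem cliffInner_self (F : CliffordSchwartz m) :
    cliffInner L F F = ((∑ k, ‖toL2 m (component (L k) F)‖ ^ 2 : ℝ) : ℂ) := by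
  simp only [cliffInner, inner_self_eq_norm_sq_to_K]
  push_cast
  rfl

variable {L} in
theorem eq_zero_of_cliffInner_self (hL : InvariantFamily m L) {F : CliffordSchwartz m}
    (h : cliffInner L F F = 0) : F = 0 := by
  rw [cliffInner_self, Complex.ofReal_eq_zero,
    Finset.sum_eq_zero_iff_of_nonneg fun k _ => by positivity] at h
  have h1 (k : κ) : component (L k) F = 0 := by
    have := h k (Finset.mem_univ k)
    rw [sq_eq_zero_iff, norm_eq_zero] at this
    exact toL2_injective (this.trans (map_zero _).symm)
  have h2 (K : Module.Dual ℝ (Cl m)) : component K F = 0 := by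
    obtain ⟨a, rfl⟩ := hL.exists_eq_sum K
    simp [component_sum_smul, h1]
  rw [eq_sum_component_tmul (Module.finBasis ℝ (Cl m)) F]
  simp [h2]

end InnerProduct
end CliffordFT

namespace CliffordFT

/-! ### Recurrences for Laguerre polynomials -/

section Laguerre

theorem coeff_laguerre (p : ℕ) (a : ℝ) (n : ℕ) : (laguerre p a).coeff n =
    if n ≤ p then (-1) ^ n * (Real.Gamma (p + a + 1) /
      ((n ! : ℝ) * ((p - n)! : ℝ) * Real.Gamma (n + a + 1))) else 0 := by
  have h (i : ℕ) : (Polynomial.C (Real.Gamma (p + a + 1) /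
      ((i ! : ℝ) * ((p - i)! : ℝ) * Real.Gamma (i + a + 1))) *
      (-Polynomial.X : Polynomial ℝ) ^ i).coeff n =
      if n = i then (-1) ^ i * (Real.Gamma (p + a + 1) /
        ((i ! : ℝ) * ((p - i)! : ℝ) * Real.Gamma (i + a + 1))) else 0 := by
    rw [neg_pow, Polynomial.coeff_C_mul, ← Polynomial.C_1, ← Polynomial.C_neg,
      ← Polynomial.C_pow, Polynomial.coeff_C_mul, Polynomial.coeff_X_pow]
    split_ifs <;> ring
  simp only [laguerre, Polynomial.finsetSum_coeff, h]
  rw [Finset.sum_ite_eq]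
  simp only [Finset.mem_range, Nat.lt_succ_iff]

theorem laguerre_zero {a : ℝ} (ha : 0 < a + 1) : laguerre 0 a = 1 := by
  have h := (Real.Gamma_pos_of_pos ha).ne'
  simp [laguerre, h]

theorem Gamma_natCast_add_succ {a : ℝ} (ha : 0 < a) (n : ℕ) :
    Real.Gamma (n + a + 1) = (n + a) * Real.Gamma (n + a) :=
  Real.Gamma_add_one (by positivity)

/-- With a = m/2 + k, this is b⁺ taking ψ_{2p,k} to ψ_{2p+1,k}. Positivity of a keeps all Gamma
values nonzero. -/
theorem laguerre_eq_sub_derivative {a : ℝ} (ha : 0 < a) (p : ℕ) :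
    laguerre p a = laguerre p (a - 1) - Polynomial.derivative (laguerre p (a - 1)) := by
  ext n
  have hs (x : ℝ) : x + (a - 1) + 1 = x + a := by ring
  rw [Polynomial.coeff_sub, Polynomial.coeff_derivative, coeff_laguerre, coeff_laguerre,
    coeff_laguerre, hs, hs, hs]
  rcases lt_trichotomy n p with h | h | h
  · obtain ⟨q, rfl⟩ := Nat.exists_eq_add_of_lt h
    rw [if_pos (by omega), if_pos (by omega), if_pos (by omega),
      show n + q + 1 - n = q + 1 by omega, show n + q + 1 - (n + 1) = q by omega,
      Nat.factorial_succ n, Nat.factorial_succ q, Gamma_natCast_add_succ ha,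
      Gamma_natCast_add_succ ha, show (((n + 1 : ℕ) : ℝ) + a) = n + a + 1 by push_cast; ring,
      Gamma_natCast_add_succ ha]
    have h1 := (Real.Gamma_pos_of_pos (show 0 < (n : ℝ) + a by positivity)).ne'
    have h2 : (n : ℝ) + a ≠ 0 := by positivity
    have h3 : (q : ℝ) + 1 ≠ 0 := by positivity
    have h4 : (n : ℝ) + 1 ≠ 0 := by positivity
    push_cast
    field_simp
    ring
  · subst h
    rw [if_pos le_rfl, if_pos le_rfl, if_neg (by omega)]
    have h1 := (Real.Gamma_pos_of_pos (show 0 < (n : ℝ) + a by positivity)).ne'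
    have h2 := (Real.Gamma_pos_of_pos (show 0 < (n : ℝ) + a + 1 by positivity)).ne'
    field_simp
    ring
  · rw [if_neg (by omega), if_neg (by omega), if_neg (by omega)]
    ring

/-- With a = m/2 + k, this is b⁺ taking ψ_{2p+1,k} to ψ_{2p+2,k}; the factor p + 1 goes into the
normalization 2^p p!. -/
theorem succ_smul_laguerre_succ {a : ℝ} (ha : 0 < a) (p : ℕ) :
    ((p : ℝ) + 1) • laguerre (p + 1) (a - 1) =
      a • laguerre p a - Polynomial.X * laguerre p a +
        Polynomial.X * Polynomial.derivative (laguerre p a) := by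
  ext n
  have hs (x : ℝ) : x + (a - 1) + 1 = x + a := by ring
  have hp : Real.Gamma (((p + 1 : ℕ) : ℝ) + a) = Real.Gamma (p + a + 1) := by
    congr 1
    push_cast
    ring
  rw [Polynomial.coeff_add, Polynomial.coeff_sub, Polynomial.coeff_smul, Polynomial.coeff_smul,
    coeff_laguerre, coeff_laguerre, hs, hs, hp, smul_eq_mul, smul_eq_mul]
  have hg := (Real.Gamma_pos_of_pos (show 0 < (p : ℝ) + a + 1 by positivity)).ne'
  rcases n with _ | n
  · rw [Polynomial.mul_coeff_zero, Polynomial.mul_coeff_zero, Polynomial.coeff_X_zero,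
      if_pos (by omega), if_pos (by omega), Gamma_natCast_add_succ ha 0, Nat.sub_zero, Nat.sub_zero,
      Nat.factorial_succ p]
    have h1 := (Real.Gamma_pos_of_pos ha).ne'
    have h3 : (p : ℝ) + 1 ≠ 0 := by positivity
    simp only [Nat.cast_zero, zero_add]
    push_cast
    field_simp
    ring
  · rw [Polynomial.coeff_X_mul, Polynomial.coeff_X_mul, Polynomial.coeff_derivative,
      coeff_laguerre, coeff_laguerre]
    have h4 : ((n + 1 : ℕ) : ℝ) + a = n + a + 1 := by push_cast; ring
    have h5 := (Real.Gamma_pos_of_pos (show 0 < (n : ℝ) + a + 1 by positivity)).ne'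
    have h6 : (n : ℝ) + 1 ≠ 0 := by positivity
    rcases lt_trichotomy n p with h | h | h
    · obtain ⟨q, rfl⟩ := Nat.exists_eq_add_of_lt h
      rw [if_pos (by omega), if_pos (by omega), if_pos (by omega),
        show n + q + 1 + 1 - (n + 1) = q + 1 by omega, show n + q + 1 - (n + 1) = q by omega,
        show n + q + 1 - n = q + 1 by omega, Gamma_natCast_add_succ ha (n + 1), h4,
        Nat.factorial_succ n, Nat.factorial_succ q]
      have h2 : (n : ℝ) + a + 1 ≠ 0 := by positivity
      have h3 : (q : ℝ) + 1 ≠ 0 := by positivity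
      push_cast
      rw [pow_succ]
      field_simp
      ring
    · subst h
      rw [if_pos le_rfl, if_neg (by omega), if_pos le_rfl, Nat.sub_self, Nat.sub_self, h4,
        Nat.factorial_succ n]
      push_cast
      rw [pow_succ]
      field_simp
      ring
    · rw [if_neg (by omega), if_neg (by omega), if_neg (by omega)]
      ring

end Laguerre

end CliffordFT

namespace CliffordFT

/-! ### The Dirac operator and the vector variable on polynomials -/

section PolynomialOperators

variable {m : ℕ}

theorem polyDirac_tmul (p : MvPolynomial (Fin m) ℂ) (c : Cl m) :
    polyDirac m (p ⊗ₜ[ℝ] c) = ∑ j, MvPolynomial.pderiv j p ⊗ₜ[ℝ] (gen j * c) :=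
  cliffOp_tmul _ p c

theorem polyVecVar_tmul (p : MvPolynomial (Fin m) ℂ) (c : Cl m) :
    polyVecVar m (p ⊗ₜ[ℝ] c) = ∑ j, (MvPolynomial.X j * p) ⊗ₜ[ℝ] (gen j * c) :=
  cliffOp_tmul _ p c

theorem polyMul_tmul (q p : MvPolynomial (Fin m) ℂ) (c : Cl m) :
    polyMul q (p ⊗ₜ[ℝ] c) = (q * p) ⊗ₜ[ℝ] c :=
  scalarOp_tmul (LinearMap.mulLeft ℂ q) p c

theorem polyMul_add (q r : MvPolynomial (Fin m) ℂ) (P : CliffordPoly m) :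
    polyMul (q + r) P = polyMul q P + polyMul r P := by
  induction P using TensorProduct.induction_on with
  | zero => simp
  | tmul p c => simp only [polyMul_tmul, add_mul, TensorProduct.add_tmul]
  | add P Q hP hQ => rw [map_add, map_add, map_add, hP, hQ]; abel

theorem polyMul_sub (q r : MvPolynomial (Fin m) ℂ) (P : CliffordPoly m) :
    polyMul (q - r) P = polyMul q P - polyMul r P := by
  rw [eq_sub_iff_add_eq, ← polyMul_add, sub_add_cancel]

theorem polyMul_smul (z : ℂ) (q : MvPolynomial (Fin m) ℂ) (P : CliffordPoly m) :
    polyMul (z • q) P = z • polyMul q P := by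
  induction P using TensorProduct.induction_on with
  | zero => simp
  | tmul p c => rw [polyMul_tmul, polyMul_tmul, smul_mul_assoc, TensorProduct.smul_tmul']
  | add P Q hP hQ => rw [map_add, map_add, hP, hQ, smul_add]

theorem polyMul_mul (q r : MvPolynomial (Fin m) ℂ) (P : CliffordPoly m) :
    polyMul (q * r) P = polyMul q (polyMul r P) := by
  induction P using TensorProduct.induction_on with
  | zero => simp
  | tmul p c => simp only [polyMul_tmul, mul_assoc]
  | add P Q hP hQ => simp only [map_add, hP, hQ]

theorem polyMul_one (P : CliffordPoly m) : polyMul 1 P = P := by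
  induction P using TensorProduct.induction_on with
  | zero => simp
  | tmul p c => rw [polyMul_tmul, one_mul]
  | add P Q hP hQ => rw [map_add, hP, hQ]

theorem polyVecVar_polyMul (q : MvPolynomial (Fin m) ℂ) (P : CliffordPoly m) :
    polyVecVar m (polyMul q P) = polyMul q (polyVecVar m P) := by
  induction P using TensorProduct.induction_on with
  | zero => simp
  | tmul p c => simp only [polyMul_tmul, polyVecVar_tmul, map_sum, mul_left_comm]
  | add P Q hP hQ => simp only [map_add, hP, hQ]

theorem polyVecVar_polyVecVar (P : CliffordPoly m) :
    polyVecVar m (polyVecVar m P) = -polyMul (normSqPoly m) P := by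
  have h := LinearMap.congr_fun (cliffOp_mul_self
    (fun j => LinearMap.mulLeft ℂ (MvPolynomial.X j : MvPolynomial (Fin m) ℂ))
    fun i j => LinearMap.ext fun p => mul_left_comm _ _ _) P
  refine h.trans ?_
  rw [LinearMap.neg_apply]
  congr 2
  refine tensor_end_ext fun p c => ?_
  rw [scalarOp_tmul, polyMul_tmul, normSqPoly, Finset.sum_mul, LinearMap.sum_apply]
  simp only [Module.End.mul_apply, LinearMap.mulLeft_apply, pow_two, mul_assoc]

theorem pderiv_aeval_normSqPoly (j : Fin m) (Q : Polynomial ℝ) :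
    MvPolynomial.pderiv j (Polynomial.aeval (normSqPoly m) Q) =
      2 * (MvPolynomial.X j * Polynomial.aeval (normSqPoly m) (Polynomial.derivative Q)) := by
  have h := ((MvPolynomial.pderiv (R := ℂ) j).restrictScalars ℝ).map_aeval Q (normSqPoly m)
  have h2 : MvPolynomial.pderiv j (normSqPoly m) = 2 * MvPolynomial.X j := by
    rw [normSqPoly, map_sum]
    simp only [Derivation.leibniz_pow, MvPolynomial.pderiv_X, smul_eq_mul]
    simp [Pi.single_apply]
  simp only [Derivation.restrictScalars_apply] at h
  rw [h, h2, smul_eq_mul]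
  ring

theorem polyDirac_polyMul_aeval (Q : Polynomial ℝ) (P : CliffordPoly m) :
    polyDirac m (polyMul (Polynomial.aeval (normSqPoly m) Q) P) =
      polyMul (Polynomial.aeval (normSqPoly m) Q) (polyDirac m P) +
      (2 : ℂ) • polyMul (Polynomial.aeval (normSqPoly m) (Polynomial.derivative Q))
        (polyVecVar m P) := by
  induction P using TensorProduct.induction_on with
  | zero => simp
  | tmul p c =>
    have hj (j : Fin m) : (p * (2 * (MvPolynomial.X j *
        Polynomial.aeval (normSqPoly m) (Polynomial.derivative Q)))) ⊗ₜ[ℝ] (gen j * c) =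
        (Polynomial.aeval (normSqPoly m) (Polynomial.derivative Q) *
          (MvPolynomial.X j * p)) ⊗ₜ[ℝ] (gen j * c) +
        (Polynomial.aeval (normSqPoly m) (Polynomial.derivative Q) *
          (MvPolynomial.X j * p)) ⊗ₜ[ℝ] (gen j * c) := by
      rw [← TensorProduct.add_tmul]
      congr 1
      ring
    simp only [polyMul_tmul, polyDirac_tmul, polyVecVar_tmul, map_sum, Derivation.leibniz,
      pderiv_aeval_normSqPoly, smul_eq_mul, TensorProduct.add_tmul, Finset.sum_add_distrib,
      two_smul, hj]
  | add P Q hP hQ => simp only [map_add, hP, hQ, smul_add]; abel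

/-- The Euler operator `∑_j x_j ∂_{x_j}` on scalar polynomials. -/
def euler (m : ℕ) : Module.End ℂ (MvPolynomial (Fin m) ℂ) :=
  ∑ j : Fin m, LinearMap.mulLeft ℂ (MvPolynomial.X j) *
    (MvPolynomial.pderiv (R := ℂ) j).toLinearMap

theorem polyVecVar_polyDirac_add (P : CliffordPoly m) :
    polyVecVar m (polyDirac m P) + polyDirac m (polyVecVar m P) =
      -((2 : ℂ) • scalarOp m (euler m) P + (m : ℂ) • P) := by
  have h := LinearMap.congr_fun (cliffOp_mul_add_mul
    (fun j => LinearMap.mulLeft ℂ (MvPolynomial.X j : MvPolynomial (Fin m) ℂ))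
    (fun j => (MvPolynomial.pderiv (R := ℂ) j).toLinearMap) (-1) fun i j => by
      refine LinearMap.ext fun p => ?_
      simp only [LinearMap.sub_apply, Module.End.mul_apply, LinearMap.mulLeft_apply,
        Derivation.coeFn_coe, Derivation.leibniz, MvPolynomial.pderiv_X, smul_eq_mul]
      by_cases hij : i = j
      · subst hij
        simp
      · simp [hij]) P
  refine h.trans ?_
  clear h
  induction P using TensorProduct.induction_on with
  | zero => simp
  | tmul p c =>
    rw [scalarOp_tmul, scalarOp_tmul, TensorProduct.smul_tmul', TensorProduct.smul_tmul',
      ← TensorProduct.add_tmul, ← TensorProduct.neg_tmul]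
    congr 1
    simp only [euler, LinearMap.sub_apply, LinearMap.smul_apply, Module.End.one_apply,
      mul_neg_one, neg_smul]
    abel
  | add P Q hP hQ =>
    simp only [map_add, smul_add, hP, hQ]
    abel

/-- Homogeneous Clifford-valued polynomials of degree `k`. -/
def homogeneousPoly (m k : ℕ) : Submodule ℂ (CliffordPoly m) :=
  LinearMap.range (TensorProduct.AlgebraTensorModule.map
      (MvPolynomial.homogeneousSubmodule (Fin m) ℂ k).subtype
      (LinearMap.id : Cl m →ₗ[ℝ] Cl m))

theorem mem_monogenics_iff {k : ℕ} {P : CliffordPoly m} :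
    P ∈ monogenics m k ↔ P ∈ homogeneousPoly m k ∧ polyDirac m P = 0 := Iff.rfl

theorem tmul_mem_homogeneousPoly {k : ℕ} {p : MvPolynomial (Fin m) ℂ} (hp : p.IsHomogeneous k)
    (c : Cl m) : (p ⊗ₜ[ℝ] c : CliffordPoly m) ∈ homogeneousPoly m k :=
  ⟨(⟨p, hp⟩ : MvPolynomial.homogeneousSubmodule (Fin m) ℂ k) ⊗ₜ[ℝ] c, by simp⟩

theorem homogeneousPoly_induction {k : ℕ} {q : CliffordPoly m → Prop}
    (tmul : ∀ p : MvPolynomial (Fin m) ℂ, p.IsHomogeneous k → ∀ c : Cl m, q (p ⊗ₜ[ℝ] c))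
    (zero : q 0) (add : ∀ P Q, q P → q Q → q (P + Q)) {P : CliffordPoly m}
    (hP : P ∈ homogeneousPoly m k) : q P := by
  obtain ⟨T, rfl⟩ := hP
  induction T using TensorProduct.induction_on with
  | zero => rw [map_zero]; exact zero
  | tmul p c => simpa using tmul p.1 p.2 c
  | add S T hS hT => rw [map_add]; exact add _ _ hS hT

theorem polyVecVar_mem_homogeneousPoly {k : ℕ} {P : CliffordPoly m}
    (hP : P ∈ homogeneousPoly m k) : polyVecVar m P ∈ homogeneousPoly m (k + 1) := by
  refine homogeneousPoly_induction (q := fun P => polyVecVar m P ∈ homogeneousPoly m (k + 1))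
    (fun p hp c => ?_) (by simp) (fun P Q hP hQ => by rw [map_add]; exact add_mem hP hQ) hP
  rw [polyVecVar_tmul]
  refine Submodule.sum_mem _ fun j _ => tmul_mem_homogeneousPoly ?_ _
  rw [add_comm]
  exact (MvPolynomial.isHomogeneous_X ℂ j).mul hp

theorem polyDirac_mem_homogeneousPoly {k : ℕ} {P : CliffordPoly m}
    (hP : P ∈ homogeneousPoly m k) : polyDirac m P ∈ homogeneousPoly m (k - 1) := by
  refine homogeneousPoly_induction (q := fun P => polyDirac m P ∈ homogeneousPoly m (k - 1))
    (fun p hp c => ?_) (by simp) (fun P Q hP hQ => by rw [map_add]; exact add_mem hP hQ) hP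
  rw [polyDirac_tmul]
  exact Submodule.sum_mem _ fun j _ => tmul_mem_homogeneousPoly hp.pderiv _

theorem polyDirac_eq_zero_of_homogeneousPoly_zero {P : CliffordPoly m}
    (hP : P ∈ homogeneousPoly m 0) : polyDirac m P = 0 := by
  refine homogeneousPoly_induction (q := fun P => polyDirac m P = 0)
    (fun p hp c => ?_) (by simp) (fun P Q hP hQ => by rw [map_add, hP, hQ, add_zero]) hP
  rw [polyDirac_tmul]
  refine Finset.sum_eq_zero fun j _ => ?_
  rw [MvPolynomial.totalDegree_eq_zero_iff_eq_C.mp (Nat.le_zero.mp hp.totalDegree_le),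
    MvPolynomial.pderiv_C, TensorProduct.zero_tmul]

theorem euler_homogeneousPoly {k : ℕ} {P : CliffordPoly m} (hP : P ∈ homogeneousPoly m k) :
    scalarOp m (euler m) P = (k : ℂ) • P := by
  refine homogeneousPoly_induction (q := fun P => scalarOp m (euler m) P = (k : ℂ) • P)
    (fun p hp c => ?_) (by simp) (fun P Q hP hQ => by rw [map_add, hP, hQ, smul_add]) hP
  rw [scalarOp_tmul, TensorProduct.smul_tmul']
  congr 1
  simp only [euler, LinearMap.sum_apply, Module.End.mul_apply, LinearMap.mulLeft_apply,
    Derivation.coeFn_coe]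
  rw [hp.sum_X_mul_pderiv, Nat.cast_smul_eq_nsmul]

theorem polyDirac_polyVecVar_of_mem {k : ℕ} {P : CliffordPoly m}
    (hP : P ∈ homogeneousPoly m k) :
    polyDirac m (polyVecVar m P) = -((2 * k + m : ℂ) • P) - polyVecVar m (polyDirac m P) := by
  rw [eq_sub_iff_add_eq, add_comm, polyVecVar_polyDirac_add, euler_homogeneousPoly hP, smul_smul,
    ← add_smul]

end PolynomialOperators

/-! ### An abstract ladder -/

section Ladder

/-- The coefficients of the lowering operator: `j` for even `j` and `2λ + j - 1` for odd `j`. -/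
def ladderCoeff (lam : ℂ) (j : ℕ) : ℂ := if Even j then j else 2 * lam + j - 1

theorem ladderCoeff_succ (lam : ℂ) (j : ℕ) :
    ladderCoeff lam (j + 1) = 2 * (lam + j) - ladderCoeff lam j := by
  unfold ladderCoeff
  by_cases h : Even j
  · rw [if_pos h, if_neg (by simpa [Nat.even_add_one] using h)]
    push_cast
    ring
  · rw [if_neg h, if_pos (by simpa [Nat.even_add_one] using h)]
    push_cast
    ring

theorem ladderCoeff_zero (lam : ℂ) : ladderCoeff lam 0 = 0 := by simp [ladderCoeff]

/-- The anticommutator of raising and lowering is known on each v_j, which determines the lowering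
coefficients recursively. It is used for x and -∂ on polynomials and for b⁺ and b⁻ on the ψ's. -/
theorem lower_apply {X : Type*} [AddCommGroup X] [Module ℂ X] {u l : Module.End ℂ X} {v : ℕ → X}
    {lam : ℂ} (hv : ∀ j, v (j + 1) = u (v j)) (h0 : l (v 0) = 0)
    (h : ∀ j, l (u (v j)) + u (l (v j)) = (2 * (lam + j)) • v j) (j : ℕ) :
    l (v j) = ladderCoeff lam j • v (j - 1) := by
  induction j with
  | zero => rw [h0, ladderCoeff_zero, zero_smul]
  | succ j ih =>
    have h1 : u (l (v j)) = ladderCoeff lam j • v j := by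
      rw [ih, map_smul, ← hv]
      -- At j = 0 the truncated index j - 1 is harmless because the coefficient vanishes.
      rcases j with _ | j
      · simp [ladderCoeff_zero]
      · rfl
    rw [hv, eq_sub_of_add_eq (h j), h1, ← sub_smul, ladderCoeff_succ, Nat.add_sub_cancel]

end Ladder

/-! ### The Fischer decomposition -/

section Fischer

variable {m : ℕ}

theorem polyVecVar_pow_mem {i : ℕ} {M : CliffordPoly m} (hM : M ∈ homogeneousPoly m i) (j : ℕ) :
    (polyVecVar m ^ j) M ∈ homogeneousPoly m (i + j) := by
  induction j with
  | zero => simpa using hM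
  | succ j ih =>
    rw [pow_succ', Module.End.mul_apply]
    exact polyVecVar_mem_homogeneousPoly ih

theorem polyDirac_polyVecVar_pow {i : ℕ} {M : CliffordPoly m} (hM : M ∈ monogenics m i) (j : ℕ) :
    polyDirac m ((polyVecVar m ^ j) M) =
      -(ladderCoeff (i + m / 2) j • (polyVecVar m ^ (j - 1)) M) := by
  have h := lower_apply (u := polyVecVar m) (l := -polyDirac m)
    (v := fun j => (polyVecVar m ^ j) M) (lam := i + m / 2)
    (fun j => by rw [pow_succ', Module.End.mul_apply])
    (by simpa using (mem_monogenics_iff.mp hM).2)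
    (fun j => by
      rw [LinearMap.neg_apply, LinearMap.neg_apply, map_neg, polyDirac_polyVecVar_of_mem
        (polyVecVar_pow_mem (mem_monogenics_iff.mp hM).1 j), neg_sub, sub_neg_eq_add,
        add_right_comm, add_neg_cancel, zero_add]
      congr 1
      push_cast
      ring) j
  rw [← h, LinearMap.neg_apply, neg_neg]

/-- The span of the products `x^j M` of degree `k`, where `M` is a spherical monogenic. -/
def fischerSpan (m k : ℕ) : Submodule ℂ (CliffordPoly m) :=
  Submodule.span ℂ {P | ∃ i j : ℕ, i + j = k ∧ ∃ M ∈ monogenics m i, P = (polyVecVar m ^ j) M}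

/-- The Dirac operator takes x^{j+1}M to a multiple of x^jM, and this ladder coefficient is never
zero: it is j + 1 or 2i + m + j. -/
theorem exists_polyDirac_eq_of_mem_fischerSpan (hm : 1 ≤ m) {k : ℕ} {P : CliffordPoly m}
    (hP : P ∈ fischerSpan m k) : ∃ R ∈ fischerSpan m (k + 1), polyDirac m R = P := by
  suffices h : fischerSpan m k ≤ (fischerSpan m (k + 1)).map (polyDirac m) from h hP
  rw [fischerSpan, Submodule.span_le]
  rintro _ ⟨i, j, rfl, M, hM, rfl⟩
  have hc : ladderCoeff ((i : ℂ) + m / 2) (j + 1) ≠ 0 := by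
    unfold ladderCoeff
    split_ifs
    · exact Nat.cast_ne_zero.mpr (Nat.succ_ne_zero j)
    · have h1 : 2 * ((i : ℂ) + m / 2) + ((j + 1 : ℕ) : ℂ) - 1 = ((2 * i + m + j : ℕ) : ℂ) := by
        push_cast
        ring
      rw [h1]
      exact Nat.cast_ne_zero.mpr (by omega)
  refine ⟨-((ladderCoeff ((i : ℂ) + m / 2) (j + 1))⁻¹ • (polyVecVar m ^ (j + 1)) M),
    Submodule.neg_mem _ (Submodule.smul_mem _ _ (Submodule.subset_span
      ⟨i, j + 1, by ring, M, hM, rfl⟩)), ?_⟩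
  rw [map_neg, map_smul, polyDirac_polyVecVar_pow hM, smul_neg, neg_neg, smul_smul,
    inv_mul_cancel₀ hc, one_smul, Nat.add_sub_cancel]

theorem fischerSpan_le_homogeneousPoly (k : ℕ) : fischerSpan m k ≤ homogeneousPoly m k := by
  rw [fischerSpan, Submodule.span_le]
  rintro _ ⟨i, j, rfl, M, hM, rfl⟩
  exact polyVecVar_pow_mem (mem_monogenics_iff.mp hM).1 j

/-- The Fischer decomposition. -/
theorem homogeneousPoly_le_fischerSpan (hm : 1 ≤ m) (k : ℕ) :
    homogeneousPoly m k ≤ fischerSpan m k := by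
  induction k with
  | zero =>
    intro P hP
    exact Submodule.subset_span ⟨0, 0, rfl, P,
      mem_monogenics_iff.mpr ⟨hP, polyDirac_eq_zero_of_homogeneousPoly_zero hP⟩, by simp⟩
  | succ k ih =>
    intro P hP
    have h0 := polyDirac_mem_homogeneousPoly hP
    rw [Nat.add_sub_cancel] at h0
    -- Solving ∂R = ∂P inside the span leaves a monogenic remainder P - R.
    obtain ⟨R, hR, hRP⟩ := exists_polyDirac_eq_of_mem_fischerSpan hm (ih h0)
    have hR' := fischerSpan_le_homogeneousPoly (k + 1) hR
    have h : P - R ∈ monogenics m (k + 1) := mem_monogenics_iff.mpr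
      ⟨Submodule.sub_mem _ hP hR', by rw [map_sub, hRP, sub_self]⟩
    rw [← sub_add_cancel P R]
    refine Submodule.add_mem _ (Submodule.subset_span ?_) hR
    exact ⟨k + 1, 0, rfl, P - R, h, by simp⟩

theorem iSup_fischerSpan (hm : 1 ≤ m) : ⨆ k, fischerSpan m k = ⊤ := by
  rw [eq_top_iff]
  rintro P -
  induction P using TensorProduct.induction_on with
  | zero => exact zero_mem _
  | add P Q hP hQ => exact add_mem hP hQ
  | tmul p c =>
    have h (k : ℕ) : (MvPolynomial.homogeneousComponent k p ⊗ₜ[ℝ] c : CliffordPoly m) ∈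
        ⨆ k, fischerSpan m k := by
      refine Submodule.mem_iSup_of_mem (p := fischerSpan m) k ?_
      refine homogeneousPoly_le_fischerSpan hm k ?_
      exact tmul_mem_homogeneousPoly (MvPolynomial.homogeneousComponent_isHomogeneous k p) c
    have h2 : (p ⊗ₜ[ℝ] c : CliffordPoly m) = ∑ k ∈ Finset.range (p.totalDegree + 1),
        MvPolynomial.homogeneousComponent k p ⊗ₜ[ℝ] c := by
      rw [← TensorProduct.sum_tmul, MvPolynomial.sum_homogeneousComponent]
    rw [h2]
    exact Submodule.sum_mem _ fun k _ => h k

end Fischer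
end CliffordFT

namespace CliffordFT

/-! ### The action of osp(1|2) on the functions ψ -/

section GaussianOperators

variable {m : ℕ}

theorem cliffordGauss_tmul (p : MvPolynomial (Fin m) ℂ) (c : Cl m) :
    cliffordGauss m (p ⊗ₜ[ℝ] c) = polyGauss m p ⊗ₜ[ℝ] c := by
  simp [cliffordGauss]

theorem vecVar_tmul (f : 𝓢(E m, ℂ)) (c : Cl m) :
    vecVar m (f ⊗ₜ[ℝ] c) = ∑ j, coordMul j f ⊗ₜ[ℝ] (gen j * c) := cliffOp_tmul _ f c

theorem dirac_tmul (f : 𝓢(E m, ℂ)) (c : Cl m) :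
    dirac m (f ⊗ₜ[ℝ] c) = ∑ j, partialD j f ⊗ₜ[ℝ] (gen j * c) := cliffOp_tmul _ f c

theorem vecVar_cliffordGauss (P : CliffordPoly m) :
    vecVar m (cliffordGauss m P) = cliffordGauss m (polyVecVar m P) := by
  induction P using TensorProduct.induction_on with
  | zero => simp
  | tmul p c =>
    simp only [cliffordGauss_tmul, vecVar_tmul, polyVecVar_tmul, map_sum, coordMul_polyGauss]
  | add P Q hP hQ => simp only [map_add, hP, hQ]

theorem dirac_cliffordGauss (P : CliffordPoly m) :
    dirac m (cliffordGauss m P) = cliffordGauss m (polyDirac m P - polyVecVar m P) := by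
  induction P using TensorProduct.induction_on with
  | zero => simp
  | tmul p c =>
    simp only [cliffordGauss_tmul, dirac_tmul, polyDirac_tmul, polyVecVar_tmul, map_sub, map_sum,
      partialD_polyGauss, TensorProduct.sub_tmul, Finset.sum_sub_distrib]
  | add P Q hP hQ =>
    simp only [map_add, map_sub] at hP hQ ⊢
    rw [hP, hQ]
    abel

theorem bPlus_apply (F : CliffordSchwartz m) :
    bPlus m F = ((Real.sqrt 2 / 2 : ℝ) : ℂ) • (vecVar m F - dirac m F) := rfl

theorem bMinus_apply (F : CliffordSchwartz m) :
    bMinus m F = -(((Real.sqrt 2 / 2 : ℝ) : ℂ) • (vecVar m F + dirac m F)) := by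
  rw [← neg_smul]
  rfl

theorem bPlus_cliffordGauss (P : CliffordPoly m) : bPlus m (cliffordGauss m P) =
    ((Real.sqrt 2 / 2 : ℝ) : ℂ) • cliffordGauss m ((2 : ℂ) • polyVecVar m P - polyDirac m P) := by
  rw [bPlus_apply, vecVar_cliffordGauss, dirac_cliffordGauss, ← map_sub, two_smul]
  congr 2
  abel

theorem bMinus_cliffordGauss (P : CliffordPoly m) : bMinus m (cliffordGauss m P) =
    -(((Real.sqrt 2 / 2 : ℝ) : ℂ) • cliffordGauss m (polyDirac m P)) := by
  rw [bMinus_apply, vecVar_cliffordGauss, dirac_cliffordGauss, ← map_add]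
  congr 3
  abel

theorem sqrt_two_div_two_mul_sqrt_two :
    ((Real.sqrt 2 / 2 : ℝ) : ℂ) * ((Real.sqrt 2 : ℝ) : ℂ) = 1 := by
  rw [← Complex.ofReal_mul, div_mul_eq_mul_div, Real.mul_self_sqrt zero_le_two, div_self two_ne_zero,
    Complex.ofReal_one]

theorem sqrt_two_div_two_mul_self :
    ((Real.sqrt 2 / 2 : ℝ) : ℂ) * ((Real.sqrt 2 / 2 : ℝ) : ℂ) = 1 / 2 := by
  have h : (Real.sqrt 2 / 2) * (Real.sqrt 2 / 2) = 1 / 2 := by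
    have := Real.mul_self_sqrt (zero_le_two (α := ℝ))
    nlinarith
  rw [← Complex.ofReal_mul, h]
  norm_num

theorem psi_two_mul (p k : ℕ) (M : CliffordPoly m) : psi m (2 * p) k M =
    ((2 ^ p * p ! : ℕ) : ℂ) • cliffordGauss m
      (polyMul (Polynomial.aeval (normSqPoly m) (laguerre p ((m : ℝ) / 2 + k - 1))) M) := by
  rw [psi, if_pos (even_two_mul p), Nat.mul_div_cancel_left p two_pos]

theorem psi_two_mul_add_one (p k : ℕ) (M : CliffordPoly m) : psi m (2 * p + 1) k M =
    (((2 ^ p * p ! : ℕ) : ℂ) * ((Real.sqrt 2 : ℝ) : ℂ)) • cliffordGauss m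
      (polyMul (Polynomial.aeval (normSqPoly m) (laguerre p ((m : ℝ) / 2 + k)))
        (polyVecVar m M)) := by
  rw [psi, if_neg (by simp), show (2 * p + 1) / 2 = p by omega]

theorem aeval_real_smul (a : ℝ) (Q : Polynomial ℝ) :
    Polynomial.aeval (normSqPoly m) (a • Q) = (a : ℂ) • Polynomial.aeval (normSqPoly m) Q := by
  rw [map_smul]
  rfl

/-- Conjugated by the Gaussian, b⁺ becomes (√2/2)(2x - ∂); on a radial factor times M or xM this is
one of the two Laguerre recurrences, and the constants in ψ make it hold without a factor. -/
theorem psi_succ (hm : 1 ≤ m) (j : ℕ) {k : ℕ} {M : CliffordPoly m} (hM : M ∈ monogenics m k) :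
    psi m (j + 1) k M = bPlus m (psi m j k M) := by
  obtain ⟨hMk, hM0⟩ := mem_monogenics_iff.mp hM
  have ha : 0 < (m : ℝ) / 2 + k := by
    have : (1 : ℝ) ≤ m := by exact_mod_cast hm
    positivity
  obtain ⟨p, rfl | rfl⟩ := Nat.even_or_odd' j
  · have key (R S : CliffordPoly m) : (2 : ℂ) • R - (2 : ℂ) • S = (2 : ℂ) • (R - S) :=
      (smul_sub _ _ _).symm
    rw [psi_two_mul_add_one, psi_two_mul, map_smul, bPlus_cliffordGauss, polyVecVar_polyMul,
      polyDirac_polyMul_aeval, hM0, map_zero, zero_add, key, ← polyMul_sub, ← map_sub,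
      ← laguerre_eq_sub_derivative ha, map_smul, smul_smul, smul_smul]
    congr 1
    rw [mul_assoc]
    congr 1
    push_cast
    ring
  · have hx : polyDirac m (polyVecVar m M) = -((2 * k + m : ℂ) • M) := by
      rw [polyDirac_polyVecVar_of_mem hMk, hM0, map_zero, sub_zero]
    set Q := laguerre p ((m : ℝ) / 2 + k) with hQ
    have key : (2 : ℂ) • polyVecVar m (polyMul (Polynomial.aeval (normSqPoly m) Q)
          (polyVecVar m M)) -
        polyDirac m (polyMul (Polynomial.aeval (normSqPoly m) Q) (polyVecVar m M)) =
        (2 * ((p : ℂ) + 1)) • polyMul (Polynomial.aeval (normSqPoly m)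
          (laguerre (p + 1) ((m : ℝ) / 2 + k - 1))) M := by
      have h1 := congrArg (fun R => polyMul (Polynomial.aeval (normSqPoly m) R) M)
        (succ_smul_laguerre_succ ha p)
      simp only [map_add, map_sub, aeval_real_smul, map_mul, Polynomial.aeval_X, polyMul_smul,
        polyMul_add, polyMul_sub] at h1
      rw [mul_comm (normSqPoly m), mul_comm (normSqPoly m), polyMul_mul, polyMul_mul, ← hQ] at h1
      rw [mul_smul, show ((p : ℂ) + 1) = (((p : ℝ) + 1 : ℝ) : ℂ) by push_cast; rfl, h1,
        polyVecVar_polyMul, polyDirac_polyMul_aeval, hx, polyVecVar_polyVecVar]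
      simp only [map_neg, map_smul]
      rw [show (2 * (k : ℂ) + m) = 2 * (((m : ℝ) / 2 + k : ℝ) : ℂ) by push_cast; ring, mul_smul]
      module
    rw [show 2 * p + 1 + 1 = 2 * (p + 1) by ring, psi_two_mul, psi_two_mul_add_one, map_smul,
      bPlus_cliffordGauss, key, map_smul, smul_smul, smul_smul, Nat.factorial_succ]
    congr 1
    have h2 := sqrt_two_div_two_mul_sqrt_two
    rw [pow_succ]
    push_cast at h2 ⊢
    linear_combination (-(2 ^ p * (p ! : ℂ) * 2 * (p + 1))) * h2

theorem psi_zero (hm : 1 ≤ m) (k : ℕ) (M : CliffordPoly m) :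
    psi m 0 k M = cliffordGauss m M := by
  have ha : 0 < (m : ℝ) / 2 + k - 1 + 1 := by
    have : (1 : ℝ) ≤ m := by exact_mod_cast hm
    rw [sub_add_cancel]
    positivity
  have h := psi_two_mul 0 k M
  rw [mul_zero, laguerre_zero ha, map_one, polyMul_one] at h
  simpa using h

theorem bMinus_psi_zero (hm : 1 ≤ m) {k : ℕ} {M : CliffordPoly m} (hM : M ∈ monogenics m k) :
    bMinus m (psi m 0 k M) = 0 := by
  rw [psi_zero hm, bMinus_cliffordGauss, (mem_monogenics_iff.mp hM).2, map_zero, smul_zero,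
    neg_zero]

theorem two_smul_hOp (F : CliffordSchwartz m) :
    (2 : ℂ) • hOp m F = bMinus m (bPlus m F) + bPlus m (bMinus m F) := by
  rw [hOp, LinearMap.smul_apply, smul_smul]
  norm_num

/-- The mixed terms x∂ and ∂x cancel in {b⁻, b⁺}, which leaves ∂² - x² = |x|² - Δ. -/
theorem hOp_eq_scalarOp : hOp m = (1 / 2 : ℂ) • scalarOp m (harmonic m) := by
  have hx : vecVar m * vecVar m = -scalarOp m (∑ i, coordMul i * coordMul i) :=
    cliffOp_mul_self coordMul commute_coordMul
  have hd : dirac m * dirac m = -scalarOp m (∑ i, partialD i * partialD i) :=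
    cliffOp_mul_self partialD commute_partialD
  have h : scalarOp m (harmonic m) = scalarOp m (∑ i, coordMul i * coordMul i) -
      scalarOp m (∑ i, partialD i * partialD i) := by
    refine tensor_end_ext fun f c => ?_
    rw [LinearMap.sub_apply, scalarOp_tmul, scalarOp_tmul, scalarOp_tmul, harmonic,
      Finset.sum_sub_distrib, LinearMap.sub_apply, TensorProduct.sub_tmul]
  rw [hOp, h, ← neg_eq_iff_eq_neg.mpr hx, ← neg_eq_iff_eq_neg.mpr hd]
  congr 1
  have h2 : bMinus m = (-((Real.sqrt 2 / 2 : ℝ) : ℂ)) • (vecVar m + dirac m) := rfl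
  have h3 : bPlus m = ((Real.sqrt 2 / 2 : ℝ) : ℂ) • (vecVar m - dirac m) := rfl
  rw [h2, h3]
  simp only [smul_mul_smul_comm, neg_mul, mul_neg, sqrt_two_div_two_mul_self, mul_add, add_mul,
    mul_sub, sub_mul]
  module

theorem hOp_apply (F : CliffordSchwartz m) :
    hOp m F = (1 / 2 : ℂ) • scalarOp m (harmonic m) F := by
  rw [hOp_eq_scalarOp, LinearMap.smul_apply]

theorem scalarOp_harmonic_vecVar (F : CliffordSchwartz m) :
    scalarOp m (harmonic m) (vecVar m F) =
      vecVar m (scalarOp m (harmonic m) F) - (2 : ℂ) • dirac m F := by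
  induction F using TensorProduct.induction_on with
  | zero => simp
  | tmul f c =>
    simp only [vecVar_tmul, dirac_tmul, scalarOp_tmul, map_sum, harmonic_coordMul,
      TensorProduct.sub_tmul, Finset.sum_sub_distrib, Finset.smul_sum, TensorProduct.smul_tmul']
  | add F G hF hG => simp only [map_add, hF, hG, smul_add]; abel

theorem scalarOp_harmonic_dirac (F : CliffordSchwartz m) :
    scalarOp m (harmonic m) (dirac m F) =
      dirac m (scalarOp m (harmonic m) F) - (2 : ℂ) • vecVar m F := by
  induction F using TensorProduct.induction_on with
  | zero => simp
  | tmul f c =>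
    simp only [vecVar_tmul, dirac_tmul, scalarOp_tmul, map_sum, harmonic_partialD,
      TensorProduct.sub_tmul, Finset.sum_sub_distrib, Finset.smul_sum, TensorProduct.smul_tmul']
  | add F G hF hG => simp only [map_add, hF, hG, smul_add]; abel

theorem hOp_bPlus (F : CliffordSchwartz m) : hOp m (bPlus m F) = bPlus m (hOp m F) + bPlus m F := by
  simp only [hOp_apply, bPlus_apply, map_smul, map_sub, scalarOp_harmonic_vecVar,
    scalarOp_harmonic_dirac]
  module

theorem hOp_psi (hm : 1 ≤ m) (j : ℕ) {k : ℕ} {M : CliffordPoly m} (hM : M ∈ monogenics m k) :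
    hOp m (psi m j k M) = ((k : ℂ) + m / 2 + j) • psi m j k M := by
  induction j with
  | zero =>
    obtain ⟨hMk, hM0⟩ := mem_monogenics_iff.mp hM
    have h := two_smul_hOp (psi m 0 k M)
    rw [bMinus_psi_zero hm hM, map_zero, add_zero, psi_zero hm, bPlus_cliffordGauss, map_smul,
      bMinus_cliffordGauss, map_sub, hM0, map_zero, sub_zero, map_smul,
      polyDirac_polyVecVar_of_mem hMk, hM0, map_zero, sub_zero, map_smul, map_neg, map_smul,
      smul_neg, smul_neg, smul_neg, smul_neg, neg_neg, smul_smul, smul_smul, smul_smul] at h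
    rw [psi_zero hm]
    refine smul_right_injective _ (two_ne_zero' ℂ) ?_
    simp only
    rw [h, smul_smul]
    congr 1
    have h2 := sqrt_two_div_two_mul_self
    push_cast at h2 ⊢
    linear_combination (2 * (2 * (k : ℂ) + m)) * h2
  | succ j ih =>
    rw [psi_succ hm j hM, hOp_bPlus, ih, map_smul]
    push_cast
    module

theorem bMinus_psi (hm : 1 ≤ m) (j : ℕ) {k : ℕ} {M : CliffordPoly m} (hM : M ∈ monogenics m k) :
    bMinus m (psi m j k M) = ladderCoeff (k + m / 2) j • psi m (j - 1) k M :=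
  lower_apply (v := fun j => psi m j k M) (fun j => psi_succ hm j hM) (bMinus_psi_zero hm hM)
    (fun j => by rw [← two_smul_hOp, hOp_psi hm j hM, smul_smul]) j

/-- Each term of C returns ψ_{j,k} to a multiple of itself, expressed in at most four consecutive
ladder coefficients; their recursion makes the total independent of j. -/
theorem casimir_psi (hm : 1 ≤ m) (j : ℕ) {k : ℕ} {M : CliffordPoly m} (hM : M ∈ monogenics m k) :
    casimir m (psi m j k M) = ((k : ℂ) + m / 2 - 1 / 2) ^ 2 • psi m j k M := by
  have hp (i : ℕ) : bPlus m (psi m i k M) = psi m (i + 1) k M := (psi_succ hm i hM).symm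
  have he (F : CliffordSchwartz m) : eOp m F = (1 / 2 : ℂ) • bPlus m (bPlus m F) := by
    simp only [eOp, LinearMap.smul_apply, LinearMap.add_apply, Module.End.mul_apply]
    module
  have hf (F : CliffordSchwartz m) : fOp m F = (-(1 / 2) : ℂ) • bMinus m (bMinus m F) := by
    simp only [fOp, LinearMap.smul_apply, LinearMap.add_apply, Module.End.mul_apply]
    module
  have hbp : bPlus m (bMinus m (psi m j k M)) = ladderCoeff (k + m / 2) j • psi m j k M := by
    rw [bMinus_psi hm j hM, map_smul, hp]
    rcases j with _ | j
    · simp [ladderCoeff_zero]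
    · rfl
  have hef : eOp m (fOp m (psi m j k M)) =
      (-(1 / 4) * (ladderCoeff (k + m / 2) j * ladderCoeff (k + m / 2) (j - 1))) •
        psi m j k M := by
    rw [hf, map_smul, he, bMinus_psi hm j hM, map_smul, bMinus_psi hm _ hM, map_smul, map_smul,
      map_smul, map_smul, hp, hp]
    rcases j with _ | _ | j
    · simp [ladderCoeff_zero]
    · simp [ladderCoeff_zero]
    · simp only [Nat.add_sub_cancel, smul_smul]
      congr 1
      ring
  have hfe : fOp m (eOp m (psi m j k M)) =
      (-(1 / 4) * (ladderCoeff (k + m / 2) (j + 2) * ladderCoeff (k + m / 2) (j + 1))) •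
        psi m j k M := by
    rw [he, map_smul, hf, hp, hp, bMinus_psi hm _ hM, map_smul, Nat.add_sub_cancel,
      bMinus_psi hm _ hM, Nat.add_sub_cancel, smul_smul, smul_smul, smul_smul]
    congr 1
    ring
  simp only [casimir, LinearMap.add_apply, LinearMap.sub_apply, LinearMap.smul_apply,
    Module.End.mul_apply, Module.End.one_apply, pow_two (hOp m), hef, hfe, hbp, hp,
    bMinus_psi hm (j + 1) hM, hOp_psi hm j hM, map_smul, Nat.add_sub_cancel, smul_smul,
    ← add_smul, ← sub_smul]
  congr 1
  rcases j with _ | j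
  · simp only [ladderCoeff_succ, ladderCoeff_zero]
    push_cast
    ring
  · simp only [Nat.add_sub_cancel, ladderCoeff_succ (k + m / 2) (j + 1 + 1),
      ladderCoeff_succ (k + m / 2) (j + 1)]
    -- The recursion has reduced everything to the coefficients at j and j + 1, whose explicit
    -- values depend on the parity of j.
    unfold ladderCoeff
    by_cases h : Even j
    · rw [if_pos h, if_neg (by simpa [Nat.even_add_one] using h)]
      push_cast
      ring
    · rw [if_neg h, if_pos (by simpa [Nat.even_add_one] using h)]
      push_cast
      ring

theorem aeval_casimir_psi (hm : 1 ≤ m) (Q : Polynomial ℂ) (j : ℕ) {k : ℕ} {M : CliffordPoly m}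
    (hM : M ∈ monogenics m k) : Polynomial.aeval (casimir m) Q (psi m j k M) =
      Q.eval (((k : ℂ) + m / 2 - 1 / 2) ^ 2) • psi m j k M := by
  induction Q using Polynomial.induction_on' with
  | add P Q hP hQ => rw [map_add, LinearMap.add_apply, hP, hQ, Polynomial.eval_add, add_smul]
  | monomial n a =>
    rw [Polynomial.aeval_monomial, Module.End.mul_apply, Module.algebraMap_end_apply,
      Polynomial.eval_monomial, mul_smul]
    congr 1
    induction n with
    | zero => simp
    | succ n ih =>
      rw [pow_succ, Module.End.mul_apply, casimir_psi hm j hM, map_smul, ih, smul_smul,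
        ← pow_succ']

end GaussianOperators

/-! ### Adjoints for the invariant inner product -/

section Symmetry

variable {m : ℕ} {κ : Type*} [Fintype κ] {L : κ → Module.Dual ℝ (Cl m)}

theorem cliffInner_neg_left (F G : CliffordSchwartz m) :
    cliffInner L (-F) G = -cliffInner L F G := by
  rw [← neg_one_smul ℂ F, cliffInner_smul_left, map_neg, map_one, neg_one_mul]

theorem cliffInner_neg_right (F G : CliffordSchwartz m) :
    cliffInner L F (-G) = -cliffInner L F G := by
  rw [← neg_one_smul ℂ G, cliffInner_smul_right, neg_one_mul]

theorem cliffInner_sub_left (F F' G : CliffordSchwartz m) :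
    cliffInner L (F - F') G = cliffInner L F G - cliffInner L F' G := by
  rw [sub_eq_add_neg, cliffInner_add_left, cliffInner_neg_left, sub_eq_add_neg]

theorem cliffInner_sub_right (F G G' : CliffordSchwartz m) :
    cliffInner L F (G - G') = cliffInner L F G - cliffInner L F G' := by
  rw [sub_eq_add_neg, cliffInner_add_right, cliffInner_neg_right, sub_eq_add_neg]

/-- As x is skew and ∂ symmetric, x - ∂ has adjoint -(x + ∂). Hence h and the Casimir element are
symmetric. -/
theorem cliffInner_bPlus (hL : InvariantFamily m L) (F G : CliffordSchwartz m) :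
    cliffInner L (bPlus m F) G = cliffInner L F (bMinus m G) := by
  rw [bPlus_apply, bMinus_apply, cliffInner_smul_left, cliffInner_neg_right, cliffInner_smul_right,
    Complex.conj_ofReal, cliffInner_sub_left, cliffInner_add_right, cliffInner_vecVar hL,
    cliffInner_dirac hL]
  ring

theorem cliffInner_bMinus (hL : InvariantFamily m L) (F G : CliffordSchwartz m) :
    cliffInner L (bMinus m F) G = cliffInner L F (bPlus m G) := by
  rw [bPlus_apply, bMinus_apply, cliffInner_smul_right, cliffInner_neg_left, cliffInner_smul_left,
    Complex.conj_ofReal, cliffInner_sub_right, cliffInner_add_left, cliffInner_vecVar hL,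
    cliffInner_dirac hL]
  ring

theorem cliffInner_hOp (hL : InvariantFamily m L) (F G : CliffordSchwartz m) :
    cliffInner L (hOp m F) G = cliffInner L F (hOp m G) := by
  simp only [hOp, LinearMap.smul_apply, LinearMap.add_apply, Module.End.mul_apply,
    cliffInner_smul_left, cliffInner_smul_right, cliffInner_add_left, cliffInner_add_right,
    cliffInner_bPlus hL, cliffInner_bMinus hL, map_div₀, map_one, map_ofNat]

theorem cliffInner_casimir (hL : InvariantFamily m L) (F G : CliffordSchwartz m) :
    cliffInner L (casimir m F) G = cliffInner L F (casimir m G) := by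
  simp only [casimir, eOp, fOp, pow_two, LinearMap.smul_apply, LinearMap.add_apply,
    LinearMap.sub_apply, Module.End.mul_apply, Module.End.one_apply, map_smul, map_add,
    cliffInner_smul_left, cliffInner_smul_right, cliffInner_add_left, cliffInner_add_right,
    cliffInner_sub_left, cliffInner_sub_right, cliffInner_hOp hL, cliffInner_bPlus hL,
    cliffInner_bMinus hL, map_div₀, map_one, map_ofNat, map_neg]

end Symmetry
end CliffordFT

namespace CliffordFT

open Filter Topology

/-! ### The span of the functions ψ is dense -/

section Span

variable {m : ℕ} {ι : ℕ → Type*} (B : ∀ k, Module.Basis (ι k) ℂ (monogenics m k))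

theorem psi_add (j k : ℕ) (M M' : CliffordPoly m) :
    psi m j k (M + M') = psi m j k M + psi m j k M' := by
  unfold psi
  split_ifs <;> simp only [map_add, smul_add]

theorem psi_smul (j k : ℕ) (z : ℂ) (M : CliffordPoly m) :
    psi m j k (z • M) = z • psi m j k M := by
  unfold psi
  split_ifs <;> simp only [map_smul, smul_comm z]

/-- `M ↦ ψ_{j,k}` as a linear map. -/
def psiLin (m j k : ℕ) : CliffordPoly m →ₗ[ℂ] CliffordSchwartz m where
  toFun := psi m j k
  map_add' := psi_add j k
  map_smul' := psi_smul j k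

variable {B}

theorem psi_basis_mem_psiSpan (j k : ℕ) (l : ι k) :
    psi m j k (B k l : CliffordPoly m) ∈ psiSpan B :=
  Submodule.subset_span ⟨j, k, l, rfl⟩

theorem psi_mem_psiSpan (j : ℕ) {k : ℕ} {M : CliffordPoly m} (hM : M ∈ monogenics m k) :
    psi m j k M ∈ psiSpan B := by
  have h : (⟨M, hM⟩ : monogenics m k) ∈ Submodule.span ℂ (Set.range (B k)) := by
    rw [(B k).span_eq]
    trivial
  have h2 : Submodule.span ℂ (Set.range (B k)) ≤
      (psiSpan B).comap (psiLin m j k ∘ₗ (monogenics m k).subtype) := by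
    rw [Submodule.span_le]
    rintro _ ⟨l, rfl⟩
    exact psi_basis_mem_psiSpan j k l
  exact h2 h

theorem bPlus_mem_psiSpan (hm : 1 ≤ m) {F : CliffordSchwartz m} (hF : F ∈ psiSpan B) :
    bPlus m F ∈ psiSpan B := by
  suffices h : psiSpan B ≤ (psiSpan B).comap (bPlus m) from h hF
  conv_lhs => rw [psiSpan]
  rw [Submodule.span_le]
  rintro _ ⟨j, k, l, rfl⟩
  show bPlus m _ ∈ psiSpan B
  rw [← psi_succ hm j (B k l).2]
  exact psi_basis_mem_psiSpan _ _ _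

theorem bMinus_mem_psiSpan (hm : 1 ≤ m) {F : CliffordSchwartz m} (hF : F ∈ psiSpan B) :
    bMinus m F ∈ psiSpan B := by
  suffices h : psiSpan B ≤ (psiSpan B).comap (bMinus m) from h hF
  conv_lhs => rw [psiSpan]
  rw [Submodule.span_le]
  rintro _ ⟨j, k, l, rfl⟩
  show bMinus m _ ∈ psiSpan B
  rw [bMinus_psi hm j (B k l).2]
  exact Submodule.smul_mem _ _ (psi_basis_mem_psiSpan _ _ _)

theorem vecVar_eq_bPlus_sub_bMinus (F : CliffordSchwartz m) :
    vecVar m F = ((Real.sqrt 2 / 2 : ℝ) : ℂ) • (bPlus m F - bMinus m F) := by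
  rw [bPlus_apply, bMinus_apply, sub_neg_eq_add, ← smul_add, smul_smul, sqrt_two_div_two_mul_self]
  module

theorem vecVar_mem_psiSpan (hm : 1 ≤ m) {F : CliffordSchwartz m} (hF : F ∈ psiSpan B) :
    vecVar m F ∈ psiSpan B := by
  rw [vecVar_eq_bPlus_sub_bMinus]
  exact Submodule.smul_mem _ _ (Submodule.sub_mem _ (bPlus_mem_psiSpan hm hF)
    (bMinus_mem_psiSpan hm hF))

/-- By the Fischer decomposition P is a combination of terms x^jM. Now M e^{-|x|²/2} is a ψ with j =
0, and x is a multiple of b⁺ - b⁻, which preserves the span. -/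
theorem cliffordGauss_mem_psiSpan (hm : 1 ≤ m) (P : CliffordPoly m) :
    cliffordGauss m P ∈ psiSpan B := by
  suffices h : (⊤ : Submodule ℂ (CliffordPoly m)) ≤ (psiSpan B).comap (cliffordGauss m) from
    h trivial
  rw [← iSup_fischerSpan hm, iSup_le_iff]
  intro k
  rw [fischerSpan, Submodule.span_le]
  rintro _ ⟨i, j, -, M, hM, rfl⟩
  show cliffordGauss m _ ∈ psiSpan B
  induction j with
  | zero =>
    rw [pow_zero, Module.End.one_apply, ← psi_zero hm i]
    exact psi_mem_psiSpan 0 hM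
  | succ j ih =>
    rw [pow_succ', Module.End.mul_apply, ← vecVar_cliffordGauss]
    exact vecVar_mem_psiSpan hm ih

theorem dense_psiSpan (hm : 1 ≤ m) : Dense (psiSpan B : Set (CliffordSchwartz m)) := by
  rw [Submodule.dense_iff_topologicalClosure_eq_top, eq_top_iff]
  rintro F -
  induction F using TensorProduct.induction_on with
  | zero => exact zero_mem _
  | add F G hF hG => exact add_mem hF hG
  | tmul f c =>
    refine (denseRange_polyGauss hm).induction_on
      (p := fun f => (f ⊗ₜ[ℝ] c : CliffordSchwartz m) ∈ (psiSpan B).topologicalClosure) f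
      ((psiSpan B).isClosed_topologicalClosure.preimage (continuous_tmul_right c)) fun p => ?_
    rw [← cliffordGauss_tmul]
    exact (psiSpan B).le_topologicalClosure (cliffordGauss_mem_psiSpan hm _)

theorem eq_of_continuous_of_eq_on_psi (hm : 1 ≤ m) {T T' : Module.End ℂ (CliffordSchwartz m)}
    (hT : Continuous T) (hT' : Continuous T')
    (h : ∀ (j k : ℕ) (l : ι k),
      T (psi m j k (B k l : CliffordPoly m)) = T' (psi m j k (B k l : CliffordPoly m))) :
    T = T' := by
  have h1 : ∀ v ∈ psiSpan B, T v = T' v := by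
    intro v hv
    refine LinearMap.eqOn_span ?_ hv
    rintro _ ⟨j, k, l, rfl⟩
    exact h j k l
  exact LinearMap.coe_injective (hT.ext_on (dense_psiSpan (B := B) hm) hT' h1)

theorem continuous_bPlus : Continuous (bPlus m) :=
  (continuous_vecVar.sub continuous_dirac).const_smul ((Real.sqrt 2 / 2 : ℝ) : ℂ)

theorem continuous_bMinus : Continuous (bMinus m) :=
  (continuous_vecVar.add continuous_dirac).const_smul (-((Real.sqrt 2 / 2 : ℝ) : ℂ))

theorem continuous_hOp : Continuous (hOp m) :=
  ((continuous_bMinus.comp continuous_bPlus).add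
    (continuous_bPlus.comp continuous_bMinus)).const_smul (1 / 2 : ℂ)

theorem continuous_hOp_pow (n : ℕ) : Continuous ⇑(hOp m ^ n) := by
  rw [Module.End.coe_pow]
  exact continuous_hOp.iterate n

theorem component_hOp_pow (K : Module.Dual ℝ (Cl m)) (n : ℕ) (F : CliffordSchwartz m) :
    (2 : ℂ) ^ n • component K ((hOp m ^ n) F) = (harmonic m ^ n) (component K F) := by
  induction n generalizing F with
  | zero => simp
  | succ n ih =>
    rw [pow_succ (hOp m), pow_succ (harmonic m), Module.End.mul_apply, Module.End.mul_apply,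
      pow_succ, mul_comm, mul_smul, ih, hOp_apply, component_smul, component_scalarOp, map_smul,
      smul_smul]
    norm_num

theorem hOp_pow_psi (hm : 1 ≤ m) (n j : ℕ) {k : ℕ} {M : CliffordPoly m}
    (hM : M ∈ monogenics m k) :
    (hOp m ^ n) (psi m j k M) = ((k : ℂ) + m / 2 + j) ^ n • psi m j k M := by
  induction n with
  | zero => simp
  | succ n ih =>
    rw [pow_succ', Module.End.mul_apply, ih, map_smul, hOp_psi hm j hM, smul_smul, ← pow_succ]

end Span

/-! ### Orthogonality of the functions ψ -/

section Orthogonality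

variable {m : ℕ} {κ : Type*} [Fintype κ] {L : κ → Module.Dual ℝ (Cl m)}

/-- Joint eigenvectors of the symmetric operators h and C with different eigenvalue pairs are
orthogonal. The pair determines (j,k): k + m/2 - 1/2 ≥ 0 is recovered from its square, and then j
from the eigenvalue of h. -/
theorem cliffInner_psi_eq_zero (hL : InvariantFamily m L) (hm : 1 ≤ m) {j k j' k' : ℕ}
    {M M' : CliffordPoly m} (hM : M ∈ monogenics m k) (hM' : M' ∈ monogenics m k')
    (h : (j, k) ≠ (j', k')) : cliffInner L (psi m j k M) (psi m j' k' M') = 0 := by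
  by_contra h0
  have h1 := cliffInner_hOp hL (psi m j k M) (psi m j' k' M')
  rw [hOp_psi hm j hM, hOp_psi hm j' hM', cliffInner_smul_left, cliffInner_smul_right] at h1
  have h2 := cliffInner_casimir hL (psi m j k M) (psi m j' k' M')
  rw [casimir_psi hm j hM, casimir_psi hm j' hM', cliffInner_smul_left, cliffInner_smul_right] at h2
  have h3 := mul_right_cancel₀ h0 h1
  have h4 := mul_right_cancel₀ h0 h2
  simp only [map_add, map_sub, map_pow, map_div₀, map_one, map_ofNat, Complex.conj_natCast] at h3 h4
  have h3' : (k : ℝ) + m / 2 + j = k' + m / 2 + j' :=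
    Complex.ofReal_injective (by push_cast; exact h3)
  have h4' : ((k : ℝ) + m / 2 - 1 / 2) ^ 2 = ((k' : ℝ) + m / 2 - 1 / 2) ^ 2 :=
    Complex.ofReal_injective (by push_cast; exact h4)
  have hm' : (1 : ℝ) ≤ m := by exact_mod_cast hm
  have hk : (0 : ℝ) ≤ k := Nat.cast_nonneg k
  have hk' : (0 : ℝ) ≤ k' := Nat.cast_nonneg k'
  have h5 := (sq_eq_sq₀ (by linarith) (by linarith)).mp h4'
  have h6 : (k : ℝ) = k' := by linarith
  have h7 : (j : ℝ) = j' := by linarith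
  exact h (by rw [Nat.cast_injective h6, Nat.cast_injective h7])

variable {S : Type*}

theorem cliffInner_linearCombination_congr {w w' : S → CliffordSchwartz m}
    (h : ∀ s t, cliffInner L (w s) (w t) = cliffInner L (w' s) (w' t)) (x y : S →₀ ℂ) :
    cliffInner L (Finsupp.linearCombination ℂ w x) (Finsupp.linearCombination ℂ w y) =
      cliffInner L (Finsupp.linearCombination ℂ w' x) (Finsupp.linearCombination ℂ w' y) := by
  induction x using Finsupp.induction_linear with
  | zero => simp only [map_zero, cliffInner_zero_left]
  | add x x' hx hx' => simp only [map_add, cliffInner_add_left, hx, hx']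
  | single s a =>
    induction y using Finsupp.induction_linear with
    | zero => simp only [map_zero, cliffInner_zero_right]
    | add y y' hy hy' => simp only [map_add, cliffInner_add_right, hy, hy']
    | single t b =>
      simp only [Finsupp.linearCombination_single, cliffInner_smul_left, cliffInner_smul_right, h]

theorem norm_toL2_component_le (K : Module.Dual ℝ (Cl m)) (hL : InvariantFamily m L) :
    ∃ C : ℝ, 0 ≤ C ∧ ∀ F : CliffordSchwartz m,
      ‖toL2 m (component K F)‖ ≤ C * Real.sqrt (∑ k, ‖toL2 m (component (L k) F)‖ ^ 2) := by
  obtain ⟨a, rfl⟩ := hL.exists_eq_sum K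
  refine ⟨∑ k, |a k|, Finset.sum_nonneg fun k _ => abs_nonneg _, fun F => ?_⟩
  have h : toL2 m (component (∑ k, a k • L k) F) =
      ∑ k, (a k : ℂ) • toL2 m (component (L k) F) := by
    rw [component_sum_smul, map_sum]
    exact Finset.sum_congr rfl fun k _ => (toL2 m).map_smul (a k : ℂ) (component (L k) F)
  rw [h, Finset.sum_mul]
  refine (norm_sum_le _ _).trans (Finset.sum_le_sum fun k hk => ?_)
  rw [norm_smul, Complex.norm_real, Real.norm_eq_abs]
  refine mul_le_mul_of_nonneg_left ?_ (abs_nonneg _)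
  exact Real.le_sqrt_of_sq_le (Finset.single_le_sum
    (f := fun k => ‖toL2 m (component (L k) F)‖ ^ 2) (fun i _ => sq_nonneg _) hk)

end Orthogonality

/-! ### Continuous extension of unimodular multipliers -/

section Extension

variable {m : ℕ} {ι : ℕ → Type*} (B : ∀ k, Module.Basis (ι k) ℂ (monogenics m k))

/-- The functions `ψ_{j,k,ℓ}` as one family. -/
def psiFamily (s : Σ k, ℕ × ι k) : CliffordSchwartz m :=
  psi m s.2.1 s.1 (B s.1 s.2.2 : CliffordPoly m)

theorem range_linearCombination_psiFamily :
    LinearMap.range (Finsupp.linearCombination ℂ (psiFamily B)) = psiSpan B := by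
  rw [Finsupp.range_linearCombination, psiSpan]
  congr 1
  ext v
  constructor
  · rintro ⟨⟨k, j, l⟩, rfl⟩
    exact ⟨j, k, l, rfl⟩
  · rintro ⟨j, k, l, rfl⟩
    exact ⟨⟨k, j, l⟩, rfl⟩

variable (μ : ℕ → ℕ → ℂ)

/-- The functions `μ_{j,k} ψ_{j,k,ℓ}` as one family. -/
def scaledFamily (s : Σ k, ℕ × ι k) : CliffordSchwartz m := μ s.2.1 s.1 • psiFamily B s

variable {μ} {κ : Type*} [Fintype κ] {L : κ → Module.Dual ℝ (Cl m)}

/-- The Gram matrix does not change: entries with different (j,k) are zero, and entries with equal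
(j,k) are multiplied by |μ_{j,k}|² = 1. No orthogonality in ℓ is needed because μ does not depend on
ℓ. -/
theorem cliffInner_hOp_pow_scaledFamily (hL : InvariantFamily m L) (hm : 1 ≤ m)
    (hμ : ∀ j k, ‖μ j k‖ = 1) (n : ℕ) (x : (Σ k, ℕ × ι k) →₀ ℂ) :
    cliffInner L ((hOp m ^ n) (Finsupp.linearCombination ℂ (scaledFamily B μ) x))
        ((hOp m ^ n) (Finsupp.linearCombination ℂ (scaledFamily B μ) x)) =
      cliffInner L ((hOp m ^ n) (Finsupp.linearCombination ℂ (psiFamily B) x))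
        ((hOp m ^ n) (Finsupp.linearCombination ℂ (psiFamily B) x)) := by
  simp only [Finsupp.apply_linearCombination]
  refine cliffInner_linearCombination_congr (fun s t => ?_) x x
  obtain ⟨k, j, l⟩ := s
  obtain ⟨k', j', l'⟩ := t
  simp only [Function.comp_apply, scaledFamily, psiFamily, map_smul, hOp_pow_psi hm n _ (B _ _).2,
    cliffInner_smul_left, cliffInner_smul_right]
  by_cases h : (j, k) = (j', k')
  · obtain ⟨rfl, rfl⟩ := Prod.ext_iff.mp h
    have h1 : (starRingEnd ℂ) (μ j k) * μ j k = 1 := by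
      rw [Complex.conj_mul', hμ]
      norm_num
    linear_combination ((starRingEnd ℂ) (((k : ℂ) + m / 2 + j) ^ n) *
      (((k : ℂ) + m / 2 + j) ^ n * cliffInner L (psi m j k (B k l : CliffordPoly m))
        (psi m j k (B k l' : CliffordPoly m)))) * h1
  · rw [cliffInner_psi_eq_zero hL hm (B _ _).2 (B _ _).2 h]
    simp only [mul_zero]

theorem sum_norm_sq_scaledFamily (hL : InvariantFamily m L) (hm : 1 ≤ m)
    (hμ : ∀ j k, ‖μ j k‖ = 1) (n : ℕ) (x : (Σ k, ℕ × ι k) →₀ ℂ) :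
    ∑ k, ‖toL2 m (component (L k)
        ((hOp m ^ n) (Finsupp.linearCombination ℂ (scaledFamily B μ) x)))‖ ^ 2 =
      ∑ k, ‖toL2 m (component (L k)
        ((hOp m ^ n) (Finsupp.linearCombination ℂ (psiFamily B) x)))‖ ^ 2 := by
  have h := cliffInner_hOp_pow_scaledFamily B hL hm hμ n x
  rw [cliffInner_self, cliffInner_self] at h
  exact Complex.ofReal_injective h

/-- Makes the multiplier well defined without linear independence of the ψ's: a combination of
scaled vectors has the same norm as the unscaled one. -/
theorem ker_psiFamily_le (hm : 1 ≤ m) (hμ : ∀ j k, ‖μ j k‖ = 1) :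
    LinearMap.ker (Finsupp.linearCombination ℂ (psiFamily B)) ≤
      LinearMap.ker (Finsupp.linearCombination ℂ (scaledFamily B μ)) := by
  obtain ⟨κ, _, L, hL⟩ := exists_invariantFamily m
  intro x hx
  have h := cliffInner_hOp_pow_scaledFamily B hL hm hμ 0 x
  rw [LinearMap.mem_ker] at hx ⊢
  rw [pow_zero, Module.End.one_apply, Module.End.one_apply, hx, cliffInner_zero_left] at h
  exact eq_zero_of_cliffInner_self hL h

theorem exists_linearMap_psiSpan (hm : 1 ≤ m) (hμ : ∀ j k, ‖μ j k‖ = 1) :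
    ∃ T : psiSpan B →ₗ[ℂ] CliffordSchwartz m,
      ∀ x (hx : Finsupp.linearCombination ℂ (psiFamily B) x ∈ psiSpan B),
        T ⟨_, hx⟩ = Finsupp.linearCombination ℂ (scaledFamily B μ) x := by
  set Ψ := Finsupp.linearCombination ℂ (psiFamily B) with hΨ
  let T₀ : LinearMap.range Ψ →ₗ[ℂ] CliffordSchwartz m :=
    (LinearMap.ker Ψ).liftQ (Finsupp.linearCombination ℂ (scaledFamily B μ))
      (ker_psiFamily_le B hm hμ) ∘ₗ Ψ.quotKerEquivRange.symm.toLinearMap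
  have hT₀ (x) : T₀ ⟨Ψ x, LinearMap.mem_range_self Ψ x⟩ =
      Finsupp.linearCombination ℂ (scaledFamily B μ) x := by
    have : Ψ.quotKerEquivRange.symm ⟨Ψ x, LinearMap.mem_range_self Ψ x⟩ =
        (LinearMap.ker Ψ).mkQ x := Ψ.quotKerEquivRange_symm_apply_image x _
    simp only [T₀, LinearMap.comp_apply, LinearEquiv.coe_coe, this, Submodule.mkQ_apply,
      Submodule.liftQ_apply]
  refine ⟨T₀ ∘ₗ Submodule.inclusion (range_linearCombination_psiFamily B).ge, fun x hx => ?_⟩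
  exact hT₀ x

/-- A seminorm of T v is bounded by a norm of h^N T v, which equals that of h^N v and so depends
continuously on v. The factor 2^N comes from |x|² - Δ = 2h. -/
theorem exists_bound_psiSpan (hm : 1 ≤ m) (hμ : ∀ j k, ‖μ j k‖ = 1)
    {T : psiSpan B →ₗ[ℂ] CliffordSchwartz m}
    (hT : ∀ x (hx : Finsupp.linearCombination ℂ (psiFamily B) x ∈ psiSpan B),
      T ⟨_, hx⟩ = Finsupp.linearCombination ℂ (scaledFamily B μ) x)
    (K : Module.Dual ℝ (Cl m)) (k n : ℕ) :
    ∃ q : CliffordSchwartz m → ℝ, Continuous q ∧ q 0 = 0 ∧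
      ∀ v : psiSpan B, SchwartzMap.seminorm ℝ k n (component K (T v)) ≤ q v := by
  obtain ⟨κ, _, L, hL⟩ := exists_invariantFamily m
  obtain ⟨N, C, hC, hN⟩ := seminorm_le_hermiteNorm hm k n
  obtain ⟨C', hC', hK⟩ := norm_toL2_component_le K hL
  refine ⟨fun v => C * (2 ^ N * (C' * Real.sqrt (∑ i, ‖toL2 m (component (L i)
    ((hOp m ^ N) v))‖ ^ 2))), ?_, ?_, ?_⟩
  · have h1 (i) : Continuous fun v : CliffordSchwartz m =>
        ‖toL2 m (component (L i) ((hOp m ^ N) v))‖ ^ 2 :=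
      (((toL2 m).continuous.comp ((continuous_component (L i)).comp
        (continuous_hOp_pow N))).norm).pow 2
    exact continuous_const.mul (continuous_const.mul (continuous_const.mul
      (Real.continuous_sqrt.comp (continuous_finsetSum _ fun i _ => h1 i))))
  · simp
  · rintro ⟨v, hv⟩
    obtain ⟨x, rfl⟩ := (range_linearCombination_psiFamily B).ge hv
    rw [hT x hv]
    refine (hN _).trans (mul_le_mul_of_nonneg_left ?_ hC)
    rw [hermiteNorm, ← component_hOp_pow, map_smul, norm_smul, norm_pow, Complex.norm_ofNat]
    refine mul_le_mul_of_nonneg_left ?_ (by positivity)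
    refine (hK _).trans_eq ?_
    rw [sum_norm_sq_scaledFamily B hL hm hμ]

theorem continuous_psiSpan (hm : 1 ≤ m) (hμ : ∀ j k, ‖μ j k‖ = 1)
    {T : psiSpan B →ₗ[ℂ] CliffordSchwartz m}
    (hT : ∀ x (hx : Finsupp.linearCombination ℂ (psiFamily B) x ∈ psiSpan B),
      T ⟨_, hx⟩ = Finsupp.linearCombination ℂ (scaledFamily B μ) x)
    (K : Module.Dual ℝ (Cl m)) : Continuous fun v => component K (T v) := by
  refine continuous_of_continuousAt_zero (componentC K ∘ₗ T) ?_
  rw [ContinuousAt, map_zero, (schwartz_withSeminorms ℝ (E m) ℂ).tendsto_nhds]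
  rintro ⟨k, n⟩ ε hε
  obtain ⟨q, hq, hq0, hle⟩ := exists_bound_psiSpan B hm hμ hT K k n
  have h1 : Tendsto (fun v : psiSpan B => q v) (𝓝 0) (𝓝 0) := by
    have h := (hq.comp continuous_subtype_val).tendsto (0 : psiSpan B)
    simpa [Function.comp_def, hq0] using h
  filter_upwards [h1.eventually (gt_mem_nhds hε)] with v hv
  rw [sub_zero]
  exact (hle v).trans_lt hv

/-- A unimodular multiplier of the system `ψ_{j,k,ℓ}` extends to a continuous operator. -/
theorem exists_continuous_diagonal (hm : 1 ≤ m) (hμ : ∀ j k, ‖μ j k‖ = 1) :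
    ∃ T : Module.End ℂ (CliffordSchwartz m), Continuous T ∧ ∀ (j k : ℕ) (l : ι k),
      T (psi m j k (B k l : CliffordPoly m)) = μ j k • psi m j k (B k l : CliffordPoly m) := by
  obtain ⟨T, hT⟩ := exists_linearMap_psiSpan B hm hμ
  let _ : UniformSpace (CliffordSchwartz m) := IsTopologicalAddGroup.rightUniformSpace _
  have : IsUniformAddGroup (CliffordSchwartz m) := isUniformAddGroup_of_addCommGroup
  have : IsUniformAddGroup (psiSpan B) := (psiSpan B).toAddSubgroup.isUniformAddGroup
  -- The components are extended one by one into the complete scalar Schwartz space and then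
  -- reassembled in a basis of the Clifford algebra.
  let f (K : Module.Dual ℝ (Cl m)) : psiSpan B →L[ℂ] 𝓢(E m, ℂ) :=
    ⟨componentC K ∘ₗ T, continuous_psiSpan B hm hμ hT K⟩
  have hd : DenseRange (psiSpan B).subtypeL := by
    have := dense_psiSpan (B := B) hm
    rwa [← Subtype.range_coe (s := (psiSpan B : Set (CliffordSchwartz m)))] at this
  have he (K : Module.Dual ℝ (Cl m)) (v : psiSpan B) :
      (f K).extend (psiSpan B).subtypeL v = component K (T v) :=
    (f K).extend_eq hd isUniformEmbedding_subtype_val.isUniformInducing v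
  let b := Module.finBasis ℝ (Cl m)
  let R (i : Fin (Module.finrank ℝ (Cl m))) : 𝓢(E m, ℂ) →ₗ[ℂ] CliffordSchwartz m :=
    (TensorProduct.AlgebraTensorModule.mk ℝ ℂ 𝓢(E m, ℂ) (Cl m)).flip (b i)
  refine ⟨∑ i, R i ∘ₗ ((f (b.coord i)).extend (psiSpan B).subtypeL).toLinearMap, ?_, ?_⟩
  · refine (continuous_finsetSum Finset.univ fun i _ => (continuous_tmul_right (b i)).comp
      ((f (b.coord i)).extend (psiSpan B).subtypeL).continuous).congr fun F => ?_
    rw [LinearMap.sum_apply]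
    rfl
  · intro j k l
    have h1 := hT (Finsupp.single ⟨k, j, l⟩ 1) (by
      rw [Finsupp.linearCombination_single, one_smul]
      exact psi_basis_mem_psiSpan j k l)
    simp only [Finsupp.linearCombination_single, one_smul] at h1
    have h2 : T ⟨psi m j k (B k l), psi_basis_mem_psiSpan j k l⟩ =
        μ j k • psi m j k (B k l : CliffordPoly m) := h1
    rw [← h2, LinearMap.sum_apply]
    conv_rhs => rw [eq_sum_component_tmul b (T _)]
    exact Finset.sum_congr rfl fun i _ => congrArg (fun g => g ⊗ₜ[ℝ] b i)
      (he (b.coord i) ⟨psi m j k (B k l), psi_basis_mem_psiSpan j k l⟩)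

end Extension

end CliffordFT

namespace CliffordFT

/-! ### Integer values of the polynomials and the choice of digits -/

section IntegerValues

/-- The factors split as (N - l)(N + l + 1), so the product runs over the 2n consecutive integers
from N - n + 1 to N + n. -/
theorem prod_half_eq_descFactorial (N n : ℕ) :
    ∏ l ∈ Finset.range n, (((N : ℂ) + 1 / 2) ^ 2 - ((l : ℂ) + 1 / 2) ^ 2) =
      ((N + n).descFactorial (2 * n) : ℂ) := by
  induction n with
  | zero => simp
  | succ n ih =>
    rw [Finset.prod_range_succ, ih, show 2 * (n + 1) = 2 * n + 1 + 1 by ring, ← add_assoc,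
      Nat.succ_descFactorial_succ, Nat.descFactorial_succ]
    rcases lt_or_ge N n with h | h
    · rw [Nat.descFactorial_of_lt (by omega)]
      simp
    · obtain ⟨d, rfl⟩ := Nat.exists_eq_add_of_le h
      rw [show n + d + n - 2 * n = d by omega]
      push_cast
      ring

theorem prod_half_self (n : ℕ) :
    ∏ l ∈ Finset.range n, (((n : ℂ) + 1 / 2) ^ 2 - ((l : ℂ) + 1 / 2) ^ 2) = ((2 * n)! : ℂ) := by
  rw [prod_half_eq_descFactorial, ← two_mul, Nat.descFactorial_self]

/-- `D_n(N + ½)` is a binomial coefficient. -/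
theorem eval_halfPoly (N n : ℕ) :
    (halfPoly n).eval (((N : ℂ) + 1 / 2) ^ 2) = ((N + n).choose (2 * n) : ℂ) := by
  simp only [halfPoly, Polynomial.eval_prod, Polynomial.eval_mul, Polynomial.eval_C,
    Polynomial.eval_sub, Polynomial.eval_X, Finset.prod_mul_distrib, Finset.prod_inv_distrib]
  rw [prod_half_self, prod_half_eq_descFactorial, Nat.descFactorial_eq_factorial_mul_choose,
    Nat.cast_mul, inv_mul_cancel_left₀ (Nat.cast_ne_zero.mpr (Nat.factorial_ne_zero _))]

/-- Together with the shifted version below this expresses the products for E_n by those for D_n: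
adding the two, x + n and x - n combine to 2x. -/
theorem mul_prod_half (x : ℂ) (n : ℕ) :
    x * ∏ l ∈ Finset.range n, ((x + 1 / 2) ^ 2 - ((l : ℂ) + 1 / 2) ^ 2) =
      (x + n) * ∏ l ∈ Finset.range n, (x ^ 2 - (l : ℂ) ^ 2) := by
  induction n with
  | zero => simp
  | succ n ih =>
    rw [Finset.prod_range_succ, Finset.prod_range_succ, ← mul_assoc, ih]
    push_cast
    ring

theorem mul_prod_half_sub_one (x : ℂ) (n : ℕ) :
    x * ∏ l ∈ Finset.range n, ((x - 1 + 1 / 2) ^ 2 - ((l : ℂ) + 1 / 2) ^ 2) =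
      (x - n) * ∏ l ∈ Finset.range n, (x ^ 2 - (l : ℂ) ^ 2) := by
  induction n with
  | zero => simp
  | succ n ih =>
    rw [Finset.prod_range_succ, Finset.prod_range_succ, ← mul_assoc, ih]
    push_cast
    ring

theorem two_mul_prod_sq (N n : ℕ) :
    2 * ∏ l ∈ Finset.range n, (((N + 1 : ℕ) : ℂ) ^ 2 - (l : ℂ) ^ 2) =
      ((2 * n)! : ℂ) * (((N + 1 + n).choose (2 * n) + (N + n).choose (2 * n) : ℕ) : ℂ) := by
  have hx : ((N + 1 : ℕ) : ℂ) ≠ 0 := Nat.cast_ne_zero.mpr N.succ_ne_zero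
  have h1 := mul_prod_half ((N + 1 : ℕ) : ℂ) n
  have h2 := mul_prod_half_sub_one ((N + 1 : ℕ) : ℂ) n
  rw [show ((N + 1 : ℕ) : ℂ) - 1 = (N : ℂ) by push_cast; ring] at h2
  rw [prod_half_eq_descFactorial, Nat.descFactorial_eq_factorial_mul_choose] at h1 h2
  refine mul_left_cancel₀ hx ?_
  push_cast at h1 h2 ⊢
  linear_combination -h1 - h2

/-- The values `E_n(N)`. -/
def evenValue (N n : ℕ) : ℕ :=
  if n = 0 then 1 else if N = 0 then 0 else (N + n).choose (2 * n) + (N - 1 + n).choose (2 * n)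

theorem eval_evenPoly (N n : ℕ) : (evenPoly n).eval ((N : ℂ) ^ 2) = (evenValue N n : ℂ) := by
  -- E_0 is the empty product 1, whereas the sum of two binomial coefficients would give 2.
  rcases n with _ | n
  · simp [evenPoly, evenValue]
  simp only [evenPoly, Polynomial.eval_prod, Polynomial.eval_mul, Polynomial.eval_C,
    Polynomial.eval_sub, Polynomial.eval_X, Finset.prod_mul_distrib, Finset.prod_inv_distrib]
  rw [evenValue, if_neg n.succ_ne_zero]
  rcases N with _ | N
  · rw [if_pos rfl, Finset.prod_eq_zero (i := 0) (s := Finset.range (n + 1))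
      (f := fun l : ℕ => (((0 : ℕ) : ℂ) ^ 2 - (l : ℂ) ^ 2)) (by simp) (by simp), mul_zero, Nat.cast_zero]
  · have h1 := two_mul_prod_sq N (n + 1)
    have h2 := two_mul_prod_sq n (n + 1)
    -- The denominator of E_n is the same product at N = n, so twice it is (2n)!.
    rw [← two_mul, Nat.choose_self, Nat.choose_eq_zero_of_lt (by omega), add_zero, Nat.cast_one,
      mul_one] at h2
    have h3 : ((2 * (n + 1))! : ℂ) ≠ 0 := Nat.cast_ne_zero.mpr (Nat.factorial_ne_zero _)
    rw [if_neg N.succ_ne_zero, Nat.add_sub_cancel]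
    rw [← h2] at h1 h3
    have h4 := right_ne_zero_of_mul h3
    rw [inv_mul_eq_iff_eq_mul₀ h4]
    refine mul_left_cancel₀ (two_ne_zero' ℂ) ?_
    rw [h1, mul_assoc]

/-- The value of the `n`-th polynomial of the series at the `N`-th point. -/
def seriesValue (m N n : ℕ) : ℕ := if Odd m then evenValue N n else (N + n).choose (2 * n)

/-- With the diagonal value 1, this makes the matrix of values unitriangular: the series terminates
on each ψ, and its digits can be found by forward substitution. -/
theorem seriesValue_of_lt (m : ℕ) {N n : ℕ} (h : N < n) : seriesValue m N n = 0 := by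
  rw [seriesValue, evenValue, if_neg (show n ≠ 0 by omega),
    Nat.choose_eq_zero_of_lt (by omega : N + n < 2 * n),
    Nat.choose_eq_zero_of_lt (by omega)]
  simp

theorem seriesValue_self (m N : ℕ) : seriesValue m N N = 1 := by
  rw [seriesValue, evenValue, ← two_mul, Nat.choose_self]
  rcases N with _ | N
  · simp
  · rw [Nat.choose_eq_zero_of_lt (by omega)]
    simp

/-- The index `N` with `√C = N` (`m` odd), `√C = N + ½` (`m` even) on `ψ_{j,k,ℓ}`. -/
def casimirLevel (m k : ℕ) : ℕ := k + (m - 1) / 2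

theorem casimirPoly_psi {m : ℕ} (hm : 1 ≤ m) (n j : ℕ) {k : ℕ} {M : CliffordPoly m}
    (hM : M ∈ monogenics m k) : casimirPoly m n (psi m j k M) =
      (seriesValue m (casimirLevel m k) n : ℂ) • psi m j k M := by
  rw [casimirPoly, aeval_casimir_psi hm _ j hM]
  congr 1
  rw [seriesValue]
  split_ifs with h
  · obtain ⟨r, rfl⟩ := h
    rw [← eval_evenPoly, casimirLevel, show (2 * r + 1 - 1) / 2 = r by omega]
    congr 2
    push_cast
    ring
  · obtain ⟨r, rfl⟩ := even_iff_two_dvd.mp (Nat.not_odd_iff_even.mp h)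
    obtain ⟨r, rfl⟩ := Nat.exists_eq_add_of_le' (show 1 ≤ r by omega)
    rw [← eval_halfPoly, casimirLevel, show (2 * (r + 1) - 1) / 2 = r by omega]
    congr 2
    push_cast
    ring

theorem psi_mem_seriesDomain {m : ℕ} (hm : 1 ≤ m) (j : ℕ) {k : ℕ} {M : CliffordPoly m}
    (hM : M ∈ monogenics m k) : psi m j k M ∈ seriesDomain m :=
  ⟨casimirLevel m k + 1, fun n hn => by
    rw [casimirPoly_psi hm n j hM, seriesValue_of_lt m hn, Nat.cast_zero, zero_smul]⟩

/-- The value of the series `F` at the `N`-th point. -/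
def seriesSum (m : ℕ) (a : ℕ → Fin 4) (N : ℕ) : ℕ :=
  ∑ n ∈ Finset.range (N + 1), (a n : ℕ) * seriesValue m N n

theorem seriesOp_psi {m : ℕ} (hm : 1 ≤ m) (a : ℕ → Fin 4) (j : ℕ) {k : ℕ} {M : CliffordPoly m}
    (hM : M ∈ monogenics m k) : seriesOp m a ⟨psi m j k M, psi_mem_seriesDomain hm j hM⟩ =
      (seriesSum m a (casimirLevel m k) : ℂ) • ⟨psi m j k M, psi_mem_seriesDomain hm j hM⟩ := by
  ext
  show ∑ᶠ n, ((a n : ℕ) : ℂ) • casimirPoly m n (psi m j k M) =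
    (seriesSum m a (casimirLevel m k) : ℂ) • psi m j k M
  rw [finsum_eq_sum_of_support_subset (s := Finset.range (casimirLevel m k + 1))]
  · simp only [casimirPoly_psi hm _ j hM, seriesSum, Nat.cast_sum,
      Nat.cast_mul, Finset.sum_smul, mul_smul]
  · intro n hn
    by_contra h
    rw [Finset.coe_range, Set.mem_Iio, not_lt] at h
    refine hn ?_
    simp only [casimirPoly_psi hm _ j hM]
    rw [seriesValue_of_lt m h, Nat.cast_zero, zero_smul, smul_zero]

/-- The digits for which the series takes prescribed values modulo `4`. -/
def digit (m : ℕ) (s : ℕ → ZMod 4) : ℕ → ZMod 4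
  | N => s N - ∑ n : Fin N, digit m s n * seriesValue m N n
decreasing_by exact n.2

theorem exists_seriesSum_eq (m : ℕ) (s : ℕ → ZMod 4) :
    ∃ a : ℕ → Fin 4, ∀ N, (seriesSum m a N : ZMod 4) = s N := by
  -- `ZMod 4` unfolds to `Fin 4`, so the residues themselves serve as the digits 0, 1, 2, 3.
  refine ⟨digit m s, fun N => ?_⟩
  have h (n : ℕ) : (Fin.val (n := 4) (digit m s n) : ZMod 4) = digit m s n :=
    ZMod.natCast_zmod_val (digit m s n)
  unfold seriesSum
  rw [Finset.sum_range_succ, seriesValue_self, mul_one]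
  push_cast
  rw [h N]
  conv_lhs => rw [digit]
  rw [Finset.sum_range]
  simp only [h]
  ring

end IntegerValues

end CliffordFT

namespace CliffordFT

open Filter Topology

/-! ### Exponential series on eigenvectors -/

section Exponential

variable {W : Type*} [AddCommGroup W] [Module ℂ W] [TopologicalSpace W]

theorem isExp_of_eigenvector [ContinuousSMul ℂ W] {A : Module.End ℂ W} {v : W} {c : ℂ}
    (h : A v = c • v) : IsExp A v (Complex.exp c • v) := by
  have h1 (n : ℕ) : (A ^ n) v = c ^ n • v := by
    induction n with
    | zero => simp
    | succ n ih => rw [pow_succ', Module.End.mul_apply, ih, map_smul, h, smul_smul, ← pow_succ]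
  have h2 : HasSum (fun n : ℕ => (n ! : ℂ)⁻¹ * c ^ n) (Complex.exp c) := by
    have := NormedSpace.exp_series_hasSum_exp' (𝕂 := ℂ) c
    rwa [← Complex.exp_eq_exp_ℂ] at this
  simpa only [IsExp, h1, smul_smul] using h2.smul_const v

theorem IsExp.add [ContinuousAdd W] {A : Module.End ℂ W} {v v' w w' : W} (h : IsExp A v w)
    (h' : IsExp A v' w') : IsExp A (v + v') (w + w') := by
  simpa only [IsExp, map_add, smul_add] using HasSum.add h h'

theorem IsExp.smul [ContinuousConstSMul ℂ W] {A : Module.End ℂ W} {v w : W} (h : IsExp A v w)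
    (z : ℂ) : IsExp A (z • v) (z • w) := by
  simpa only [IsExp, map_smul, smul_comm z] using HasSum.const_smul z h

theorem isExp_zero (A : Module.End ℂ W) : IsExp A 0 0 := by
  simpa only [IsExp, map_zero, smul_zero] using hasSum_zero

theorem exp_pi_div_two_mul_I_mul (n : ℕ) :
    Complex.exp ((Real.pi : ℂ) / 2 * Complex.I * n) = Complex.I ^ n := by
  rw [mul_comm, Complex.exp_nat_mul, Complex.exp_pi_div_two_mul_I]

end Exponential

/-! ### The operators T_a and their characterization -/

section Operators

variable {m : ℕ} {ι : ℕ → Type*} {B : ∀ k, Module.Basis (ι k) ℂ (monogenics m k)}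
  {a : ℕ → Fin 4} {T : Module.End ℂ (CliffordSchwartz m)}

theorem isExp_hOp_psi (hm : 1 ≤ m) (j : ℕ) {k : ℕ} {M : CliffordPoly m}
    (hM : M ∈ monogenics m k) :
    IsExp (((Real.pi : ℂ) / 2 * Complex.I) • (hOp m - ((m : ℂ) / 2) • 1)) (psi m j k M)
      (Complex.I ^ (k + j) • psi m j k M) := by
  rw [← exp_pi_div_two_mul_I_mul]
  refine isExp_of_eigenvector ?_
  rw [LinearMap.smul_apply, LinearMap.sub_apply, LinearMap.smul_apply, Module.End.one_apply,
    hOp_psi hm j hM, mul_smul]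
  push_cast
  module

theorem isExp_seriesOp_psi (hm : 1 ≤ m) (a : ℕ → Fin 4) (j : ℕ) {k : ℕ} {M : CliffordPoly m}
    (hM : M ∈ monogenics m k) :
    IsExp (((Real.pi : ℂ) / 2 * Complex.I) • seriesOp m a)
      ⟨psi m j k M, psi_mem_seriesDomain hm j hM⟩
      (Complex.I ^ seriesSum m a (casimirLevel m k) •
        ⟨psi m j k M, psi_mem_seriesDomain hm j hM⟩) := by
  rw [← exp_pi_div_two_mul_I_mul]
  refine isExp_of_eigenvector ?_
  rw [LinearMap.smul_apply, seriesOp_psi hm a j hM, smul_smul]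

/-- The eigenvalue of `e^{iπ/2 F(√C)} e^{iπ/2 (h - m/2)}` on `ψ_{j,k,ℓ}`. -/
def expEigenvalue (m : ℕ) (a : ℕ → Fin 4) (j k : ℕ) : ℂ :=
  Complex.I ^ (k + j + seriesSum m a (casimirLevel m k))

theorem IsExpOperator.apply_psi (hm : 1 ≤ m) (hT : IsExpOperator B a T) (j k : ℕ) (l : ι k) :
    T (psi m j k (B k l : CliffordPoly m)) =
      expEigenvalue m a j k • psi m j k (B k l : CliffordPoly m) := by
  obtain ⟨u, w, hu, hw, h⟩ := hT.exp_apply _ (psi_basis_mem_psiSpan j k l)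
  -- The space is Hausdorff, so the exponential series determines u, and likewise w below.
  have hu' : u = Complex.I ^ (k + j) • ⟨psi m j k (B k l : CliffordPoly m),
      psi_mem_seriesDomain hm j (B k l).2⟩ :=
    Subtype.ext (HasSum.unique hu (isExp_hOp_psi hm j (B k l).2))
  rw [hu'] at hw
  rw [h, HasSum.unique hw ((isExp_seriesOp_psi hm a j (B k l).2).smul _), smul_smul, ← pow_add]
  rfl

theorem isExpOperator_of_apply_psi (hm : 1 ≤ m) (hc : Continuous T)
    (hT : ∀ j k l, T (psi m j k (B k l : CliffordPoly m)) =
      expEigenvalue m a j k • psi m j k (B k l : CliffordPoly m)) : IsExpOperator B a T := by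
  refine ⟨hc, fun v hv => ?_⟩
  induction hv using Submodule.span_induction with
  | mem v hv =>
    obtain ⟨j, k, l, rfl⟩ := hv
    refine ⟨_, _, isExp_hOp_psi hm j (B k l).2,
      (isExp_seriesOp_psi hm a j (B k l).2).smul (Complex.I ^ (k + j)), ?_⟩
    rw [hT, smul_smul, ← pow_add]
    rfl
  | zero => exact ⟨0, 0, isExp_zero _, isExp_zero _, map_zero T⟩
  | add v v' _ _ h h' =>
    obtain ⟨u, w, h1, h2, h3⟩ := h
    obtain ⟨u', w', h1', h2', h3'⟩ := h'
    exact ⟨u + u', w + w', h1.add h1', h2.add h2', by rw [map_add, h3, h3', Submodule.coe_add]⟩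
  | smul z v _ h =>
    obtain ⟨u, w, h1, h2, h3⟩ := h
    exact ⟨z • u, z • w, h1.smul z, h2.smul z, by rw [map_smul, h3, Submodule.coe_smul]⟩

variable (B a) in
theorem exists_isExpOperator (hm : 1 ≤ m) : ∃ T, IsExpOperator B a T := by
  obtain ⟨T, hc, hT⟩ := exists_continuous_diagonal B (μ := expEigenvalue m a) hm fun j k => by
    rw [expEigenvalue, norm_pow, Complex.norm_I, one_pow]
  exact ⟨T, isExpOperator_of_apply_psi hm hc hT⟩

theorem IsExpOperator.eq (hm : 1 ≤ m) {T' : Module.End ℂ (CliffordSchwartz m)}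
    (hT : IsExpOperator B a T) (hT' : IsExpOperator B a T') : T = T' :=
  eq_of_continuous_of_eq_on_psi (B := B) hm hT.continuous hT'.continuous fun j k l => by
    rw [hT.apply_psi hm, hT'.apply_psi hm]

theorem bPlus_eq : bPlus m = ((Real.sqrt 2 / 2 : ℝ) : ℂ) • (vecVar m - dirac m) := rfl

theorem vecVar_eq : vecVar m = ((Real.sqrt 2 / 2 : ℝ) : ℂ) • (bPlus m - bMinus m) :=
  LinearMap.ext vecVar_eq_bPlus_sub_bMinus

theorem dirac_eq : dirac m = (-((Real.sqrt 2 / 2 : ℝ) : ℂ)) • (bPlus m + bMinus m) := by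
  refine LinearMap.ext fun F => ?_
  rw [LinearMap.smul_apply, LinearMap.add_apply, bPlus_apply, bMinus_apply, ← smul_neg, ← smul_add,
    smul_smul, neg_mul, sqrt_two_div_two_mul_self]
  module

theorem CliffordHelmholtz.mul_bPlus (h : CliffordHelmholtz T) :
    T * bPlus m = Complex.I • (bPlus m * T) := by
  rw [bPlus_eq, mul_smul_comm, mul_sub, h.1, h.2, smul_mul_assoc, sub_mul]
  module

/-- In the ladder basis the relations (I) become diagonal: T multiplies b⁺ by i and b⁻ by -i. In
this form they can be read off from the eigenvalues. -/
theorem cliffordHelmholtz_of_ladder (h : T * bPlus m = Complex.I • (bPlus m * T))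
    (h' : T * bMinus m = (-Complex.I) • (bMinus m * T)) : CliffordHelmholtz T := by
  constructor
  · rw [vecVar_eq, dirac_eq, mul_smul_comm, mul_add, h, h', smul_mul_assoc, sub_mul]
    module
  · rw [vecVar_eq, dirac_eq, mul_smul_comm, mul_sub, h, h', smul_mul_assoc, add_mul]
    module

theorem IsExpOperator.cliffordHelmholtz (hm : 1 ≤ m) (hT : IsExpOperator B a T) :
    CliffordHelmholtz T := by
  refine cliffordHelmholtz_of_ladder ?_ ?_
  · refine eq_of_continuous_of_eq_on_psi (B := B) hm (hT.continuous.comp continuous_bPlus)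
      ((continuous_bPlus.comp hT.continuous).const_smul Complex.I) fun j k l => ?_
    rw [LinearMap.smul_apply, Module.End.mul_apply, Module.End.mul_apply, hT.apply_psi hm,
      map_smul, ← psi_succ hm j (B k l).2, hT.apply_psi hm, smul_smul, expEigenvalue, expEigenvalue]
    congr 1
    ring
  · refine eq_of_continuous_of_eq_on_psi (B := B) hm (hT.continuous.comp continuous_bMinus)
      ((continuous_bMinus.comp hT.continuous).const_smul (-Complex.I)) fun j k l => ?_
    rw [LinearMap.smul_apply, Module.End.mul_apply, Module.End.mul_apply, hT.apply_psi hm,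
      map_smul, bMinus_psi hm j (B k l).2, map_smul, hT.apply_psi hm]
    -- For j = 0 both sides vanish; otherwise lowering j divides the eigenvalue by i and leaves k,
    -- hence the value of F, unchanged.
    rcases j with _ | j
    · simp only [ladderCoeff_zero, zero_smul, smul_zero]
    · rw [Nat.add_sub_cancel, smul_smul, smul_smul, smul_smul, expEigenvalue, expEigenvalue,
        show k + (j + 1) + seriesSum m a (casimirLevel m k) =
          k + j + seriesSum m a (casimirLevel m k) + 1 by ring, pow_succ _ (_ + _)]
      congr 1
      linear_combination (ladderCoeff (k + m / 2) (j + 1) *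
        Complex.I ^ (k + j + seriesSum m a (casimirLevel m k))) * Complex.I_mul_I

theorem IsExpOperator.diagonalOnPsi (hm : 1 ≤ m) (hT : IsExpOperator B a T) : DiagonalOnPsi B T :=
  ⟨expEigenvalue m a, hT.apply_psi hm⟩

theorem pow_four_apply_of_eigenvector {v : CliffordSchwartz m} {c : ℂ} (h : T v = c • v) :
    (T ^ 4) v = c ^ 4 • v := by
  simp only [pow_succ, pow_zero, one_mul, Module.End.mul_apply, h, map_smul, smul_smul,
    mul_assoc]

theorem IsExpOperator.pow_four (hm : 1 ≤ m) (hT : IsExpOperator B a T) : T ^ 4 = 1 := by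
  refine eq_of_continuous_of_eq_on_psi (B := B) hm ?_ continuous_id fun j k l => ?_
  · rw [Module.End.coe_pow]
    exact hT.continuous.iterate 4
  · rw [pow_four_apply_of_eigenvector (hT.apply_psi hm j k l), expEigenvalue, ← pow_mul, mul_comm,
      pow_mul, Complex.I_pow_four, one_pow, one_smul, Module.End.one_apply]

theorem exists_eq_I_pow {z : ℂ} (h : z ^ 4 = 1) : ∃ n : ℕ, z = Complex.I ^ n := by
  -- The factorization of z⁴ - 1.
  have h1 : (z - 1) * (z + 1) * ((z - Complex.I) * (z + Complex.I)) = 0 := by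
    linear_combination h + (1 - z ^ 2) * Complex.I_sq
  rcases mul_eq_zero.mp h1 with h1 | h1 <;> rcases mul_eq_zero.mp h1 with h1 | h1
  · exact ⟨0, by rw [pow_zero, sub_eq_zero.mp h1]⟩
  · exact ⟨2, by rw [Complex.I_sq, eq_neg_of_add_eq_zero_left h1]⟩
  · exact ⟨1, by rw [pow_one, sub_eq_zero.mp h1]⟩
  · exact ⟨3, by rw [Complex.I_pow_three, eq_neg_of_add_eq_zero_left h1]⟩

theorem CliffordHelmholtz.apply_psi (hm : 1 ≤ m) (h : CliffordHelmholtz T) {c : ℂ} {k : ℕ}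
    {M : CliffordPoly m} (hM : M ∈ monogenics m k) (h0 : T (psi m 0 k M) = c • psi m 0 k M)
    (j : ℕ) : T (psi m j k M) = (c * Complex.I ^ j) • psi m j k M := by
  induction j with
  | zero => rw [h0, pow_zero, mul_one]
  | succ j ih =>
    rw [psi_succ hm j hM, ← Module.End.mul_apply, h.mul_bPlus, LinearMap.smul_apply,
      Module.End.mul_apply, ih, map_smul, smul_smul, pow_succ]
    congr 1
    ring

/-- Only μ_{0,k} is free: commutation with b⁺ fixes the remaining eigenvalues, and T⁴ = 1 makes it a
fourth root of unity once some ψ_{0,k,ℓ} is nonzero. -/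
theorem exists_I_pow_of_diagonal (hm : 1 ≤ m) (h : CliffordHelmholtz T) (hd : DiagonalOnPsi B T)
    (h4 : T ^ 4 = 1) (k : ℕ) : ∃ n : ℕ, ∀ (j : ℕ) (l : ι k),
      T (psi m j k (B k l : CliffordPoly m)) =
        Complex.I ^ (n + j) • psi m j k (B k l : CliffordPoly m) := by
  obtain ⟨μ, hμ⟩ := hd
  -- This also covers degrees without monogenics, such as k ≥ 1 for m = 1, where μ is not
  -- constrained and any exponent works.
  by_cases h0 : ∀ l, psi m 0 k (B k l : CliffordPoly m) = 0
  · refine ⟨0, fun j l => ?_⟩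
    rw [pow_add, pow_zero]
    exact h.apply_psi hm (B k l).2 (by rw [h0, map_zero, smul_zero]) j
  · push Not at h0
    obtain ⟨l, hl⟩ := h0
    have h1 := pow_four_apply_of_eigenvector (hμ 0 k l)
    rw [h4, Module.End.one_apply] at h1
    have h2 : μ 0 k ^ 4 = 1 := by
      refine smul_left_injective ℂ hl ?_
      simp only [← h1, one_smul]
    obtain ⟨n, hn⟩ := exists_eq_I_pow h2
    refine ⟨n, fun j l => ?_⟩
    rw [pow_add, ← hn]
    exact h.apply_psi hm (B k l).2 (hμ 0 k l) j

theorem I_pow_eq_I_pow {n n' : ℕ} (h : (n : ZMod 4) = n') : Complex.I ^ n = Complex.I ^ n' := by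
  rw [Complex.I_pow_eq_pow_mod n, Complex.I_pow_eq_pow_mod n',
    (ZMod.natCast_eq_natCast_iff' n n' 4).mp h]

theorem exists_equivalent_isExpOperator (hm : 1 ≤ m) (h : CliffordHelmholtz T)
    (hd : DiagonalOnPsi B T) (h4 : T ^ 4 = 1) :
    ∃ (a : ℕ → Fin 4) (T' : Module.End ℂ (CliffordSchwartz m)),
      IsExpOperator B a T' ∧ EquivalentOnPsi B T T' := by
  choose n hn using exists_I_pow_of_diagonal hm h hd h4
  -- The eigenvalue exponent of T_a at j = 0 is k + F, so F must be congruent to n_k - k at the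
  -- point N = k + ⌊(m-1)/2⌋. Smaller N belong to no k, and the value that truncated subtraction
  -- assigns there is irrelevant.
  obtain ⟨a, ha⟩ := exists_seriesSum_eq m fun N =>
    (n (N - (m - 1) / 2) : ZMod 4) - ((N - (m - 1) / 2 : ℕ) : ZMod 4)
  obtain ⟨T', hT'⟩ := exists_isExpOperator B a hm
  refine ⟨a, T', hT', fun j k l => ?_⟩
  rw [hn, hT'.apply_psi hm, expEigenvalue]
  congr 1
  refine I_pow_eq_I_pow ?_
  have hk := ha (casimirLevel m k)
  rw [casimirLevel, Nat.add_sub_cancel] at hk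
  push_cast
  rw [casimirLevel, hk]
  ring

end Operators

end CliffordFT

end

theorem theorem3p4 (m : ℕ) (hm : 1 ≤ m) {ι : ℕ → Type*}
    (B : ∀ k, Module.Basis (ι k) ℂ (monogenics m k)) :
    (∀ a : ℕ → Fin 4,
      (∃! T : Module.End ℂ (CliffordSchwartz m), IsExpOperator B a T) ∧
      ∀ T : Module.End ℂ (CliffordSchwartz m), IsExpOperator B a T →
        CliffordHelmholtz T ∧ DiagonalOnPsi B T ∧ T ^ 4 = 1) ∧
    (∀ T : Module.End ℂ (CliffordSchwartz m),
      CliffordHelmholtz T → DiagonalOnPsi B T → T ^ 4 = 1 →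
        ∃ (a : ℕ → Fin 4) (T' : Module.End ℂ (CliffordSchwartz m)),
          IsExpOperator B a T' ∧ EquivalentOnPsi B T T' ∧ (Continuous T → T = T')) := by
  refine ⟨fun a => ⟨?_, fun T hT => ⟨hT.cliffordHelmholtz hm, hT.diagonalOnPsi hm,
    hT.pow_four hm⟩⟩, fun T h hd h4 => ?_⟩
  · obtain ⟨T, hT⟩ := exists_isExpOperator B a hm
    exact ⟨T, hT, fun T' hT' => hT'.eq hm hT⟩
  · obtain ⟨a, T', hT', he⟩ := exists_equivalent_isExpOperator hm h hd h4
    exact ⟨a, T', hT', he, fun hc => eq_of_continuous_of_eq_on_psi hm hc hT'.continuous he⟩
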